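/- Let $n\ge 1$, let $\mathbb B^n\subset\mathbb C^n$ be the unit ball, and for $z,w\in\mathbb B^n$ put $z\cdot\bar w=\sum_i z_i\bar w_i$. Let $\mathcal K(z,w)=\frac{n!}{\pi^n}(1-z\cdot\bar w)^{-(n+1)}$ be the Bergman kernel, $dV=\mathcal K(z,z)\,dV_e$ the invariant volume ($dV_e$ is Lebesgue measure), and $\tau$ the complex hyperbolic distance, $\cosh^2\frac{\tau(z,w)}2=\frac{|1-z\cdot\bar w|^2}{(1-|z|^2)(1-|w|^2)}$; for sets put $\mathrm{dist}(A,B)=\inf\{\tau(z,w): z\in A, w\in B\}$. Let $c(k)$ be the constant with $c(k)\int_{\mathbb B^n}\mathcal K(z,w)^k\mathcal K(w,z)^k\mathcal K(w,w)^{-k}dV(w)=\mathcal K(z,z)^k$. Let $\Gamma\subset SU(n,1)$ be a discrete subgroup, regarded as a group of automorphisms of $\mathbb B^n$ (a matrix is identified with the fractional linear map it defines), acting freely and with compact quotient; let $\rho:\Gamma\to U(m)$ be a unitary representation, $j\in\{1,\dots,m\}$, and let $J(\gamma,z)$ be the complex Jacobian determinant of $\gamma$ at $z$. Let $\mathcal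 F=\{z:\tau(z,z_0)<\tau(z,\gamma z_0)\ \forall\gamma\in\Gamma,\gamma\ne \mathrm{id}\}$ be a Dirichlet fundamental domain. For $k\in\mathbb N$ and $p\in\mathbb B^n$ put $$\Theta_p^{(j;k)}(z)=c(k)\sum_{\gamma\in\Gamma}\rho(\gamma^{-1})\,\mathcal K(\gamma z,p)^k e_j\,J(\gamma,z)^k ,$$ for a submanifold $\Lambda$ with a volume form $\nu$ put $\Theta_\Lambda^{(j;k)}(z)=\int_\Lambda \Theta_p^{(j;k)}(z)\,\mathcal K(p,p)^{-k/2}\nu(p)$, and put $(F,G)=\int_{\mathcal F}F(z)^T\overline{G(z)}\,\mathcal K(z,z)^{-k}dV(z)$. Let $X,Y$ be smooth embedded submanifolds of $\mathbb B^n$ of real dimensions $q_X,q_Y>0$, with $Y\subset X\subset\mathcal F$, and let $\nu_X,\nu_Y$ be positive (nowhere vanishing) volume forms on them with $0<\int_X\nu_X<\infty$, $0<\int_Y\nu_Y<\infty$. Suppose that $X$ is relatively compact in a $q_X$-dimensional submanifold of $\mathbb B^n$ to which $\nu_X$ extends as a positive volume form (which is automatic if $X$ is compact), and that $\mathrm{dist}(X,\partial\mathcal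 F)>0$. (i) If $q_X\le n$, then there is a constant $C=C(n,X,Y,\nu_X,\nu_Y)$, independent of $\Gamma,\mathcal F,\rho,m,j$, such that for all sufficiently large $k$ $$\bigl|(\Theta_X^{(j;k)},\Theta_Y^{(j;k)})\bigr|\le C\,k^{\,n-q_X/2}.$$ (ii) If $X\subset\{z\in\mathbb B^n: \operatorname{Im}z_1=\dots=\operatorname{Im}z_n=0\}$, then there is a constant $C=C(n,X,Y,\nu_X,\nu_Y)>0$, independent of $\Gamma,\mathcal F,\rho,m,j$, such that $$\lim_{k\to\infty}\frac{(\Theta_X^{(j;k)},\Theta_Y^{(j;k)})}{C\,k^{\,n-q_X/2}}=1 .$$ -/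

import Mathlib

open MeasureTheory Filter Topology
open scoped ContDiff ENNReal Matrix

noncomputable section

namespace BallQuotient

/-- `ℂⁿ` with its Euclidean norm. -/
abbrev E (n : ℕ) : Type := EuclideanSpace ℂ (Fin n)

/-- The open unit ball of `ℂⁿ`. -/
abbrev Ball (n : ℕ) : Type := Metric.ball (0 : E n) 1

/-- The centre of the ball. -/
def origin (n : ℕ) : Ball n := ⟨0, by simp⟩

instance (n : ℕ) : Nonempty (Ball n) := ⟨origin n⟩

/-! ### The group `SU(n,1)` and its action on the ball -/

/-- `σ = diag(1, …, 1, -1)`. -/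
def sig (n : ℕ) : Matrix (Fin n ⊕ Unit) (Fin n ⊕ Unit) ℂ :=
  Matrix.diagonal (Sum.elim (fun _ => 1) (fun _ => -1))

/-- `SU(n,1) = {A ∈ SL(n+1, ℂ) | Aᵀ σ Ā = σ}`. -/
def SU (n : ℕ) : Subgroup (Matrix.SpecialLinearGroup (Fin n ⊕ Unit) ℂ) where
  carrier := {A | A.1ᵀ * sig n * A.1.map (starRingEnd ℂ) = sig n}
  one_mem' := by
    simp [Matrix.map_one]
  mul_mem' := by
    intro A B hA hB
    simp only [Set.mem_ofPred_eq] at hA hB ⊢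
    rw [Matrix.SpecialLinearGroup.coe_mul, Matrix.transpose_mul, Matrix.map_mul]
    calc _ = B.1ᵀ * (A.1ᵀ * sig n *
            A.1.map (starRingEnd ℂ)) * B.1.map (starRingEnd ℂ) := by
          simp only [Matrix.mul_assoc]
      _ = _ := by rw [hA, hB]
  inv_mem' := by
    intro A hA
    simp only [Set.mem_ofPred_eq] at hA ⊢
    have h1 : A.1 * (A⁻¹).1 = 1 := by
      rw [← Matrix.SpecialLinearGroup.coe_mul, mul_inv_cancel, Matrix.SpecialLinearGroup.coe_one]
    have h2 : (A⁻¹).1ᵀ * A.1ᵀ = 1 := by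
      rw [← Matrix.transpose_mul, h1, Matrix.transpose_one]
    have h3 : A.1.map (starRingEnd ℂ) *
        (A⁻¹).1.map (starRingEnd ℂ) = 1 := by
      rw [← Matrix.map_mul, h1, Matrix.map_one _ (map_zero _) (map_one _)]
    calc _ = (A⁻¹).1ᵀ *
            (A.1ᵀ * sig n * A.1.map (starRingEnd ℂ)) *
            (A⁻¹).1.map (starRingEnd ℂ) := by
          rw [hA]
      _ = ((A⁻¹).1ᵀ * A.1ᵀ) * sig n *
            (A.1.map (starRingEnd ℂ) *
            (A⁻¹).1.map (starRingEnd ℂ)) := by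
          simp only [Matrix.mul_assoc]
      _ = _ := by rw [h2, h3, Matrix.one_mul, Matrix.mul_one]

/-- The matrix of an element of `SU(n,1)`. -/
def mat {n : ℕ} (A : SU n) : Matrix (Fin n ⊕ Unit) (Fin n ⊕ Unit) ℂ := A.1.1

/-- The homogeneous coordinates `(z₁, …, zₙ, 1)`. -/
def lift {n : ℕ} (z : E n) : Fin n ⊕ Unit → ℂ := Sum.elim (fun i => z i) (fun _ => 1)

/-- The numerators `a_{i1} z₁ + … + a_{in} zₙ + a_{i,n+1}`. -/
def num {n : ℕ} (A : SU n) (z : E n) : E n :=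
  WithLp.toLp 2 fun i => ((mat A) *ᵥ lift z) (Sum.inl i)

/-- The denominator `a_{n+1,1} z₁ + … + a_{n+1,n} zₙ + a_{n+1,n+1}`. -/
def den {n : ℕ} (A : SU n) (z : E n) : ℂ :=
  ((mat A) *ᵥ lift z) (Sum.inr ())

/-- The fractional linear transformation of `A`. -/
def frac {n : ℕ} (A : SU n) (z : E n) : E n := (den A z)⁻¹ • num A z

lemma form_eq {n : ℕ} (v : Fin n ⊕ Unit → ℂ) :
    v ⬝ᵥ (sig n *ᵥ (star v)) = ((∑ i, ‖v (Sum.inl i)‖ ^ 2 - ‖v (Sum.inr ())‖ ^ 2 : ℝ) : ℂ) := by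
  simp [sig, dotProduct, Matrix.mulVec_diagonal, Complex.mul_conj, Complex.normSq_eq_norm_sq,
    sub_eq_add_neg]

lemma form_mulVec {n : ℕ} (A : SU n) (v : Fin n ⊕ Unit → ℂ) :
    ((mat A) *ᵥ v) ⬝ᵥ (sig n *ᵥ (star ((mat A) *ᵥ v))) =
      v ⬝ᵥ (sig n *ᵥ (star v)) := by
  have h : (mat A)ᵀ * sig n * (mat A).map (starRingEnd ℂ) = sig n := A.2
  have hs : star ((mat A) *ᵥ v) =
      (mat A).map (starRingEnd ℂ) *ᵥ star v := by
    funext i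
    simp [Matrix.mulVec, dotProduct]
  rw [hs]
  conv_rhs => rw [← h]
  rw [← Matrix.mulVec_mulVec, ← Matrix.mulVec_mulVec]
  conv_rhs => rw [Matrix.dotProduct_mulVec, Matrix.vecMul_transpose]

lemma norm_num_sub {n : ℕ} (A : SU n) (z : E n) :
    ‖num A z‖ ^ 2 - ‖den A z‖ ^ 2 = ‖z‖ ^ 2 - 1 := by
  have h := form_mulVec A (lift z)
  rw [form_eq, form_eq] at h
  have h' := Complex.ofReal_injective h
  simpa [EuclideanSpace.norm_sq_eq, num, den, lift] using h'

lemma den_ne_zero {n : ℕ} (A : SU n) (z : Ball n) : den A z.1 ≠ 0 := by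
  intro h
  have h1 := norm_num_sub A z.1
  have h2 : ‖z.1‖ < 1 := mem_ball_zero_iff.1 z.2
  rw [h, norm_zero] at h1
  nlinarith [norm_nonneg z.1, sq_nonneg ‖num A z.1‖]

lemma frac_mem {n : ℕ} (A : SU n) (z : Ball n) : frac A z.1 ∈ Metric.ball (0 : E n) 1 := by
  have h1 := norm_num_sub A z.1
  have h2 : ‖z.1‖ < 1 := mem_ball_zero_iff.1 z.2
  have h3 : 0 < ‖den A z.1‖ := norm_pos_iff.2 (den_ne_zero A z)
  have h4 : ‖num A z.1‖ < ‖den A z.1‖ := by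
    apply lt_of_pow_lt_pow_left₀ 2 h3.le
    nlinarith [norm_nonneg z.1]
  rw [mem_ball_zero_iff, frac, norm_smul, norm_inv, inv_mul_lt_iff₀ h3]
  simpa using h4

lemma mulVec_lift {n : ℕ} (A : SU n) (z : Ball n) :
    (mat A) *ᵥ lift z.1 = den A z.1 • lift (frac A z.1) := by
  have h := den_ne_zero A z
  funext i
  rcases i with i | i
  · simp [lift, frac, num, mul_inv_cancel_left₀ h]
  · simp [lift, den]

/-- `SU(n,1)` acts on the ball by fractional linear transformations. -/
instance instMulActionBall (n : ℕ) : MulAction (SU n) (Ball n) where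
  smul A z := ⟨frac A z.1, frac_mem A z⟩
  one_smul z := by
    apply Subtype.ext
    change frac 1 z.1 = z.1
    ext i
    simp [frac, num, den, lift, mat]
  mul_smul A B z := by
    apply Subtype.ext
    change frac (A * B) z.1 = frac A (frac B z.1)
    have hB := den_ne_zero B z
    have key : (mat (A * B)) *ᵥ lift z.1 =
        den B z.1 • ((mat A) *ᵥ lift (frac B z.1)) := by
      rw [← Matrix.mulVec_smul, ← mulVec_lift, Matrix.mulVec_mulVec]
      rfl
    ext i
    have e1 : num (A * B) z.1 i = den B z.1 * num A (frac B z.1) i := congrFun key (Sum.inl i)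
    have e2 : den (A * B) z.1 = den B z.1 * den A (frac B z.1) := congrFun key (Sum.inr ())
    change (den (A * B) z.1)⁻¹ * num (A * B) z.1 i =
      (den A (frac B z.1))⁻¹ * num A (frac B z.1) i
    rw [e1, e2, mul_inv]
    field_simp

/-- The group of automorphisms of the ball given by a subgroup of `SU(n,1)`: a matrix and the
automorphism that it represents are identified, so scalar matrices count as the identity. -/
def autGroup {n : ℕ} (Γ : Subgroup (SU n)) : Subgroup (Equiv.Perm (Ball n)) :=
  Γ.map (MulAction.toPermHom (SU n) (Ball n))

/-- The complex Jacobian determinant `J(g, z)` of a self-map of the ball. -/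
def jac {n : ℕ} (g : Equiv.Perm (Ball n)) (z : Ball n) : ℂ := by
  classical exact
    (fderiv ℂ (fun w : E n => if h : w ∈ Metric.ball (0 : E n) 1 then ((g ⟨w, h⟩ : Ball n) : E n)
      else 0) z.1).det

/-- `Γ` is a discrete subgroup of `SU(n,1)` with smooth compact quotient `Γ \ 𝔹ⁿ`: it is discrete,
its automorphisms other than the identity have no fixed points, and the quotient is compact. -/
structure IsSmoothCocompact {n : ℕ} (Γ : Subgroup (SU n)) : Prop where
  discrete : DiscreteTopology Γ
  free : ∀ g ∈ autGroup Γ, g ≠ 1 → ∀ z : Ball n, g z ≠ z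
  compact : CompactSpace (Quotient (MulAction.orbitRel (autGroup Γ) (Ball n)))

/-! ### Complex hyperbolic distance and Dirichlet domains -/

/-- Complex hyperbolic distance:
`cosh² (τ(z,w)/2) = |1 - z·w̄|² / ((1 - |z|²)(1 - |w|²))`, where `z·w̄ = inner ℂ w z`. -/
def tau {n : ℕ} (z w : Ball n) : ℝ :=
  2 * Real.arcosh (‖1 - inner ℂ (w : E n) (z : E n)‖ /
    Real.sqrt ((1 - ‖(z : E n)‖ ^ 2) * (1 - ‖(w : E n)‖ ^ 2)))

/-- `dist(A, B) = inf {τ(z,w) | z ∈ A, w ∈ B}`, infinite if `A` or `B` is empty. -/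
def setDist {n : ℕ} (A B : Set (Ball n)) : ℝ≥0∞ :=
  ⨅ z ∈ A, ⨅ w ∈ B, ENNReal.ofReal (tau z w)

/-- The Dirichlet fundamental domain of `Γ` centred at `z₀`. -/
def dirichlet {n : ℕ} (Γ : Subgroup (SU n)) (z₀ : Ball n) : Set (Ball n) :=
  {z | ∀ g ∈ autGroup Γ, g ≠ 1 → tau z z₀ < tau z (g z₀)}

/-! ### Bergman kernel, Poincaré series, inner product -/

/-- The Bergman kernel `K(z,w) = (n!/πⁿ) (1 - z·w̄)^{-(n+1)}` of the ball. -/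
def bergman {n : ℕ} (z w : Ball n) : ℂ :=
  ((n.factorial : ℝ) / Real.pi ^ n : ℝ) / (1 - inner ℂ (w : E n) (z : E n)) ^ (n + 1)

/-- The positive real number `K(z,z)`. -/
def bergmanDiag {n : ℕ} (z : Ball n) : ℝ := (bergman z z).re

/-- The invariant volume `dV = K(z,z) dV_e`, where `dV_e` is Lebesgue measure on the ball. -/
def invVol (n : ℕ) : Measure (Ball n) :=
  ((volume : Measure (E n)).comap Subtype.val).withDensity fun z => ENNReal.ofReal (bergmanDiag z)

/-- The constant `c(𝔹ⁿ, k)` that makes `c K(z,w)^k` the reproducing kernel of the holomorphic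
functions with `∫ |f|² K(z,z)^{-k} dV < ∞`; it is determined by
`c ∫ K(z,w)^k K(w,z)^k K(w,w)^{-k} dV(w) = K(z,z)^k`, here at `z = 0`. -/
def kernelConst (n k : ℕ) : ℂ :=
  bergman (origin n) (origin n) ^ k /
    ∫ w, bergman (origin n) w ^ k * bergman w (origin n) ^ k / bergman w w ^ k ∂(invVol n)

/-- `Θ̂^{(j;k)}(z,p) = Θ_p^{(j;k)}(z) = c ∑_{γ ∈ Γ} ρ(γ⁻¹) (K(γz,p)^k e_j) J(γ,z)^k`. -/
def thetaPoint {n m : ℕ} (Γ : Subgroup (SU n)) (ρ : autGroup Γ →* Matrix.unitaryGroup (Fin m) ℂ)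
    (j : Fin m) (k : ℕ) (z p : Ball n) : Fin m → ℂ :=
  kernelConst n k • ∑' γ : autGroup Γ,
    jac γ.1 z ^ k • ((ρ γ⁻¹ : Matrix (Fin m) (Fin m) ℂ) *ᵥ Pi.single j (bergman (γ.1 z) p ^ k))

/-- `Θ_Λ^{(j;k)}(z) = ∫_Λ Θ̂^{(j;k)}(z,p) K(p,p)^{-k/2} ν(p)`; here `ν` is carried by `Λ`. -/
def theta {n m : ℕ} (Γ : Subgroup (SU n)) (ρ : autGroup Γ →* Matrix.unitaryGroup (Fin m) ℂ)
    (ν : Measure (Ball n)) (j : Fin m) (k : ℕ) (z : Ball n) : Fin m → ℂ :=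
  ∫ p, (bergmanDiag p ^ (-(k : ℝ) / 2)) • thetaPoint Γ ρ j k z p ∂ν

/-- `(F, G) = ∫_{Γ \ 𝔹ⁿ} F(z)ᵀ conj(G(z)) K(z,z)^{-k} dV`, the integral being taken over a
fundamental domain `S`. -/
def innerProd {n m : ℕ} (S : Set (Ball n)) (k : ℕ) (F G : Ball n → Fin m → ℂ) : ℂ :=
  ∫ z in S, (F z ⬝ᵥ star (G z)) * ((bergmanDiag z ^ k)⁻¹ : ℝ) ∂(invVol n)

/-! ### Submanifolds and volume forms -/

/-- A smooth local parametrization `φ : U → X` of a `q`-dimensional embedded submanifold `X`. -/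
structure IsLocalParam {n : ℕ} (q : ℕ) (X : Set (Ball n)) (U : Set (EuclideanSpace ℝ (Fin q)))
    (φ : EuclideanSpace ℝ (Fin q) → Ball n) : Prop where
  isOpen : IsOpen U
  smooth : ContDiffOn ℝ ∞ (fun t => (φ t : E n)) U
  immersion : ∀ t ∈ U, Function.Injective (fderiv ℝ (fun t => (φ t : E n)) t)
  embedding : IsEmbedding (U.domRestrict φ)
  image : ∃ V : Set (Ball n), IsOpen V ∧ φ '' U = X ∩ V

/-- `X` is a (smooth, embedded) `q`-dimensional submanifold of the ball. -/
def IsSubmanifold {n : ℕ} (q : ℕ) (X : Set (Ball n)) : Prop :=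
  ∀ x ∈ X, ∃ U φ, IsLocalParam q X U φ ∧ x ∈ φ '' U

/-- A volume form on `X` is used only to integrate functions over `X`, for the orientation that it
defines. It is given here by the corresponding measure `A ↦ ∫_{A ∩ X} ν`: in local parametrizations
it is `f(t) dt₁ ⋯ dt_q` with a smooth function `f > 0`. -/
def IsVolumeForm {n : ℕ} (q : ℕ) (X : Set (Ball n)) (ν : Measure (Ball n)) : Prop :=
  ν Xᶜ = 0 ∧ ∀ x ∈ X, ∃ U φ, IsLocalParam q X U φ ∧ x ∈ φ '' U ∧
    ∃ f : EuclideanSpace ℝ (Fin q) → ℝ, ContDiffOn ℝ ∞ f U ∧ (∀ t ∈ U, 0 < f t) ∧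
      ν.restrict (φ '' U) =
        ((volume.restrict U).withDensity fun t => ENNReal.ofReal (f t)).map φ

/-- `(X, ν)` is smooth up to its ends: `X` is relatively compact in a `q`-dimensional submanifold
`Z` of the ball, and `ν` is the restriction of a volume form of `Z`. For compact `X` one may take
`Z = X`. -/
def IsRegularUpToEnds {n : ℕ} (q : ℕ) (X : Set (Ball n)) (ν : Measure (Ball n)) : Prop :=
  ∃ (Z : Set (Ball n)) (νZ : Measure (Ball n)), IsSubmanifold q Z ∧ IsVolumeForm q Z νZ ∧
    IsCompact (closure X) ∧ closure X ⊆ Z ∧ ν = νZ.restrict X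

end BallQuotient

end

/-!
Normalizing the terms of the Poincaré series by `K(z,z)^{-k/2} K(p,p)^{-k/2}` turns their moduli
into `cosh^{-(n+1)k}(τ(γz,p)/2)`. Unfolding the integral over the Dirichlet domain to the ball and
applying the reproducing property of `K^k` writes `(Θ_X, Θ_Y)` as `c(k)`, which grows like
`((n+1)ⁿ/n!) kⁿ`, times a double integral over `X × Y` of a sum over `γ`. Since `X` stays away
from the boundary of the Dirichlet domain, the points `γy` with `γ ≠ 1` and `y ∈ Y` keep a positive
distance from `X`, and their contribution decays exponentially. For `γ = 1` the modulus is at most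
`exp(-k|x-y|²/10)`, and Laplace's method on `X` gives a multiple of `k^{-q_X/2}`; if the pairings
`x·ȳ` are real, this term equals its modulus.
-/

noncomputable section

open MeasureTheory Filter Topology
open scoped ContDiff ENNReal Matrix

namespace BallQuotient

section Overlap

variable {n : ℕ}

lemma one_sub_norm_sq_pos (z : Ball n) : 0 < 1 - ‖(z : E n)‖ ^ 2 := by
  have h : ‖(z : E n)‖ < 1 := mem_ball_zero_iff.1 z.2
  nlinarith [norm_nonneg (z : E n)]

lemma norm_inner_lt_one (z w : Ball n) : ‖inner ℂ (w : E n) (z : E n)‖ < 1 := by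
  have hz : ‖(z : E n)‖ < 1 := mem_ball_zero_iff.1 z.2
  have hw : ‖(w : E n)‖ < 1 := mem_ball_zero_iff.1 w.2
  exact (norm_inner_le_norm _ _).trans_lt (mul_lt_one_of_nonneg_of_lt_one_left (norm_nonneg _)
    hw hz.le)

lemma one_sub_inner_ne_zero (z w : Ball n) : 1 - inner ℂ (w : E n) (z : E n) ≠ 0 := by
  rw [sub_ne_zero]
  intro h
  simpa [← h] using norm_inner_lt_one z w

lemma norm_one_sub_inner_pos (z w : Ball n) : 0 < ‖1 - inner ℂ (w : E n) (z : E n)‖ :=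
  norm_pos_iff.2 (one_sub_inner_ne_zero z w)

/-- The overlap `cosh⁻² (τ(z,w)/2)` of two points of the ball; it is the power `2/(n+1)` of
`|K(z,w)| / √(K(z,z) K(w,w))`, and as a rational expression it replaces the distance `τ`
throughout. -/
def overlap (z w : Ball n) : ℝ :=
  (1 - ‖(z : E n)‖ ^ 2) * (1 - ‖(w : E n)‖ ^ 2) / ‖1 - inner ℂ (w : E n) (z : E n)‖ ^ 2

lemma overlap_pos (z w : Ball n) : 0 < overlap z w :=
  div_pos (mul_pos (one_sub_norm_sq_pos z) (one_sub_norm_sq_pos w))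
    (pow_pos (norm_one_sub_inner_pos z w) 2)

lemma overlap_comm (z w : Ball n) : overlap z w = overlap w z := by
  rw [overlap, overlap, ← RCLike.norm_conj, map_sub, map_one, inner_conj_symm,
    mul_comm (1 - ‖(z : E n)‖ ^ 2)]

lemma norm_one_sub_inner_sq {𝕜 V : Type*} [RCLike 𝕜] [SeminormedAddCommGroup V]
    [InnerProductSpace 𝕜 V] (z w : V) :
    ‖1 - inner 𝕜 w z‖ ^ 2 = (1 - ‖z‖ ^ 2) * (1 - ‖w‖ ^ 2) +
      (‖z - w‖ ^ 2 * (1 - ‖w‖ ^ 2) + ‖inner 𝕜 w (z - w)‖ ^ 2) := by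
  have hzw : ‖z - w‖ ^ 2 = ‖z‖ ^ 2 - 2 * RCLike.re (inner 𝕜 w z) + ‖w‖ ^ 2 := by
    rw [norm_sub_sq (𝕜 := 𝕜), inner_re_symm]
  have hw : inner 𝕜 w (z - w) = inner 𝕜 w z - ((‖w‖ ^ 2 : ℝ) : 𝕜) := by
    rw [inner_sub_right, inner_self_eq_norm_sq_to_K, RCLike.ofReal_pow]
  rw [hzw, hw]
  generalize inner 𝕜 w z = u
  simp only [RCLike.norm_sq_eq_def, map_sub, RCLike.one_re, RCLike.one_im, RCLike.ofReal_re,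
    RCLike.ofReal_im]
  ring

lemma inv_overlap (z w : Ball n) :
    (overlap z w)⁻¹ = 1 + (‖(z : E n) - w‖ ^ 2 * (1 - ‖(w : E n)‖ ^ 2) +
      ‖inner ℂ (w : E n) ((z : E n) - w)‖ ^ 2) /
        ((1 - ‖(z : E n)‖ ^ 2) * (1 - ‖(w : E n)‖ ^ 2)) := by
  have hz := (one_sub_norm_sq_pos z).ne'
  have hw := (one_sub_norm_sq_pos w).ne'
  rw [overlap, inv_div, norm_one_sub_inner_sq, add_div, div_self (mul_ne_zero hz hw)]

lemma one_add_norm_sub_sq_le_inv_overlap (z w : Ball n) :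
    1 + ‖(z : E n) - w‖ ^ 2 ≤ (overlap z w)⁻¹ := by
  have hz := one_sub_norm_sq_pos z
  have hw := one_sub_norm_sq_pos w
  have hzw : 0 ≤ ‖(z : E n) - w‖ ^ 2 * (1 - ‖(w : E n)‖ ^ 2) := by positivity
  rw [inv_overlap, add_le_add_iff_left, le_div_iff₀ (mul_pos hz hw)]
  nlinarith [sq_nonneg ‖(z : E n)‖, sq_nonneg ‖inner ℂ (w : E n) ((z : E n) - w)‖]

lemma overlap_le_one (z w : Ball n) : overlap z w ≤ 1 := by
  rw [← one_le_inv₀ (overlap_pos z w)]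
  linarith [one_add_norm_sub_sq_le_inv_overlap z w, sq_nonneg ‖(z : E n) - w‖]

lemma overlap_self (z : Ball n) : overlap z z = 1 := by
  simpa using inv_overlap z z

lemma overlap_origin (w : Ball n) : overlap w (origin n) = 1 - ‖(w : E n)‖ ^ 2 := by
  simp [overlap, origin]

lemma continuous_overlap : Continuous fun x : Ball n × Ball n => overlap x.1 x.2 := by
  unfold overlap
  refine Continuous.div (by fun_prop) (by fun_prop) fun x => ?_
  exact pow_ne_zero _ (norm_one_sub_inner_pos x.1 x.2).ne'

lemma continuous_overlap_left (p : Ball n) : Continuous fun w : Ball n => overlap w p := by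
  unfold overlap
  refine Continuous.div (by fun_prop) (by fun_prop) fun w => ?_
  exact pow_ne_zero _ (norm_one_sub_inner_pos w p).ne'

lemma isOpen_lt_overlap (a : ℝ) (p : Ball n) : IsOpen {w : Ball n | a < overlap w p} :=
  isOpen_lt continuous_const (continuous_overlap_left p)

lemma tau_eq_arcosh_overlap (z w : Ball n) :
    tau z w = 2 * Real.arcosh (√(overlap z w))⁻¹ := by
  rw [tau, overlap, Real.sqrt_div' _ (by positivity), Real.sqrt_sq (norm_nonneg _), inv_div]

lemma tau_lt_tau_iff (z w z' w' : Ball n) :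
    tau z w < tau z' w' ↔ overlap z' w' < overlap z w := by
  have h := overlap_pos z w
  have h' := overlap_pos z' w'
  rw [tau_eq_arcosh_overlap, tau_eq_arcosh_overlap, mul_lt_mul_iff_right₀ two_pos,
    Real.arcosh_lt_arcosh (by positivity) (by positivity),
    inv_lt_inv₀ (by positivity) (by positivity), Real.sqrt_lt_sqrt_iff h'.le]

lemma tau_lt_iff {z w : Ball n} {δ : ℝ} (hδ : 0 ≤ δ) :
    tau z w < δ ↔ (Real.cosh (δ / 2) ^ 2)⁻¹ < overlap z w := by
  have h := overlap_pos z w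
  have hc := Real.cosh_pos (δ / 2)
  rw [tau_eq_arcosh_overlap, ← lt_div_iff₀' two_pos, ← Real.arcosh_cosh (by positivity : 0 ≤ δ / 2),
    Real.arcosh_lt_arcosh (by positivity) (by positivity), Real.arcosh_cosh (by positivity),
    inv_lt_comm₀ (by positivity) hc, Real.lt_sqrt (by positivity), inv_pow]

end Overlap

section Invariance

variable {n : ℕ}

lemma coe_smul (A : SU n) (z : Ball n) : ((A • z : Ball n) : E n) = frac A z := rfl

lemma form_mulVec_mulVec (A : SU n) (v w : Fin n ⊕ Unit → ℂ) :
    (mat A *ᵥ v) ⬝ᵥ (sig n *ᵥ star (mat A *ᵥ w)) = v ⬝ᵥ (sig n *ᵥ star w) := by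
  have hA : (mat A)ᵀ * sig n * (mat A).map (starRingEnd ℂ) = sig n := A.2
  have hstar : star (mat A *ᵥ w) = (mat A).map (starRingEnd ℂ) *ᵥ star w := by
    funext i
    simp [Matrix.mulVec, dotProduct]
  conv_rhs => rw [← hA, ← Matrix.mulVec_mulVec, ← Matrix.mulVec_mulVec, Matrix.dotProduct_mulVec,
    Matrix.vecMul_transpose]
  rw [hstar]

lemma form_lift (z w : E n) : lift z ⬝ᵥ (sig n *ᵥ star (lift w)) = inner ℂ w z - 1 := by
  simp [sig, dotProduct, Matrix.mulVec_diagonal, lift, PiLp.inner_apply, sub_eq_add_neg]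

lemma one_sub_inner_smul (A : SU n) (z w : Ball n) :
    den A z * (starRingEnd ℂ) (den A w) *
      (1 - inner ℂ ((A • w : Ball n) : E n) ((A • z : Ball n) : E n)) =
      1 - inner ℂ (w : E n) (z : E n) := by
  have h := form_mulVec_mulVec A (lift z.1) (lift w.1)
  rw [mulVec_lift, mulVec_lift, form_lift, star_smul, Matrix.mulVec_smul, smul_dotProduct,
    dotProduct_smul, form_lift] at h
  simp only [smul_eq_mul, Complex.star_def] at h
  rw [coe_smul, coe_smul]
  linear_combination -h

lemma one_sub_norm_sq_smul (A : SU n) (z : Ball n) :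
    ‖den A z‖ ^ 2 * (1 - ‖((A • z : Ball n) : E n)‖ ^ 2) = 1 - ‖(z : E n)‖ ^ 2 := by
  have h := one_sub_inner_smul A z z
  rw [inner_self_eq_norm_sq_to_K, inner_self_eq_norm_sq_to_K, Complex.mul_conj,
    Complex.normSq_eq_norm_sq] at h
  apply Complex.ofReal_injective
  push_cast at h ⊢
  exact h

lemma overlap_smul_smul (A : SU n) (z w : Ball n) : overlap (A • z) (A • w) = overlap z w := by
  have hz := norm_pos_iff.2 (den_ne_zero A z)
  have hw := norm_pos_iff.2 (den_ne_zero A w)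
  have hzw := (norm_one_sub_inner_pos (A • z) (A • w)).ne'
  rw [overlap, overlap, ← one_sub_norm_sq_smul A z, ← one_sub_norm_sq_smul A w,
    ← one_sub_inner_smul A z w, norm_mul, norm_mul, RCLike.norm_conj]
  field_simp

end Invariance

section Transitivity

variable {n : ℕ}

/-- The matrix of the complex reflection `v ↦ v - 2 ⟨v, w⟩ / ⟨w, w⟩ w` in the hyperplane orthogonal
to `w` for the form `⟨v, w⟩ = vᵀ σ w̄`; it is meaningful when `⟨w, w⟩ ≠ 0`. -/
def reflection (w : Fin n ⊕ Unit → ℂ) : Matrix (Fin n ⊕ Unit) (Fin n ⊕ Unit) ℂ :=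
  1 + Matrix.vecMulVec w ((-2 / (w ⬝ᵥ (sig n *ᵥ star w))) • (sig n *ᵥ star w))

lemma reflection_mulVec (v w : Fin n ⊕ Unit → ℂ) :
    reflection w *ᵥ v =
      v - (2 * (v ⬝ᵥ (sig n *ᵥ star w)) / (w ⬝ᵥ (sig n *ᵥ star w))) • w := by
  rw [reflection, Matrix.add_mulVec, Matrix.one_mulVec, Matrix.vecMulVec_mulVec, smul_dotProduct,
    dotProduct_comm (sig n *ᵥ star w) v, op_smul_eq_smul, sub_eq_add_neg, ← neg_smul, smul_eq_mul]
  congr 2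
  ring

lemma det_reflection {w : Fin n ⊕ Unit → ℂ} (hw : w ⬝ᵥ (sig n *ᵥ star w) ≠ 0) :
    (reflection w).det = -1 := by
  rw [reflection, Matrix.vecMulVec_eq Unit, Matrix.det_one_add_replicateCol_mul_replicateRow,
    smul_dotProduct, dotProduct_comm (sig n *ᵥ star w), smul_eq_mul, div_mul_cancel₀ _ hw]
  norm_num

lemma reflection_preserves_form {w : Fin n ⊕ Unit → ℂ} (hw : w ⬝ᵥ (sig n *ᵥ star w) ≠ 0) :
    (reflection w)ᵀ * sig n * (reflection w).map (starRingEnd ℂ) = sig n := by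
  set a : Fin n ⊕ Unit → ℂ := sig n *ᵥ star w with ha
  set c : ℂ := -2 / (w ⬝ᵥ a) with hc
  have hreal : star (w ⬝ᵥ a) = w ⬝ᵥ a := by
    rw [ha, form_eq, Complex.star_def, Complex.conj_ofReal]
  have hc_real : star c = c := by
    rw [hc, star_div₀, hreal, star_neg, star_ofNat]
  have hvec : w ᵥ* sig n = star a := by
    funext i
    rcases i with i | i <;> simp [ha, sig, Matrix.mulVec_diagonal, Matrix.vecMul_diagonal]
  have hmap : (reflection w).map (starRingEnd ℂ) =
      1 + c • Matrix.vecMulVec (star w) (star a) := by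
    nth_rewrite 1 [← hc_real]
    ext i l
    simp [reflection, Matrix.vecMulVec_apply, Matrix.one_apply, apply_ite, ← ha, ← hc,
      mul_left_comm]
  have htranspose : (reflection w)ᵀ = 1 + c • Matrix.vecMulVec a w := by
    rw [reflection, Matrix.transpose_add, Matrix.transpose_one, Matrix.transpose_vecMulVec,
      Matrix.smul_vecMulVec]
  have hnorm : star a ⬝ᵥ star w = w ⬝ᵥ a := by
    rw [Matrix.star_dotProduct_star, hreal]
  have hcoeff : c + (c + c * (c * (w ⬝ᵥ a))) = 0 := by
    rw [hc, div_mul_cancel₀ _ hw]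
    ring
  rw [hmap, htranspose, Matrix.add_mul, Matrix.one_mul, Matrix.smul_mul, Matrix.vecMulVec_mul, hvec,
    Matrix.mul_add, Matrix.mul_one, Matrix.add_mul, Matrix.mul_smul, Matrix.mul_smul,
    Matrix.smul_mul, Matrix.mul_vecMulVec, ← ha, Matrix.vecMulVec_mul_vecMulVec, hnorm,
    Matrix.vecMulVec_smul, smul_smul, smul_smul, add_assoc, ← add_smul, ← add_smul]
  convert add_zero (sig n)
  convert zero_smul ℂ (Matrix.vecMulVec a (star a)) using 2
  linear_combination hcoeff

/-- The element of `SU(n,1)` obtained by composing two reflections. -/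
def reflectionMul {v w : Fin n ⊕ Unit → ℂ} (hv : v ⬝ᵥ (sig n *ᵥ star v) ≠ 0)
    (hw : w ⬝ᵥ (sig n *ᵥ star w) ≠ 0) : SU n :=
  ⟨⟨reflection v * reflection w, by
    rw [Matrix.det_mul, det_reflection hv, det_reflection hw, neg_one_mul, neg_neg]⟩, by
    change (reflection v * reflection w)ᵀ * sig n *
      (reflection v * reflection w).map (starRingEnd ℂ) = sig n
    calc _ = (reflection w)ᵀ * ((reflection v)ᵀ * sig n * (reflection v).map (starRingEnd ℂ)) *
          (reflection w).map (starRingEnd ℂ) := by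
          simp only [Matrix.transpose_mul, Matrix.map_mul, Matrix.mul_assoc]
      _ = sig n := by rw [reflection_preserves_form hv, reflection_preserves_form hw]⟩

lemma exists_mulVec_eq {v w : Fin n ⊕ Unit → ℂ} (hv : v ⬝ᵥ (sig n *ᵥ star v) ≠ 0)
    (hvw : v ⬝ᵥ (sig n *ᵥ star v) = w ⬝ᵥ (sig n *ᵥ star w))
    (hcomm : v ⬝ᵥ (sig n *ᵥ star w) = w ⬝ᵥ (sig n *ᵥ star v))
    (hadd : v ⬝ᵥ (sig n *ᵥ star v) + v ⬝ᵥ (sig n *ᵥ star w) ≠ 0) :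
    ∃ A : SU n, mat A *ᵥ v = w := by
  have hsum : (v + w) ⬝ᵥ (sig n *ᵥ star (v + w)) =
      2 * (v ⬝ᵥ (sig n *ᵥ star v) + v ⬝ᵥ (sig n *ᵥ star w)) := by
    rw [star_add, Matrix.mulVec_add, add_dotProduct, dotProduct_add, dotProduct_add, ← hcomm, ← hvw]
    ring
  have hv_neg : reflection v *ᵥ v = -v := by
    rw [reflection_mulVec, mul_div_cancel_right₀ _ hv, two_smul]
    abel
  have hw_neg : reflection (v + w) *ᵥ v = -w := by
    rw [reflection_mulVec, hsum, star_add, Matrix.mulVec_add, dotProduct_add,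
      div_self (mul_ne_zero two_ne_zero hadd), one_smul]
    abel
  refine ⟨reflectionMul (v := v + w) (w := v) (hsum ▸ mul_ne_zero two_ne_zero hadd) hv, ?_⟩
  change (reflection (v + w) * reflection v) *ᵥ v = w
  rw [← Matrix.mulVec_mulVec, hv_neg, Matrix.mulVec_neg, hw_neg, neg_neg]

lemma exists_smul_origin (p : Ball n) : ∃ A : SU n, A • origin n = p := by
  have hp := one_sub_norm_sq_pos p
  set s : ℝ := (√(1 - ‖(p : E n)‖ ^ 2))⁻¹ with hs
  have hs0 : 0 < s := by positivity
  have hs2 : (s : ℂ) * (s * (‖(p : E n)‖ ^ 2 - 1)) = -1 := by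
    have h : s * (s * (‖(p : E n)‖ ^ 2 - 1)) = -1 := by
      rw [← mul_assoc, hs, ← mul_inv, Real.mul_self_sqrt hp.le]
      field_simp
      ring
    exact_mod_cast h
  have hsum_ne : (-1 + -s : ℂ) ≠ 0 := by
    have h : -1 + -s ≠ 0 := by linarith
    exact_mod_cast h
  obtain ⟨A, hA⟩ : ∃ A : SU n, mat A *ᵥ lift (0 : E n) = (s : ℂ) • lift (p : E n) := by
    apply exists_mulVec_eq <;>
      simp only [star_smul, Matrix.mulVec_smul, smul_dotProduct, dotProduct_smul, form_lift,
        inner_self_eq_norm_sq_to_K, inner_zero_left, inner_zero_right, smul_eq_mul,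
        Complex.star_def, Complex.conj_ofReal]
    · simp
    · simpa using hs2.symm
    · simpa using hsum_ne
  have hden : den A 0 = s := (congrFun hA (Sum.inr ())).trans (mul_one _)
  refine ⟨A, Subtype.ext ?_⟩
  ext i
  have hnum : num A 0 i = s * (p : E n) i := congrFun hA (Sum.inl i)
  change (den A 0)⁻¹ * num A 0 i = (p : E n) i
  rw [hden, hnum, inv_mul_cancel_left₀ (Complex.ofReal_ne_zero.2 hs0.ne')]

lemma exists_smul_eq (z w : Ball n) : ∃ A : SU n, A • z = w := by
  obtain ⟨A, hA⟩ := exists_smul_origin z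
  obtain ⟨B, hB⟩ := exists_smul_origin w
  exact ⟨B * A⁻¹, by rw [mul_smul, inv_smul_eq_iff.2 hA.symm, hB]⟩

lemma overlap_mul_overlap_le (z p w : Ball n) :
    overlap z p * overlap w p ≤ 4 * overlap z w := by
  obtain ⟨A, hA⟩ := exists_smul_eq p (origin n)
  rw [← overlap_smul_smul A z p, ← overlap_smul_smul A w p, ← overlap_smul_smul A z w, hA,
    overlap_origin, overlap_origin, overlap]
  generalize A • z = z
  generalize A • w = w
  have hpos := norm_one_sub_inner_pos z w
  have hle : ‖1 - inner ℂ (w : E n) (z : E n)‖ ≤ 2 := by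
    refine (norm_sub_le _ _).trans ?_
    rw [norm_one]
    linarith [norm_inner_lt_one z w]
  have hsq : ‖1 - inner ℂ (w : E n) (z : E n)‖ ^ 2 ≤ 4 := by nlinarith
  rw [mul_div_assoc', le_div_iff₀ (by positivity)]
  nlinarith [mul_pos (one_sub_norm_sq_pos z) (one_sub_norm_sq_pos w)]

end Transitivity

section Jacobian

variable {n : ℕ}

/-- The matrix of the complex derivative of `frac A` at `z`. -/
def fracDeriv (A : SU n) (z : E n) : Matrix (Fin n) (Fin n) ℂ := fun i l =>
  (den A z)⁻¹ * mat A (Sum.inl i) (Sum.inl l) -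
    (den A z)⁻¹ ^ 2 * num A z i * mat A (Sum.inr ()) (Sum.inl l)

lemma num_apply (A : SU n) (z : E n) (i : Fin n) :
    num A z i = ∑ l, mat A (Sum.inl i) (Sum.inl l) * z l + mat A (Sum.inl i) (Sum.inr ()) := by
  simp [num, Matrix.mulVec, dotProduct, lift]

lemma den_apply (A : SU n) (z : E n) :
    den A z = ∑ l, mat A (Sum.inr ()) (Sum.inl l) * z l + mat A (Sum.inr ()) (Sum.inr ()) := by
  simp [den, Matrix.mulVec, dotProduct, lift]

lemma det_fromBlocks_num_den (A : SU n) (z : E n) :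
    (Matrix.fromBlocks (mat A).toBlocks₁₁ (Matrix.replicateCol Unit fun i => num A z i)
      (mat A).toBlocks₂₁ (Matrix.diagonal fun _ => den A z)).det = 1 := by
  let T : Matrix (Fin n ⊕ Unit) (Fin n ⊕ Unit) ℂ :=
    Matrix.fromBlocks 1 (Matrix.replicateCol Unit fun i => z i) 0 1
  have hT : T.det = 1 := by simp [T]
  have hA : (mat A).det = 1 := A.1.2
  suffices h : mat A * T = Matrix.fromBlocks (mat A).toBlocks₁₁
      (Matrix.replicateCol Unit fun i => num A z i) (mat A).toBlocks₂₁
      (Matrix.diagonal fun _ => den A z) by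
    rw [← h, Matrix.det_mul, hA, hT, one_mul]
  rw [← Matrix.fromBlocks_toBlocks (mat A), Matrix.fromBlocks_multiply]
  ext (i | i) (l | l)
  · simp
  · simp [Matrix.mul_apply, num_apply, Matrix.toBlocks₁₁, Matrix.toBlocks₁₂, Matrix.replicateCol]
  · simp
  · simp [Matrix.mul_apply, den_apply, Matrix.toBlocks₂₁, Matrix.toBlocks₂₂, Matrix.replicateCol]

-- `fracDeriv A z` is `(den A z)⁻¹` times the Schur complement of `den A z` in the above matrix.
lemma det_fracDeriv (A : SU n) {z : E n} (hz : den A z ≠ 0) :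
    (fracDeriv A z).det = (den A z)⁻¹ ^ (n + 1) := by
  let : Invertible (Matrix.diagonal fun _ : Unit => den A z) :=
    ⟨Matrix.diagonal fun _ => (den A z)⁻¹, by simp [hz], by simp [hz]⟩
  have hinv : ⅟ (Matrix.diagonal fun _ : Unit => den A z) =
    Matrix.diagonal fun _ => (den A z)⁻¹ := rfl
  have hdet := det_fromBlocks_num_den A z
  rw [Matrix.det_fromBlocks₂₂, hinv, Matrix.det_diagonal] at hdet
  simp only [Finset.univ_unique, Finset.prod_singleton] at hdet
  have hschur : fracDeriv A z = (den A z)⁻¹ • ((mat A).toBlocks₁₁ -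
      (Matrix.replicateCol Unit fun i => num A z i : Matrix (Fin n) Unit ℂ) *
        (Matrix.diagonal fun _ => (den A z)⁻¹ : Matrix Unit Unit ℂ) * (mat A).toBlocks₂₁) := by
    ext i l
    simp [fracDeriv, Matrix.mul_apply, Matrix.toBlocks₁₁, Matrix.toBlocks₂₁, Matrix.replicateCol]
    ring
  rw [hschur, Matrix.det_smul, Fintype.card_fin, pow_succ]
  congr 1
  exact eq_inv_of_mul_eq_one_right hdet

/-- The derivative of `frac A` at `z`, as a continuous linear map. -/
def fracDerivCLM (A : SU n) (z : E n) : E n →L[ℂ] E n :=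
  LinearMap.toContinuousLinearMap (Matrix.toLin (EuclideanSpace.basisFun (Fin n) ℂ).toBasis
    (EuclideanSpace.basisFun (Fin n) ℂ).toBasis (fracDeriv A z))

lemma det_fracDerivCLM (A : SU n) {z : E n} (hz : den A z ≠ 0) :
    (fracDerivCLM A z).det = (den A z)⁻¹ ^ (n + 1) := by
  rw [← det_fracDeriv A hz, fracDerivCLM, LinearMap.det_toContinuousLinearMap,
    LinearMap.det_toLin]

lemma fracDerivCLM_apply (A : SU n) (z v : E n) (i : Fin n) :
    fracDerivCLM A z v i = ∑ l, fracDeriv A z i l * v l := by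
  rw [fracDerivCLM, LinearMap.coe_toContinuousLinearMap',
    ← Matrix.toEuclideanLin_eq_toLin_orthonormal]
  simp [Matrix.mulVec, dotProduct]

lemma hasFDerivAt_frac (A : SU n) {z : E n} (hz : den A z ≠ 0) :
    HasFDerivAt (frac A) (fracDerivCLM A z) z := by
  rw [← hasFDerivWithinAt_univ, hasFDerivWithinAt_piLp]
  intro i
  rw [hasFDerivWithinAt_univ]
  have haff : ∀ r : Fin n ⊕ Unit, HasFDerivAt
      (fun w : E n => ∑ l, mat A r (Sum.inl l) * w l + mat A r (Sum.inr ()))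
      (∑ l, mat A r (Sum.inl l) • (EuclideanSpace.proj l : E n →L[ℂ] ℂ)) z := by
    intro r
    refine HasFDerivAt.add_const _ (HasFDerivAt.fun_sum fun l _ => ?_)
    exact ((EuclideanSpace.proj l : E n →L[ℂ] ℂ).hasFDerivAt).const_mul _
  have hnum := haff (Sum.inl i)
  have hden := haff (Sum.inr ())
  simp only [← num_apply, ← den_apply] at hnum hden
  refine (((hasDerivAt_inv hz).comp_hasFDerivAt z hden).mul hnum).congr_fderiv ?_
  ext v
  have hproj : (PiLp.proj 2 (fun _ => ℂ) i ∘SL fracDerivCLM A z) v =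
    ∑ l, fracDeriv A z i l * v l := fracDerivCLM_apply A z v i
  have hv : ∀ l, (EuclideanSpace.proj l : E n →L[ℂ] ℂ) v = v l := fun _ => rfl
  simp only [hproj, add_apply, smul_apply, sum_apply, smul_eq_mul, hv, fracDeriv, sub_mul,
    Finset.sum_sub_distrib, Finset.mul_sum, Function.comp_apply]
  rw [← Finset.sum_add_distrib, ← Finset.sum_sub_distrib]
  exact Finset.sum_congr rfl fun l _ => by ring

lemma continuous_den (A : SU n) : Continuous (den A) := by
  rw [funext (den_apply A)]
  fun_prop

instance instContinuousConstSMulBall : ContinuousConstSMul (SU n) (Ball n) where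
  continuous_const_smul A := by
    refine Continuous.subtype_mk (continuous_iff_continuousAt.2 fun z => ?_) _
    exact (hasFDerivAt_frac A (den_ne_zero A z)).continuousAt.comp
      continuous_subtype_val.continuousAt

lemma jac_toPermHom (A : SU n) (z : Ball n) :
    jac (MulAction.toPermHom (SU n) (Ball n) A) z = (den A z)⁻¹ ^ (n + 1) := by
  rw [jac, ← det_fracDerivCLM A (den_ne_zero A z)]
  congr 1
  refine HasFDerivAt.fderiv ((hasFDerivAt_frac A (den_ne_zero A z)).congr_of_eventuallyEq ?_)
  filter_upwards [Metric.isOpen_ball.mem_nhds z.2] with w hw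
  rw [dif_pos hw]
  rfl

end Jacobian

section Bergman

variable {n : ℕ}

/-- The constant `n!/πⁿ` of the Bergman kernel. -/
def bergmanConst (n : ℕ) : ℝ := (n.factorial : ℝ) / Real.pi ^ n

lemma bergmanConst_pos (n : ℕ) : 0 < bergmanConst n := by
  unfold bergmanConst
  positivity

lemma bergman_eq (z w : Ball n) :
    bergman z w = (bergmanConst n : ℂ) / (1 - inner ℂ (w : E n) (z : E n)) ^ (n + 1) := rfl

lemma bergmanDiag_eq (z : Ball n) :
    bergmanDiag z = bergmanConst n / (1 - ‖(z : E n)‖ ^ 2) ^ (n + 1) := by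
  have h : bergman z z = ((bergmanConst n / (1 - ‖(z : E n)‖ ^ 2) ^ (n + 1) : ℝ) : ℂ) := by
    rw [bergman_eq, inner_self_eq_norm_sq_to_K]
    push_cast
    rfl
  rw [bergmanDiag, h, Complex.ofReal_re]

lemma bergman_self (z : Ball n) : bergman z z = (bergmanDiag z : ℂ) := by
  rw [bergmanDiag_eq, bergman_eq, inner_self_eq_norm_sq_to_K]
  push_cast
  rfl

lemma bergmanDiag_pos (z : Ball n) : 0 < bergmanDiag z := by
  rw [bergmanDiag_eq]
  exact div_pos (bergmanConst_pos n) (pow_pos (one_sub_norm_sq_pos z) _)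

lemma conj_bergman (z w : Ball n) : (starRingEnd ℂ) (bergman z w) = bergman w z := by
  rw [bergman_eq, bergman_eq, map_div₀, map_pow, map_sub, map_one, inner_conj_symm,
    Complex.conj_ofReal]

lemma bergman_smul_smul (A : SU n) (z w : Ball n) :
    bergman (A • z) (A • w) = (den A z * (starRingEnd ℂ) (den A w)) ^ (n + 1) * bergman z w := by
  have hz := den_ne_zero A z
  have hw : (starRingEnd ℂ) (den A w) ≠ 0 := by simpa using den_ne_zero A w
  have hzw := one_sub_inner_ne_zero (A • z) (A • w)
  rw [bergman_eq, bergman_eq, ← one_sub_inner_smul A z w, mul_pow _ (1 - _)]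
  field_simp

lemma bergmanDiag_smul (A : SU n) (z : Ball n) :
    bergmanDiag (A • z) = ‖den A z‖ ^ (2 * (n + 1)) * bergmanDiag z := by
  have hden := norm_pos_iff.2 (den_ne_zero A z)
  have hz := one_sub_norm_sq_pos (A • z)
  rw [bergmanDiag_eq, bergmanDiag_eq, ← one_sub_norm_sq_smul A z, mul_pow, ← pow_mul]
  field_simp

lemma norm_bergman_sq (z w : Ball n) :
    ‖bergman z w‖ ^ 2 = overlap z w ^ (n + 1) * (bergmanDiag z * bergmanDiag w) := by
  have hz := one_sub_norm_sq_pos z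
  have hw := one_sub_norm_sq_pos w
  have hzw := norm_one_sub_inner_pos z w
  rw [bergmanDiag_eq, bergmanDiag_eq, bergman_eq, overlap, norm_div, norm_pow, Complex.norm_real,
    Real.norm_of_nonneg (bergmanConst_pos n).le]
  simp only [div_pow, mul_pow]
  field_simp
  ring

end Bergman

section InvariantVolume

variable {n : ℕ}

lemma measurable_bergmanDiag : Measurable (bergmanDiag : Ball n → ℝ) := by
  rw [funext (bergmanDiag_eq (n := n))]
  fun_prop

lemma lintegral_invVol_coe {g : E n → ℝ≥0∞} (hg : Measurable fun z : Ball n => g z) :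
    ∫⁻ z : Ball n, g z ∂(invVol n) = ∫⁻ x in Metric.ball (0 : E n) 1,
      ENNReal.ofReal (bergmanConst n / (1 - ‖x‖ ^ 2) ^ (n + 1)) * g x := by
  rw [invVol, lintegral_withDensity_eq_lintegral_mul _ measurable_bergmanDiag.ennreal_ofReal hg,
    ← lintegral_subtype_comap measurableSet_ball]
  simp only [Pi.mul_apply, bergmanDiag_eq]

lemma abs_det_restrictScalars {V : Type*} [NormedAddCommGroup V] [NormedSpace ℂ V]
    (L : V →L[ℂ] V) : |(L.restrictScalars ℝ).det| = ‖L.det‖ ^ 2 := by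
  have h := LinearMap.det_restrictScalars (R := ℝ) (f := (L : V →ₗ[ℂ] V))
  rw [Algebra.norm_complex_apply, Complex.normSq_eq_norm_sq] at h
  exact (congrArg abs h).trans (abs_of_nonneg (sq_nonneg _))

lemma image_frac_ball (A : SU n) :
    frac A '' Metric.ball (0 : E n) 1 = Metric.ball (0 : E n) 1 := by
  ext x
  constructor
  · rintro ⟨y, hy, rfl⟩
    exact frac_mem A ⟨y, hy⟩
  · intro hx
    refine ⟨(A⁻¹ • (⟨x, hx⟩ : Ball n) : Ball n), (A⁻¹ • (⟨x, hx⟩ : Ball n) : Ball n).2, ?_⟩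
    rw [← coe_smul, smul_inv_smul]

lemma injOn_frac (A : SU n) : Set.InjOn (frac A) (Metric.ball (0 : E n) 1) := by
  intro x hx y hy h
  have hsmul : A • (⟨x, hx⟩ : Ball n) = A • (⟨y, hy⟩ : Ball n) := Subtype.ext h
  exact congrArg Subtype.val (MulAction.injective A hsmul)

lemma setLIntegral_comp_frac (A : SU n) (g : E n → ℝ≥0∞) :
    ∫⁻ x in Metric.ball (0 : E n) 1,
        ENNReal.ofReal (bergmanConst n / (1 - ‖x‖ ^ 2) ^ (n + 1)) * g (frac A x) =
      ∫⁻ x in Metric.ball (0 : E n) 1,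
        ENNReal.ofReal (bergmanConst n / (1 - ‖x‖ ^ 2) ^ (n + 1)) * g x := by
  conv_rhs => rw [← image_frac_ball A]
  rw [lintegral_image_eq_lintegral_abs_det_fderiv_mul volume measurableSet_ball
    (f' := fun x => (fracDerivCLM A x).restrictScalars ℝ)
    (fun x hx => ((hasFDerivAt_frac A
      (den_ne_zero A ⟨x, hx⟩)).restrictScalars ℝ).hasFDerivWithinAt) (injOn_frac A)]
  refine setLIntegral_congr_fun measurableSet_ball fun x hx => ?_
  have hden := den_ne_zero A ⟨x, hx⟩
  have _hden_pos := norm_pos_iff.2 hden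
  have hdiag := bergmanDiag_smul A ⟨x, hx⟩
  rw [bergmanDiag_eq, bergmanDiag_eq, coe_smul] at hdiag
  simp only
  rw [abs_det_restrictScalars, det_fracDerivCLM A hden, hdiag, ← mul_assoc,
    ← ENNReal.ofReal_mul (by positivity)]
  congr 2
  rw [norm_pow, norm_inv, ← pow_mul, mul_comm (n + 1) 2, inv_pow, ← mul_assoc,
    inv_mul_cancel₀ (by positivity), one_mul]

lemma measurePreserving_smul_invVol (A : SU n) :
    MeasurePreserving (fun z : Ball n => A • z) (invVol n) (invVol n) := by
  have hA : Measurable (fun z : Ball n => A • z) := (continuous_const_smul A).measurable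
  refine ⟨hA, Measure.ext_of_lintegral _ fun f hf => ?_⟩
  obtain ⟨g, -, hgf⟩ := (MeasurableEmbedding.subtype_coe
    (measurableSet_ball (x := (0 : E n)) (ε := 1))).exists_measurable_extend hf fun _ => ⟨0⟩
  have hg : Measurable fun z : Ball n => g z := by rwa [← hgf] at hf
  calc ∫⁻ z, f z ∂(invVol n).map (fun z => A • z)
      = ∫⁻ z, g ((A • z : Ball n) : E n) ∂(invVol n) := by rw [lintegral_map hf hA, ← hgf]; rfl
    _ = ∫⁻ z, g z ∂(invVol n) := by
      rw [lintegral_invVol_coe hg, ← setLIntegral_comp_frac A]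
      exact lintegral_invVol_coe (g := fun x => g (frac A x)) (hg.comp hA)
    _ = ∫⁻ z, f z ∂(invVol n) := by rw [← hgf]; rfl

lemma integral_comp_smul (A : SU n) {F : Type*} [NormedAddCommGroup F] [NormedSpace ℝ F]
    (f : Ball n → F) : ∫ w, f (A • w) ∂(invVol n) = ∫ w, f w ∂(invVol n) :=
  (measurePreserving_smul_invVol A).integral_comp (Homeomorph.smul A).measurableEmbedding f

lemma lintegral_comp_smul (A : SU n) (f : Ball n → ℝ≥0∞) :
    ∫⁻ w, f (A • w) ∂(invVol n) = ∫⁻ w, f w ∂(invVol n) :=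
  (measurePreserving_smul_invVol A).lintegral_comp_emb (Homeomorph.smul A).measurableEmbedding f

instance instSFiniteInvVol : SFinite (invVol n) := by
  have : IsFiniteMeasure ((volume : Measure (E n)).comap (Subtype.val : Ball n → E n)) := by
    constructor
    rw [(MeasurableEmbedding.subtype_coe measurableSet_ball).comap_apply, Set.image_univ,
      Subtype.range_coe]
    exact measure_ball_lt_top
  unfold invVol
  infer_instance

lemma lintegral_overlap_pow (p : Ball n) :
    ∫⁻ w, ENNReal.ofReal (overlap w p ^ (n + 1)) ∂(invVol n) =
      ENNReal.ofReal (bergmanConst n) * volume (Metric.ball (0 : E n) 1) := by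
  obtain ⟨A, rfl⟩ := exists_smul_origin p
  rw [← lintegral_comp_smul A]
  simp only [overlap_smul_smul, overlap_origin]
  rw [lintegral_invVol_coe (g := fun x => ENNReal.ofReal ((1 - ‖x‖ ^ 2) ^ (n + 1))) (by fun_prop),
    ← setLIntegral_const]
  refine setLIntegral_congr_fun measurableSet_ball fun x hx => ?_
  have hx := one_sub_norm_sq_pos ⟨x, hx⟩
  have hb := bergmanConst_pos n
  simp only at hx ⊢
  rw [← ENNReal.ofReal_mul (by positivity), div_mul_cancel₀ _ (by positivity)]

lemma lintegral_overlap_pow_lt_top (p : Ball n) :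
    ∫⁻ w, ENNReal.ofReal (overlap w p ^ (n + 1)) ∂(invVol n) < ⊤ := by
  rw [lintegral_overlap_pow]
  exact ENNReal.mul_lt_top ENNReal.ofReal_lt_top measure_ball_lt_top

lemma integrable_overlap_pow (p : Ball n) :
    Integrable (fun w => overlap w p ^ (n + 1)) (invVol n) := by
  refine ⟨((continuous_overlap_left p).pow _).aestronglyMeasurable, ?_⟩
  rw [hasFiniteIntegral_iff_ofReal (ae_of_all _ fun w => (pow_pos (overlap_pos w p) _).le)]
  exact lintegral_overlap_pow_lt_top p

lemma invVol_ne_zero : invVol n ≠ 0 := by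
  intro h
  have hint := lintegral_overlap_pow (origin n)
  rw [h, lintegral_zero_measure] at hint
  exact mul_ne_zero (by simpa using bergmanConst_pos n)
    (Metric.measure_ball_pos _ _ one_pos).ne' hint.symm

end InvariantVolume

section MeanValue

variable {n : ℕ}

lemma bergmanDiag_origin : bergmanDiag (origin n) = bergmanConst n := by
  simp [bergmanDiag_eq, origin]

lemma bergman_origin_left (w : Ball n) : bergman (origin n) w = bergmanConst n := by
  simp [bergman_eq, origin]

lemma bergman_origin_right (w : Ball n) : bergman w (origin n) = bergmanConst n := by
  simp [bergman_eq, origin]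

lemma norm_bergman_le (w p : Ball n) :
    ‖bergman w p‖ ≤ bergmanConst n / (1 - ‖(p : E n)‖) ^ (n + 1) := by
  have hb := bergmanConst_pos n
  have hw : ‖(w : E n)‖ < 1 := mem_ball_zero_iff.1 w.2
  have hp : 0 < 1 - ‖(p : E n)‖ := sub_pos.2 (mem_ball_zero_iff.1 p.2)
  rw [bergman_eq, norm_div, norm_pow, Complex.norm_real, Real.norm_of_nonneg hb.le]
  gcongr
  have htri := norm_sub_norm_le (1 : ℂ) (inner ℂ (p : E n) (w : E n))
  have hcs := norm_inner_le_norm (𝕜 := ℂ) (p : E n) (w : E n)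
  rw [norm_one] at htri
  nlinarith [norm_nonneg (p : E n)]

lemma inv_bergmanDiag (w : Ball n) :
    (bergmanDiag w)⁻¹ = (bergmanConst n)⁻¹ * overlap w (origin n) ^ (n + 1) := by
  rw [bergmanDiag_eq, overlap_origin, inv_div, div_eq_inv_mul]

lemma integrable_inv_bergmanDiag_pow {k : ℕ} (hk : 1 ≤ k) :
    Integrable (fun w : Ball n => (bergmanDiag w ^ k)⁻¹) (invVol n) := by
  refine ((integrable_overlap_pow (origin n)).const_mul ((bergmanConst n)⁻¹ ^ k)).mono'
    (measurable_bergmanDiag.pow_const k).inv.aestronglyMeasurable (ae_of_all _ fun w => ?_)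
  have h := overlap_pos w (origin n)
  have hb := bergmanConst_pos n
  have hd := bergmanDiag_pos w
  rw [Real.norm_of_nonneg (by positivity), ← inv_pow, inv_bergmanDiag, mul_pow]
  gcongr
  exact pow_le_of_le_one (by positivity) (pow_le_one₀ h.le (overlap_le_one _ _)) (by omega)

lemma integral_inv_bergmanDiag_pow_pos {k : ℕ} (hk : 1 ≤ k) :
    0 < ∫ w : Ball n, (bergmanDiag w ^ k)⁻¹ ∂(invVol n) := by
  have hpos : ∀ w : Ball n, 0 < (bergmanDiag w ^ k)⁻¹ := fun w =>
    inv_pos.2 (pow_pos (bergmanDiag_pos w) k)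
  have hsupp : Function.support (fun w : Ball n => (bergmanDiag w ^ k)⁻¹) = Set.univ :=
    Set.eq_univ_of_forall fun w => (hpos w).ne'
  rw [integral_pos_iff_support_of_nonneg (fun w => (hpos w).le)
    (integrable_inv_bergmanDiag_pow hk), hsupp, Measure.measure_univ_pos]
  exact invVol_ne_zero

/-- The rotation `w ↦ ζ^{n+1} w` as an element of `SU(n,1)`; the power makes the determinant
one. -/
def rotation (n : ℕ) (ζ : Circle) : SU n :=
  ⟨⟨Matrix.diagonal (Sum.elim (fun _ => (ζ : ℂ)) fun _ => ((ζ⁻¹ : Circle) : ℂ) ^ n), by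
    simp [Matrix.det_diagonal]⟩, by
    change _ = _
    have hζ : (ζ : ℂ) * (starRingEnd ℂ) (ζ : ℂ) = 1 := by simp [Complex.mul_conj]
    rw [sig, Matrix.diagonal_transpose, Matrix.diagonal_map (map_zero _),
      Matrix.diagonal_mul_diagonal, Matrix.diagonal_mul_diagonal]
    congr 1
    funext i
    rcases i with i | i
    · simp [Complex.mul_conj]
    · simp [← mul_inv, ← mul_pow, hζ]⟩

lemma coe_rotation_smul (ζ : Circle) (w : Ball n) :
    ((rotation n ζ • w : Ball n) : E n) = (ζ : ℂ) ^ (n + 1) • (w : E n) := by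
  rw [coe_smul]
  ext i
  simp [frac, num, den, mat, rotation, Matrix.mulVec_diagonal, lift]
  ring

lemma bergmanDiag_rotation_smul (ζ : Circle) (w : Ball n) :
    bergmanDiag (rotation n ζ • w) = bergmanDiag w := by
  rw [bergmanDiag_eq, bergmanDiag_eq, coe_rotation_smul, norm_smul, norm_pow, Circle.norm_coe,
    one_pow, one_mul]

lemma bergman_rotation_exp_smul (θ : ℝ) (w p : Ball n) :
    bergman (rotation n (Circle.exp θ) • w) p = (bergmanConst n : ℂ) /
      (1 - circleMap 0 1 θ ^ (n + 1) * inner ℂ (p : E n) (w : E n)) ^ (n + 1) := by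
  rw [bergman_eq, coe_rotation_smul, inner_smul_right]
  simp [circleMap]

lemma circleAverage_div_one_sub_pow_mul {a : ℂ} (ha : ‖a‖ < 1) (c : ℂ) {l : ℕ} (hl : l ≠ 0)
    (i k : ℕ) :
    Real.circleAverage (fun ζ => (c / (1 - ζ ^ l * a) ^ i) ^ k) 0 1 = c ^ k := by
  rw [DiffContOnCl.circleAverage]
  · simp [hl]
  refine DifferentiableOn.diffContOnCl fun ζ hζ => ?_
  rw [abs_one, closure_ball _ one_ne_zero, mem_closedBall_zero_iff] at hζ
  have hlt : ‖ζ ^ l * a‖ < 1 := by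
    rw [norm_mul, norm_pow]
    exact mul_lt_one_of_nonneg_of_lt_one_right (pow_le_one₀ (norm_nonneg _) hζ) (norm_nonneg _) ha
  have hne : (1 - ζ ^ l * a) ^ i ≠ 0 := by
    refine pow_ne_zero _ fun h => ?_
    simp [← sub_eq_zero.1 h] at hlt
  exact DifferentiableAt.differentiableWithinAt (by fun_prop (disch := exact hne))

lemma intervalIntegral_bergman_rotation_exp_smul_pow (w p : Ball n) (k : ℕ) :
    ∫ θ in (0 : ℝ)..(2 * Real.pi), bergman (rotation n (Circle.exp θ) • w) p ^ k =
      (2 * Real.pi : ℝ) • (bergmanConst n : ℂ) ^ k := by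
  rw [← circleAverage_div_one_sub_pow_mul (norm_inner_lt_one w p) (bergmanConst n) n.succ_ne_zero
    (n + 1) k, Real.circleAverage, smul_smul, mul_inv_cancel₀ (by positivity), one_smul]
  simp only [bergman_rotation_exp_smul]

lemma integrable_mul_bergman_rotation_exp_smul_pow {μ : Measure ℝ} [IsFiniteMeasure μ]
    {r : Ball n → ℝ} (hr : Integrable r (invVol n)) (p : Ball n) (k : ℕ) :
    Integrable (fun x : ℝ × Ball n =>
      (r x.2 : ℂ) * bergman (rotation n (Circle.exp x.1) • x.2) p ^ k) (μ.prod (invVol n)) := by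
  refine (Integrable.comp_snd (f := fun w => (r w : ℂ)) hr.ofReal μ).mul_bdd
    (c := (bergmanConst n / (1 - ‖(p : E n)‖) ^ (n + 1)) ^ k) (Measurable.aestronglyMeasurable ?_)
    (ae_of_all _ fun x => ?_)
  · have _hcircle := (continuous_circleMap 0 1).measurable
    simp only [bergman_rotation_exp_smul]
    fun_prop
  · rw [norm_pow]
    gcongr
    exact norm_bergman_le _ _

lemma integral_mul_bergman_pow {r : Ball n → ℝ} (hr : Integrable r (invVol n))
    (hinv : ∀ ζ w, r (rotation n ζ • w) = r w) (p : Ball n) (k : ℕ) :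
    ∫ w, (r w : ℂ) * bergman w p ^ k ∂(invVol n) =
      (bergmanConst n : ℂ) ^ k * ∫ w, (r w : ℂ) ∂(invVol n) := by
  have hrot : ∀ θ, ∫ w, (r w : ℂ) * bergman (rotation n (Circle.exp θ) • w) p ^ k ∂(invVol n) =
      ∫ w, (r w : ℂ) * bergman w p ^ k ∂(invVol n) := by
    intro θ
    rw [← integral_comp_smul (rotation n (Circle.exp θ)) fun w => (r w : ℂ) * bergman w p ^ k]
    simp only [hinv]
  have : IsFiniteMeasure ((volume : Measure ℝ).restrict (Set.uIoc 0 (2 * Real.pi))) :=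
    isFiniteMeasure_restrict.2 measure_Ioc_lt_top.ne
  have hswap := intervalIntegral_integral_swap (a := 0) (b := 2 * Real.pi)
    (f := fun θ w => (r w : ℂ) * bergman (rotation n (Circle.exp θ) • w) p ^ k)
    (integrable_mul_bergman_rotation_exp_smul_pow hr p k)
  simp only [hrot, intervalIntegral.integral_const_mul,
    intervalIntegral_bergman_rotation_exp_smul_pow, mul_smul_comm] at hswap
  rw [intervalIntegral.integral_const, integral_smul, sub_zero] at hswap
  rw [smul_right_injective ℂ (by positivity : (2 * Real.pi) ≠ 0) hswap, integral_mul_const,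
    mul_comm]

end MeanValue

section Reproducing

variable {n : ℕ}

/-- The constant `c(𝔹ⁿ, k)` as a real number. -/
def kernelReal (n k : ℕ) : ℝ :=
  (bergmanConst n ^ k * ∫ w : Ball n, (bergmanDiag w ^ k)⁻¹ ∂(invVol n))⁻¹

lemma kernelReal_pos {k : ℕ} (hk : 1 ≤ k) : 0 < kernelReal n k :=
  inv_pos.2 (mul_pos (pow_pos (bergmanConst_pos n) k) (integral_inv_bergmanDiag_pow_pos hk))

lemma kernelConst_eq (k : ℕ) : kernelConst n k = kernelReal n k := by
  have hb : (bergmanConst n : ℂ) ^ k ≠ 0 :=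
    pow_ne_zero _ (by exact_mod_cast (bergmanConst_pos n).ne')
  have hreal : ∫ w : Ball n, ((bergmanDiag w : ℂ) ^ k)⁻¹ ∂(invVol n) =
      ((∫ w : Ball n, (bergmanDiag w ^ k)⁻¹ ∂(invVol n) : ℝ) : ℂ) := by
    rw [← integral_complex_ofReal]
    push_cast
    rfl
  rw [kernelConst]
  simp only [bergman_origin_left, bergman_origin_right, bergman_self,
    bergmanDiag_origin, div_eq_mul_inv]
  rw [integral_const_mul, hreal, kernelReal]
  push_cast
  rw [mul_inv, mul_inv, mul_inv, ← mul_assoc, ← mul_assoc, mul_inv_cancel₀ hb, one_mul]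

lemma reproducing_origin {k : ℕ} (hk : 1 ≤ k) (p : Ball n) :
    kernelConst n k * ∫ w, bergman (origin n) w ^ k * bergman w p ^ k /
      bergman w w ^ k ∂(invVol n) = bergman (origin n) p ^ k := by
  have hb : (bergmanConst n : ℂ) ≠ 0 := by exact_mod_cast (bergmanConst_pos n).ne'
  have hI : ((∫ w : Ball n, (bergmanDiag w ^ k)⁻¹ ∂(invVol n) : ℝ) : ℂ) ≠ 0 := by
    exact_mod_cast (integral_inv_bergmanDiag_pow_pos hk).ne'
  have hintegrand : ∀ w : Ball n,
      bergman (origin n) w ^ k * bergman w p ^ k / bergman w w ^ k =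
        (bergmanConst n : ℂ) ^ k * ((((bergmanDiag w ^ k)⁻¹ : ℝ) : ℂ) * bergman w p ^ k) := by
    intro w
    rw [bergman_origin_left, bergman_self, div_eq_mul_inv]
    push_cast
    ring
  simp only [hintegrand]
  rw [integral_const_mul, integral_mul_bergman_pow (integrable_inv_bergmanDiag_pow hk)
    (fun ζ w => by rw [bergmanDiag_rotation_smul]), integral_complex_ofReal, kernelConst_eq,
    kernelReal, bergman_origin_left]
  generalize ∫ w : Ball n, (bergmanDiag w ^ k)⁻¹ ∂(invVol n) = I at hI ⊢
  push_cast
  field_simp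

theorem reproducing {k : ℕ} (hk : 1 ≤ k) (q p : Ball n) :
    kernelConst n k * ∫ w, bergman q w ^ k * bergman w p ^ k / bergman w w ^ k ∂(invVol n) =
      bergman q p ^ k := by
  obtain ⟨A, rfl⟩ := exists_smul_origin q
  obtain ⟨p, rfl⟩ : ∃ p', p = A • p' := ⟨A⁻¹ • p, by simp⟩
  have hintegrand : ∀ w : Ball n,
      ((den A (origin n) * (starRingEnd ℂ) (den A w)) ^ (n + 1) * bergman (origin n) w) ^ k *
      ((den A w * (starRingEnd ℂ) (den A p)) ^ (n + 1) * bergman w p) ^ k /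
      ((den A w * (starRingEnd ℂ) (den A w)) ^ (n + 1) * bergman w w) ^ k =
      ((den A (origin n) * (starRingEnd ℂ) (den A p)) ^ (n + 1)) ^ k *
        (bergman (origin n) w ^ k * bergman w p ^ k / bergman w w ^ k) := by
    intro w
    have hw := den_ne_zero A w
    have hw' : (starRingEnd ℂ) (den A w) ≠ 0 := by simpa using hw
    have hww : bergman w w ≠ 0 := by
      rw [bergman_self]
      exact_mod_cast (bergmanDiag_pos w).ne'
    simp only [mul_pow]
    field_simp
  rw [← integral_comp_smul A]
  simp only [bergman_smul_smul, hintegrand]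
  rw [integral_const_mul, mul_left_comm, reproducing_origin hk, ← mul_pow]

end Reproducing

section LocalFiniteness

variable {n : ℕ}

lemma conj_mul_sig_mul_transpose (A : SU n) :
    (mat A).map (starRingEnd ℂ) * sig n * (mat A)ᵀ = sig n := by
  have hA : (mat A)ᵀ * sig n * (mat A).map (starRingEnd ℂ) = sig n := A.2
  have hsig : sig n * sig n = 1 := by
    rw [sig, Matrix.diagonal_mul_diagonal, ← Matrix.diagonal_one]
    congr 1
    funext i
    rcases i with i | i <;> simp
  have hinv : (sig n * (mat A)ᵀ * sig n) * (mat A).map (starRingEnd ℂ) = 1 := by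
    rw [Matrix.mul_assoc, Matrix.mul_assoc, ← Matrix.mul_assoc (mat A)ᵀ, hA, hsig]
  calc (mat A).map (starRingEnd ℂ) * sig n * (mat A)ᵀ
      = (mat A).map (starRingEnd ℂ) * (sig n * (mat A)ᵀ * sig n) * sig n := by
        simp only [Matrix.mul_assoc, hsig, Matrix.mul_one]
    _ = sig n := by rw [mul_eq_one_comm.1 hinv, Matrix.one_mul]

lemma sum_norm_sq_row_le (A : SU n) (r : Fin n ⊕ Unit) :
    ∑ l, ‖mat A r (Sum.inl l)‖ ^ 2 ≤ 1 + ‖mat A r (Sum.inr ())‖ ^ 2 := by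
  have hrow : ((∑ l, ‖mat A r (Sum.inl l)‖ ^ 2 - ‖mat A r (Sum.inr ())‖ ^ 2 : ℝ) : ℂ) =
      ((Sum.elim (fun _ => 1) (fun _ => -1) r : ℝ) : ℂ) := by
    have h := congrFun (congrFun (conj_mul_sig_mul_transpose A) r) r
    rw [sig, Matrix.mul_apply] at h
    rcases r with r | r <;>
      simpa [Matrix.mul_diagonal, Complex.conj_mul', sub_eq_add_neg] using h
  have hle : (Sum.elim (fun _ => 1) (fun _ => -1) r : ℝ) ≤ 1 := by
    rcases r with r | r <;> norm_num
  linarith [Complex.ofReal_injective hrow]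

lemma norm_mat_sq_le (A : SU n) (r l : Fin n ⊕ Unit) :
    ‖mat A r l‖ ^ 2 ≤ 1 + ‖den A (origin n)‖ ^ 2 := by
  have hlast : ‖mat A r (Sum.inr ())‖ ^ 2 ≤ ‖den A (origin n)‖ ^ 2 := by
    rcases r with i | i
    · have hnum : num A (origin n) i = mat A (Sum.inl i) (Sum.inr ()) := by
        simp [num_apply, origin]
      have hle : ‖num A (origin n) i‖ ≤ ‖num A (origin n)‖ := PiLp.norm_apply_le _ i
      have hsub := norm_num_sub A (origin n)
      rw [show ‖((origin n : Ball n) : E n)‖ = 0 by simp [origin]] at hsub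
      rw [hnum] at hle
      nlinarith [norm_nonneg (mat A (Sum.inl i) (Sum.inr ()))]
    · simp [den_apply, origin]
  rcases l with l | l
  · have hle : ‖mat A r (Sum.inl l)‖ ^ 2 ≤ ∑ l, ‖mat A r (Sum.inl l)‖ ^ 2 :=
      Finset.single_le_sum (f := fun l => ‖mat A r (Sum.inl l)‖ ^ 2)
        (fun _ _ => sq_nonneg _) (Finset.mem_univ l)
    linarith [sum_norm_sq_row_le A r]
  · linarith

lemma isClosedEmbedding_mat : IsClosedEmbedding (mat : SU n → _) := by
  have hSL : IsClosedEmbedding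
      (Subtype.val : Matrix.SpecialLinearGroup (Fin n ⊕ Unit) ℂ → Matrix _ _ ℂ) :=
    (isClosed_eq (by fun_prop) continuous_const).isClosedEmbedding_subtypeVal
  have hSU : IsClosed {A : Matrix.SpecialLinearGroup (Fin n ⊕ Unit) ℂ |
      A.1ᵀ * sig n * A.1.map (starRingEnd ℂ) = sig n} := by
    have hval : Continuous fun A : Matrix.SpecialLinearGroup (Fin n ⊕ Unit) ℂ => A.1 :=
      continuous_subtype_val
    exact isClosed_eq ((hval.matrix_transpose.matrix_mul continuous_const).matrix_mul
      (hval.matrix_map Complex.continuous_conj)) continuous_const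
  exact hSL.comp hSU.isClosedEmbedding_subtypeVal

lemma finite_norm_den_origin_le (Γ : Subgroup (SU n)) [DiscreteTopology Γ] (R : ℝ) :
    {A : SU n | A ∈ Γ ∧ ‖den A (origin n)‖ ^ 2 ≤ R}.Finite := by
  set K : Set (Matrix (Fin n ⊕ Unit) (Fin n ⊕ Unit) ℂ) :=
    Set.univ.pi fun _ => Set.univ.pi fun _ => Metric.closedBall 0 √(1 + R)
  have hKcompact : IsCompact K :=
    isCompact_univ_pi fun _ => isCompact_univ_pi fun _ => isCompact_closedBall _ _
  have hfin : (mat ⁻¹' K ∩ (Γ : Set (SU n))).Finite :=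
    ((isClosedEmbedding_mat.isCompact_preimage hKcompact).inter_right
      Subgroup.isClosed_of_discrete).finite (IsDiscrete.mono ⟨‹_›⟩ Set.inter_subset_right)
  refine hfin.subset ?_
  rintro A ⟨hA, hR⟩
  refine ⟨fun r _ l _ => ?_, hA⟩
  rw [mem_closedBall_zero_iff]
  exact Real.le_sqrt_of_sq_le ((norm_mat_sq_le A r l).trans (by linarith))

end LocalFiniteness

section AutGroup

variable {n : ℕ} {Γ : Subgroup (SU n)}

lemma aut_smul_def (g : autGroup Γ) (z : Ball n) : g • z = g.1 z := rfl

lemma exists_representative (g : autGroup Γ) :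
    ∃ A ∈ Γ, MulAction.toPermHom (SU n) (Ball n) A = g.1 ∧ ∀ z : Ball n, g • z = A • z := by
  obtain ⟨A, hA, h⟩ := Subgroup.mem_map.1 g.2
  exact ⟨A, hA, h, fun z => by rw [aut_smul_def, ← h]; rfl⟩

lemma overlap_aut_smul (g : autGroup Γ) (z w : Ball n) :
    overlap (g • z) (g • w) = overlap z w := by
  obtain ⟨A, -, -, h⟩ := exists_representative g
  rw [h, h, overlap_smul_smul]

lemma overlap_aut_smul_left (g : autGroup Γ) (z w : Ball n) :
    overlap (g • z) w = overlap z (g⁻¹ • w) := by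
  rw [← overlap_aut_smul g z, smul_inv_smul]

instance instContinuousConstSMulAut : ContinuousConstSMul (autGroup Γ) (Ball n) where
  continuous_const_smul g := by
    obtain ⟨A, -, -, h⟩ := exists_representative g
    simp only [h]
    exact continuous_const_smul A

instance instMeasurableConstSMulAut : MeasurableConstSMul (autGroup Γ) (Ball n) where
  measurable_const_smul g := (continuous_const_smul g).measurable

instance instSMulInvariantMeasureAut : SMulInvariantMeasure (autGroup Γ) (Ball n) (invVol n) where
  measure_preimage_smul g S hS := by
    obtain ⟨A, -, -, h⟩ := exists_representative g
    simp only [h]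
    exact (measurePreserving_smul_invVol A).measure_preimage hS.nullMeasurableSet

instance instCountableAutGroup [DiscreteTopology Γ] : Countable (autGroup Γ) := by
  have : SecondCountableTopology (Matrix (Fin n ⊕ Unit) (Fin n ⊕ Unit) ℂ) :=
    inferInstanceAs (SecondCountableTopology (_ → _ → ℂ))
  have : SecondCountableTopology (SU n) :=
    isClosedEmbedding_mat.isEmbedding.secondCountableTopology
  have : Countable Γ := TopologicalSpace.separableSpace_iff_countable.1 inferInstance
  exact ((MulAction.toPermHom (SU n) (Ball n)).subgroupMap_surjective Γ).countable

lemma overlap_smul_origin_origin (A : SU n) :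
    overlap (A • origin n) (origin n) = (‖den A (origin n)‖ ^ 2)⁻¹ := by
  have h := one_sub_norm_sq_smul A (origin n)
  rw [show ‖((origin n : Ball n) : E n)‖ = 0 by simp [origin]] at h
  rw [overlap_origin]
  apply eq_inv_of_mul_eq_one_right
  rw [h]
  norm_num

lemma finite_overlap_smul_origin_ge [DiscreteTopology Γ] {ε : ℝ} (hε : 0 < ε) :
    {g : autGroup Γ | ε ≤ overlap (g • origin n) (origin n)}.Finite := by
  have hfin := (finite_norm_den_origin_le Γ ε⁻¹).image (MulAction.toPermHom (SU n) (Ball n))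
  refine Set.Finite.of_finite_image (f := Subtype.val) (hfin.subset ?_)
    Subtype.val_injective.injOn
  rintro _ ⟨g, hg, rfl⟩
  obtain ⟨A, hA, hAg, h⟩ := exists_representative g
  have hd := norm_pos_iff.2 (den_ne_zero A (origin n))
  rw [Set.mem_ofPred_eq, h, overlap_smul_origin_origin] at hg
  exact ⟨A, ⟨hA, (le_inv_comm₀ hε (by positivity)).1 hg⟩, hAg⟩

lemma finite_overlap_smul_ge [DiscreteTopology Γ] {ε : ℝ} (hε : 0 < ε) (z w : Ball n) :
    {g : autGroup Γ | ε ≤ overlap (g • z) w}.Finite := by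
  set o := origin n
  have hz := overlap_pos o z
  have hw := overlap_pos o w
  have hη : 0 < overlap o z * (ε * overlap o w / 4) / 4 := by positivity
  refine (finite_overlap_smul_origin_ge hη).subset fun g hg => ?_
  rw [Set.mem_ofPred_eq] at hg ⊢
  have hzo : ε * overlap o w / 4 ≤ overlap (g • z) o := by
    nlinarith [overlap_mul_overlap_le (g • z) w o]
  have hoo := overlap_mul_overlap_le (g • o) (g • z) o
  rw [overlap_aut_smul, overlap_comm o (g • z)] at hoo
  nlinarith

end AutGroup

section Dirichlet

variable {n : ℕ} {Γ : Subgroup (SU n)}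

lemma volume_norm_one_sub_inner_eq {q : E n} (hq : q ≠ 0) (r : ℝ) :
    volume {z : E n | ‖1 - inner ℂ q z‖ = r} = 0 := by
  let L : E n →ₗ[ℝ] ℂ := ((innerSL ℂ q : E n →L[ℂ] ℂ) : E n →ₗ[ℂ] ℂ).restrictScalars ℝ
  have hL : Function.Surjective L := fun u => ⟨(u / inner ℂ q q) • q, by
    change inner ℂ q ((u / inner ℂ q q) • q) = u
    rw [inner_smul_right, div_mul_cancel₀ _ (inner_self_ne_zero.2 hq)]⟩
  have hsphere : ∀ᵐ u : ℂ, u ∈ (Metric.sphere (1 : ℂ) r)ᶜ := by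
    rw [ae_iff]
    simp only [Set.mem_compl_iff, not_not]
    exact Measure.addHaar_sphere volume (1 : ℂ) r
  have hae := (ae_comp_linearMap_mem_iff L (volume : Measure (E n)) (volume : Measure ℂ) hL
    Metric.isClosed_sphere.measurableSet.compl).2 hsphere
  rw [ae_iff] at hae
  refine measure_mono_null (fun z hz => ?_) hae
  rw [Set.mem_ofPred_eq, Set.notMem_compl_iff, mem_sphere_iff_norm, norm_sub_rev]
  exact hz

lemma invVol_bisector {p q : Ball n} (h : p ≠ q) :
    invVol n {z | overlap z p = overlap z q} = 0 := by
  obtain ⟨A, rfl⟩ := exists_smul_origin p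
  obtain ⟨q, rfl⟩ : ∃ q', q = A • q' := ⟨A⁻¹ • q, by simp⟩
  have hq : (q : E n) ≠ 0 := fun hq =>
    h (congrArg (A • ·) (Subtype.ext hq.symm : origin n = q))
  have hcl : IsClosed {z : Ball n | overlap z (A • origin n) = overlap z (A • q)} :=
    isClosed_eq (continuous_overlap_left _) (continuous_overlap_left _)
  rw [← (measurePreserving_smul_invVol A).measure_preimage hcl.measurableSet.nullMeasurableSet]
  simp only [Set.preimage_ofPred_eq, overlap_smul_smul]
  refine withDensity_absolutelyContinuous _ _ ?_
  rw [(MeasurableEmbedding.subtype_coe measurableSet_ball).comap_apply]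
  refine measure_mono_null ?_ (volume_norm_one_sub_inner_eq hq √(1 - ‖(q : E n)‖ ^ 2))
  rintro _ ⟨z, hz, rfl⟩
  have hnorm := norm_one_sub_inner_pos z q
  rw [Set.mem_ofPred_eq, overlap_origin, overlap, eq_div_iff (by positivity)] at hz
  rw [Set.mem_ofPred_eq, ← mul_left_cancel₀ (one_sub_norm_sq_pos z).ne' hz, Real.sqrt_sq hnorm.le]

lemma mem_dirichlet_iff {z₀ z : Ball n} : z ∈ dirichlet Γ z₀ ↔
    ∀ g : autGroup Γ, g ≠ 1 → overlap z (g • z₀) < overlap z z₀ := by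
  simp only [dirichlet, tau_lt_tau_iff, Set.mem_ofPred_eq, Subtype.forall, ne_eq, Subtype.ext_iff,
    aut_smul_def, Subgroup.coe_one]

lemma measurableSet_dirichlet [DiscreteTopology Γ] (z₀ : Ball n) :
    MeasurableSet (dirichlet Γ z₀) := by
  have h : dirichlet Γ z₀ = ⋂ g : autGroup Γ, ⋂ _ : g ≠ 1,
      {z | overlap z (g • z₀) < overlap z z₀} := by
    ext z
    simp only [mem_dirichlet_iff, Set.mem_iInter, Set.mem_ofPred_eq]
  rw [h]
  exact MeasurableSet.iInter fun g => MeasurableSet.iInter fun _ =>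
    (isOpen_lt (continuous_overlap_left _) (continuous_overlap_left _)).measurableSet

lemma smul_notMem_dirichlet {z₀ z : Ball n} (hz : z ∈ dirichlet Γ z₀) {g : autGroup Γ}
    (hg : g ≠ 1) : g • z ∉ dirichlet Γ z₀ := by
  intro hgz
  have hlt := mem_dirichlet_iff.1 hgz g hg
  rw [overlap_aut_smul, overlap_aut_smul_left] at hlt
  exact lt_asymm hlt (mem_dirichlet_iff.1 hz g⁻¹ (inv_ne_one.2 hg))

lemma smul_injective_of_nonempty_dirichlet {z₀ : Ball n} (hne : (dirichlet Γ z₀).Nonempty) :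
    Function.Injective fun g : autGroup Γ => g • z₀ := by
  intro g h hgh
  obtain ⟨z, hz⟩ := hne
  by_contra hne
  have hlt := mem_dirichlet_iff.1 hz (h⁻¹ * g) fun heq => hne (inv_mul_eq_one.1 heq).symm
  rw [mul_smul, show g • z₀ = h • z₀ from hgh, inv_smul_smul] at hlt
  exact lt_irrefl _ hlt

lemma exists_smul_mem_dirichlet [DiscreteTopology Γ] {z₀ z : Ball n}
    (hinj : Function.Injective fun g : autGroup Γ => overlap z (g • z₀)) :
    ∃ g : autGroup Γ, g • z ∈ dirichlet Γ z₀ := by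
  have hone : (1 : autGroup Γ) ∈ {g : autGroup Γ | overlap z z₀ ≤ overlap (g • z₀) z} := by
    rw [Set.mem_ofPred_eq, one_smul, overlap_comm]
  obtain ⟨g, hg, hmax⟩ := Set.exists_max_image _ (fun g : autGroup Γ => overlap (g • z₀) z)
    (finite_overlap_smul_ge (overlap_pos z z₀) z₀ z) ⟨1, hone⟩
  have hlt : ∀ h : autGroup Γ, h ≠ g → overlap z (h • z₀) < overlap z (g • z₀) := by
    intro h hh
    refine lt_of_le_of_ne ?_ (hinj.ne hh)
    rw [overlap_comm z, overlap_comm z]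
    by_cases hm : h ∈ {g : autGroup Γ | overlap z z₀ ≤ overlap (g • z₀) z}
    · exact hmax h hm
    · exact (not_le.1 hm).le.trans hg
  refine ⟨g⁻¹, mem_dirichlet_iff.2 fun h hh => ?_⟩
  rw [overlap_aut_smul_left, overlap_aut_smul_left, inv_inv, smul_smul]
  exact hlt _ (by simpa using hh)

theorem isFundamentalDomain_dirichlet [DiscreteTopology Γ] {z₀ : Ball n}
    (hne : (dirichlet Γ z₀).Nonempty) :
    IsFundamentalDomain (autGroup Γ) (dirichlet Γ z₀) (invVol n) := by
  refine ⟨(measurableSet_dirichlet z₀).nullMeasurableSet, ?_, fun g h hgh => ?_⟩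
  · have hae : ∀ᵐ z ∂(invVol n), ∀ g h : autGroup Γ, g ≠ h →
        overlap z (g • z₀) ≠ overlap z (h • z₀) := by
      simp only [ae_all_iff]
      intro g h hgh
      simpa [ae_iff] using invVol_bisector ((smul_injective_of_nonempty_dirichlet hne).ne hgh)
    filter_upwards [hae] with z hz
    exact exists_smul_mem_dirichlet fun g h => not_imp_not.1 (hz g h)
  · refine Disjoint.aedisjoint (Set.disjoint_left.2 ?_)
    rintro _ ⟨x, hx, rfl⟩ ⟨y, hy, hxy⟩
    refine smul_notMem_dirichlet hx (g := h⁻¹ * g) (fun heq => hgh (inv_mul_eq_one.1 heq).symm) ?_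
    rwa [mul_smul, ← show h • y = g • x from hxy, inv_smul_smul]

end Dirichlet

section Separation

variable {n : ℕ} {Γ : Subgroup (SU n)}

lemma isPreconnected_overlap_gt (a : ℝ) (p : Ball n) :
    IsPreconnected {w : Ball n | a < overlap w p} := by
  obtain ⟨A, rfl⟩ := exists_smul_origin p
  rw [← (Homeomorph.smul A).isPreconnected_preimage]
  simp only [Set.preimage_ofPred_eq, Homeomorph.smul_apply, overlap_smul_smul, overlap_origin]
  rw [← Topology.IsInducing.subtypeVal.isPreconnected_image]
  have himage : Subtype.val '' {w : Ball n | a < 1 - ‖(w : E n)‖ ^ 2} =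
      Metric.ball 0 1 ∩ {x : E n | x ∈ Set.univ ∧ ‖x‖ ^ 2 < 1 - a} := by
    rw [← Subtype.image_preimage_coe]
    congr 1
    ext w
    simp [lt_sub_comm]
  have hconvex : ConvexOn ℝ Set.univ fun x : E n => ‖x‖ ^ 2 :=
    (convexOn_norm convex_univ).pow (fun _ _ => norm_nonneg _) 2
  rw [himage]
  exact ((convex_ball _ _).inter (hconvex.convex_lt _)).isPreconnected

lemma inter_frontier_nonempty {α : Type*} [TopologicalSpace α] {t u : Set α}
    (ht : IsPreconnected t) (hu : (t ∩ u).Nonempty) (huc : (t ∩ uᶜ).Nonempty) :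
    (t ∩ frontier u).Nonempty := by
  by_contra hne
  have hint : t ∩ u ⊆ interior u := fun x hx => by_contra fun hi =>
    hne ⟨x, hx.1, subset_closure hx.2, hi⟩
  have hext : t ∩ uᶜ ⊆ (closure u)ᶜ := fun x hx hc =>
    hne ⟨x, hx.1, hc, fun hi => hx.2 (interior_subset hi)⟩
  obtain ⟨w, -, hw, hw'⟩ := ht _ _ isOpen_interior isClosed_closure.isOpen_compl
    (fun z hz => (em (z ∈ u)).imp (fun h => hint ⟨hz, h⟩) fun h => hext ⟨hz, h⟩)
    (hu.mono fun x hx => ⟨hx.1, hint hx⟩) (huc.mono fun x hx => ⟨hx.1, hext hx⟩)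
  exact hw' (subset_closure (interior_subset hw))

lemma exists_overlap_gt_mem_dirichlet {X : Set (Ball n)} {z₀ : Ball n}
    (hX : X ⊆ dirichlet Γ z₀) (hd : 0 < setDist X (frontier (dirichlet Γ z₀))) :
    ∃ a : ℝ, 0 < a ∧ a < 1 ∧ ∀ p ∈ X, ∀ w, a < overlap w p → w ∈ dirichlet Γ z₀ := by
  obtain ⟨δ, hδ0, hδpos, hδ⟩ := ENNReal.lt_iff_exists_real_btwn.1 hd
  have hδpos : 0 < δ := by simpa using hδpos
  have hcosh : 1 < Real.cosh (δ / 2) ^ 2 :=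
    one_lt_pow₀ (Real.one_lt_cosh.2 (by positivity)) two_ne_zero
  have ha1 := inv_lt_one_of_one_lt₀ hcosh
  refine ⟨(Real.cosh (δ / 2) ^ 2)⁻¹, by positivity, ha1, fun p hp w hw => ?_⟩
  by_contra hwF
  obtain ⟨v, hv, hvF⟩ := inter_frontier_nonempty (isPreconnected_overlap_gt _ p)
    ⟨p, by rwa [Set.mem_ofPred_eq, overlap_self], hX hp⟩ ⟨w, hw, hwF⟩
  rw [Set.mem_ofPred_eq, overlap_comm, ← tau_lt_iff hδ0] at hv
  have hdist : setDist X (frontier (dirichlet Γ z₀)) ≤ ENNReal.ofReal (tau p v) :=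
    (iInf₂_le p hp).trans (iInf₂_le v hvF)
  exact lt_asymm hv ((ENNReal.ofReal_lt_ofReal_iff_of_nonneg hδ0).1 (hδ.trans_le hdist))

end Separation

section PoincareSeries

variable {n : ℕ} {Γ : Subgroup (SU n)}

/-- The Poincaré series `∑ cosh^{-2(n+1)} (τ(γz,p)/2)` over `Γ` converges for `p ∈ X`, with sum at
most `C`; it dominates all the theta series of weight at least two. -/
def PoincareBound (Γ : Subgroup (SU n)) (X : Set (Ball n)) (C : ℝ) : Prop :=
  ∀ p ∈ X, ∀ z, Summable (fun g : autGroup Γ => overlap (g • z) p ^ (n + 1)) ∧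
    ∑' g : autGroup Γ, overlap (g • z) p ^ (n + 1) ≤ C

lemma invVol_overlap_gt (a : ℝ) (p : Ball n) :
    invVol n {w | a < overlap w p} = invVol n {w | a < overlap w (origin n)} := by
  obtain ⟨A, rfl⟩ := exists_smul_origin p
  rw [← (measurePreserving_smul_invVol A).measure_preimage
    (isOpen_lt_overlap a _).measurableSet.nullMeasurableSet]
  simp only [Set.preimage_ofPred_eq, overlap_smul_smul]

lemma invVol_overlap_gt_lt_top {a : ℝ} (ha : 0 < a) (p : Ball n) :
    invVol n {w | a < overlap w p} < ⊤ :=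
  (measure_mono fun _ (hw : a < _) => pow_le_pow_left₀ ha.le hw.le (n + 1)).trans_lt
    ((integrable_overlap_pow p).measure_ge_lt_top (pow_pos ha (n + 1)))

lemma invVol_overlap_gt_pos {a : ℝ} (ha : a < 1) (p : Ball n) :
    0 < invVol n {w | a < overlap w p} := by
  have hne : {w : Ball n | ENNReal.ofReal (bergmanDiag w) ≠ 0} = Set.univ :=
    Set.eq_univ_of_forall fun w => by simpa using bergmanDiag_pos w
  rw [pos_iff_ne_zero, invVol, Ne,
    withDensity_apply_eq_zero measurable_bergmanDiag.ennreal_ofReal, hne, Set.univ_inter,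
    (MeasurableEmbedding.subtype_coe measurableSet_ball).comap_apply]
  have hopen := Metric.isOpen_ball.isOpenEmbedding_subtypeVal.isOpenMap _ (isOpen_lt_overlap a p)
  exact (hopen.measure_pos _ ⟨_, p, by rwa [Set.mem_ofPred_eq, overlap_self], rfl⟩).ne'

-- A mean value argument: on the ball about `p`, where `overlap w p > a`, the term
-- `overlap (γz) p` is at most `(4 / a)` times `overlap (γz) w`; integrating over `w` and unfolding
-- the sum over `Γ` bounds the series by an integral over the whole of the unit ball.
lemma tsum_overlap_pow_mul_le [DiscreteTopology Γ] {z₀ : Ball n} {a : ℝ} (ha : 0 < a)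
    (ha1 : a < 1) {p : Ball n} (hp : ∀ w, a < overlap w p → w ∈ dirichlet Γ z₀) (z : Ball n) :
    (∑' g : autGroup Γ, ENNReal.ofReal (overlap (g • z) p ^ (n + 1))) *
        invVol n {w | a < overlap w p} ≤
      ENNReal.ofReal ((4 / a) ^ (n + 1)) *
        ∫⁻ w, ENNReal.ofReal (overlap w z ^ (n + 1)) ∂(invVol n) := by
  have hF : IsFundamentalDomain (autGroup Γ) (dirichlet Γ z₀) (invVol n) :=
    isFundamentalDomain_dirichlet ⟨p, hp p (by rwa [overlap_self])⟩
  have hterm : ∀ g : autGroup Γ,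
      ENNReal.ofReal (overlap (g • z) p ^ (n + 1)) * invVol n {w | a < overlap w p} ≤
        ∫⁻ w in dirichlet Γ z₀, ENNReal.ofReal ((4 / a) ^ (n + 1)) *
          ENNReal.ofReal (overlap (g⁻¹ • w) z ^ (n + 1)) ∂(invVol n) := by
    intro g
    rw [← setLIntegral_const]
    refine (setLIntegral_mono' (isOpen_lt_overlap a p).measurableSet fun w hw => ?_).trans
      (lintegral_mono_set hp)
    rw [Set.mem_ofPred_eq] at hw
    rw [← ENNReal.ofReal_mul (by positivity), ← mul_pow, overlap_aut_smul_left g⁻¹, inv_inv]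
    refine ENNReal.ofReal_le_ofReal (pow_le_pow_left₀ (overlap_pos _ _).le ?_ _)
    rw [overlap_comm w, div_mul_eq_mul_div, le_div_iff₀ ha]
    nlinarith [overlap_mul_overlap_le (g • z) p w, overlap_pos (g • z) p]
  rw [← ENNReal.tsum_mul_right]
  refine (ENNReal.tsum_le_tsum hterm).trans_eq ?_
  rw [← hF.lintegral_eq_tsum' (fun w =>
    ENNReal.ofReal ((4 / a) ^ (n + 1)) * ENNReal.ofReal (overlap w z ^ (n + 1))),
    lintegral_const_mul' _ _ ENNReal.ofReal_ne_top]

lemma exists_poincareBound [DiscreteTopology Γ] {z₀ : Ball n} {X : Set (Ball n)} {a : ℝ}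
    (ha : 0 < a) (ha1 : a < 1) (hX : ∀ p ∈ X, ∀ w, a < overlap w p → w ∈ dirichlet Γ z₀) :
    ∃ C : ℝ, 0 ≤ C ∧ PoincareBound Γ X C := by
  set T : ℝ≥0∞ := ENNReal.ofReal ((4 / a) ^ (n + 1)) *
    (ENNReal.ofReal (bergmanConst n) * volume (Metric.ball (0 : E n) 1)) /
      invVol n {w | a < overlap w (origin n)} with hT
  have hTtop : T ≠ ⊤ := ENNReal.div_ne_top (ENNReal.mul_ne_top ENNReal.ofReal_ne_top
    (ENNReal.mul_ne_top ENNReal.ofReal_ne_top measure_ball_lt_top.ne))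
    (invVol_overlap_gt_pos ha1 _).ne'
  have hle : ∀ p ∈ X, ∀ z,
      ∑' g : autGroup Γ, ENNReal.ofReal (overlap (g • z) p ^ (n + 1)) ≤ T := by
    intro p hp z
    rw [hT, ← invVol_overlap_gt a p, ENNReal.le_div_iff_mul_le
      (Or.inl (invVol_overlap_gt_pos ha1 p).ne') (Or.inl (invVol_overlap_gt_lt_top ha p).ne),
      ← lintegral_overlap_pow z]
    exact tsum_overlap_pow_mul_le ha ha1 (hX p hp) z
  refine ⟨T.toReal, ENNReal.toReal_nonneg, fun p hp z => ?_⟩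
  have hnonneg : ∀ g : autGroup Γ, 0 ≤ overlap (g • z) p ^ (n + 1) := fun g =>
    (pow_pos (overlap_pos _ _) _).le
  have hsummable : Summable (fun g : autGroup Γ => overlap (g • z) p ^ (n + 1)) := by
    simpa only [ENNReal.toReal_ofReal (hnonneg _)] using
      ENNReal.summable_toReal (ne_top_of_le_ne_top hTtop (hle p hp z))
  refine ⟨hsummable, ?_⟩
  rw [← ENNReal.ofReal_le_iff_le_toReal hTtop, ENNReal.ofReal_tsum_of_nonneg hnonneg hsummable]
  exact hle p hp z

end PoincareSeries

section Jacobian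

variable {n : ℕ} {Γ : Subgroup (SU n)}

lemma exists_jac_eq (g : autGroup Γ) : ∃ A : SU n, (∀ z : Ball n, g • z = A • z) ∧
    ∀ z, jac g.1 z = (den A z)⁻¹ ^ (n + 1) := by
  obtain ⟨A, -, hA, hsmul⟩ := exists_representative g
  exact ⟨A, hsmul, fun z => by rw [← hA, jac_toPermHom]⟩

lemma jac_ne_zero (g : autGroup Γ) (z : Ball n) : jac g.1 z ≠ 0 := by
  obtain ⟨A, -, hjac⟩ := exists_jac_eq g
  rw [hjac]
  exact pow_ne_zero _ (inv_ne_zero (den_ne_zero A z))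

lemma jac_one (z : Ball n) : jac (1 : autGroup Γ).1 z = 1 := by
  rw [Subgroup.coe_one, ← map_one (MulAction.toPermHom (SU n) (Ball n)), jac_toPermHom]
  simp [den, mat, lift]

lemma den_mul (A B : SU n) (z : Ball n) :
    den (A * B) z = den B z * den A (B • z : Ball n) := by
  have hlift : mat (A * B) *ᵥ lift z.1 = den B z.1 • (mat A *ᵥ lift (frac B z.1)) := by
    rw [← Matrix.mulVec_smul, ← mulVec_lift, Matrix.mulVec_mulVec]
    rfl
  exact congrFun hlift (Sum.inr ())

lemma jac_mul (g h : autGroup Γ) (z : Ball n) :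
    jac (g * h).1 z = jac g.1 (h • z) * jac h.1 z := by
  obtain ⟨A, -, hA, -⟩ := exists_representative g
  obtain ⟨B, -, hB, hsmul⟩ := exists_representative h
  rw [Subgroup.coe_mul, ← hA, ← hB, ← map_mul, jac_toPermHom, jac_toPermHom, jac_toPermHom,
    den_mul, hsmul, ← mul_pow, mul_inv, mul_comm]

lemma bergman_aut_smul (g : autGroup Γ) (z w : Ball n) :
    bergman (g • z) (g • w) * jac g.1 z * (starRingEnd ℂ) (jac g.1 w) = bergman z w := by
  obtain ⟨A, hA, hjac⟩ := exists_jac_eq g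
  have hz := den_ne_zero A z
  have hw : (starRingEnd ℂ) (den A w) ≠ 0 := by simpa using den_ne_zero A w
  rw [hA, hA, bergman_smul_smul, hjac, hjac, map_pow, map_inv₀, mul_pow, inv_pow, inv_pow]
  field_simp

lemma bergmanDiag_aut_smul (g : autGroup Γ) (z : Ball n) :
    bergmanDiag (g • z) * ‖jac g.1 z‖ ^ 2 = bergmanDiag z := by
  obtain ⟨A, hA, hjac⟩ := exists_jac_eq g
  have hz := norm_pos_iff.2 (den_ne_zero A z)
  rw [hA, bergmanDiag_smul, hjac, norm_pow, norm_inv, ← pow_mul, mul_comm (n + 1) 2, inv_pow]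
  field_simp

lemma continuous_jac (g : autGroup Γ) : Continuous (jac g.1) := by
  obtain ⟨A, -, hjac⟩ := exists_jac_eq g
  rw [show jac g.1 = fun z : Ball n => (den A z)⁻¹ ^ (n + 1) from funext hjac]
  exact (((continuous_den A).comp continuous_subtype_val).inv₀ fun z => den_ne_zero A z).pow _

end Jacobian

section PoincareTerm

variable {n : ℕ} {Γ : Subgroup (SU n)}

/-- The weight `K(z,z)^{-k/2}`. -/
def weight (k : ℕ) (z : Ball n) : ℝ := bergmanDiag z ^ (-(k : ℝ) / 2)

lemma weight_pos (k : ℕ) (z : Ball n) : 0 < weight k z := Real.rpow_pos_of_pos (bergmanDiag_pos z) _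

lemma weight_sq (k : ℕ) (z : Ball n) : weight k z ^ 2 = (bergmanDiag z ^ k)⁻¹ := by
  rw [weight, ← Real.rpow_mul_natCast (bergmanDiag_pos z).le, Nat.cast_ofNat,
    div_mul_cancel₀ _ two_ne_zero, Real.rpow_neg (bergmanDiag_pos z).le, Real.rpow_natCast]

lemma weight_aut_smul (k : ℕ) (g : autGroup Γ) (z : Ball n) :
    weight k (g • z) = weight k z * ‖jac g.1 z‖ ^ k := by
  have hz := weight_pos k z
  have hj := norm_pos_iff.2 (jac_ne_zero g z)
  have hb := bergmanDiag_pos (g • z)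
  refine (sq_eq_sq₀ (weight_pos k (g • z)).le (by positivity)).1 ?_
  rw [mul_pow, weight_sq, weight_sq, ← bergmanDiag_aut_smul g z, mul_pow, ← pow_mul, ← pow_mul,
    mul_comm k 2]
  field_simp

lemma measurable_weight (k : ℕ) : Measurable (weight k : Ball n → ℝ) :=
  measurable_bergmanDiag.pow_const _

/-- The term `J(g,z)^k K(gz,p)^k` of the Poincaré series, normalized by the weights
`K(z,z)^{-k/2} K(p,p)^{-k/2}` so that its modulus is a function of `τ(gz,p)` alone. -/
def poincareTerm (k : ℕ) (g : autGroup Γ) (z p : Ball n) : ℂ :=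
  ((weight k z * weight k p : ℝ) : ℂ) * (jac g.1 z * bergman (g • z) p) ^ k

lemma norm_poincareTerm (k : ℕ) (g : autGroup Γ) (z p : Ball n) :
    ‖poincareTerm k g z p‖ = √(overlap (g • z) p) ^ ((n + 1) * k) := by
  have hz := weight_pos k z
  have hp := weight_pos k p
  have ho := overlap_pos (g • z) p
  have hb := bergmanDiag_pos p
  have hb' := bergmanDiag_pos (g • z)
  have hj := norm_pos_iff.2 (jac_ne_zero g z)
  refine (sq_eq_sq₀ (norm_nonneg _) (by positivity)).1 ?_
  rw [← pow_mul, mul_comm _ 2, pow_mul, Real.sq_sqrt ho.le, poincareTerm, norm_mul,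
    Complex.norm_real, Real.norm_of_nonneg (by positivity), norm_pow, norm_mul, mul_pow, mul_pow,
    weight_sq, weight_sq, ← bergmanDiag_aut_smul g z, ← pow_mul, mul_comm k 2, pow_mul,
    mul_pow ‖jac g.1 z‖ ‖bergman (g • z) p‖ 2, norm_bergman_sq, pow_mul, mul_pow]
  simp only [mul_pow]
  field_simp

lemma norm_poincareTerm_le_mul {k : ℕ} (hk : 2 ≤ k) {a : ℝ} {g : autGroup Γ} {z p : Ball n}
    (ha : overlap (g • z) p ≤ a) :
    ‖poincareTerm k g z p‖ ≤ √a ^ (k - 2) * overlap (g • z) p ^ (n + 1) := by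
  have hk2 : (n + 1) * k = (k - 2) + n * (k - 2) + 2 * (n + 1) := by
    obtain ⟨l, rfl⟩ := Nat.exists_eq_add_of_le hk
    rw [Nat.add_sub_cancel_left]
    ring
  have ho := overlap_pos (g • z) p
  have ho1 : √(overlap (g • z) p) ≤ 1 := Real.sqrt_le_one.2 (overlap_le_one _ _)
  rw [norm_poincareTerm, hk2, pow_add, pow_add, pow_mul _ 2, Real.sq_sqrt ho.le]
  gcongr
  calc √(overlap (g • z) p) ^ (k - 2) * √(overlap (g • z) p) ^ (n * (k - 2))
      ≤ √(overlap (g • z) p) ^ (k - 2) * 1 := by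
        gcongr
        exact pow_le_one₀ (Real.sqrt_nonneg _) ho1
    _ ≤ √a ^ (k - 2) := by
        rw [mul_one]
        gcongr

lemma norm_poincareTerm_le {k : ℕ} (hk : 2 ≤ k) (g : autGroup Γ) (z p : Ball n) :
    ‖poincareTerm k g z p‖ ≤ overlap (g • z) p ^ (n + 1) := by
  simpa using norm_poincareTerm_le_mul hk (overlap_le_one (g • z) p)

lemma measurable_poincareTerm (k : ℕ) (g : autGroup Γ) {α : Type*} [MeasurableSpace α]
    {a b : α → Ball n} (ha : Measurable a) (hb : Measurable b) :
    Measurable fun x => poincareTerm k g (a x) (b x) := by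
  have _hga : Measurable fun x => g • a x := ha.const_smul g
  have hK : Measurable fun x => bergman (g • a x) (b x) := by
    simp only [bergman_eq]
    fun_prop
  have hJ : Measurable fun x => jac g.1 (a x) := (continuous_jac g).measurable.comp ha
  exact (Complex.measurable_ofReal.comp (((measurable_weight k).comp ha).mul
    ((measurable_weight k).comp hb))).mul ((hJ.mul hK).pow_const k)

lemma poincareTerm_smul (k : ℕ) (g h : autGroup Γ) (z p : Ball n) :
    poincareTerm k h (g • z) p =
      ((‖jac g.1 z‖ : ℂ) / jac g.1 z) ^ k * poincareTerm k (h * g) z p := by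
  have hj := jac_ne_zero g z
  rw [poincareTerm, poincareTerm, weight_aut_smul, jac_mul, mul_smul]
  push_cast
  simp only [div_pow, mul_pow]
  field_simp

lemma integral_poincareTerm_mul_conj {k : ℕ} (hk : 1 ≤ k) (g : autGroup Γ) (q p : Ball n) :
    (kernelReal n k : ℂ) * ∫ z, poincareTerm k g z p *
      (starRingEnd ℂ) (poincareTerm k (1 : autGroup Γ) z q) ∂(invVol n) =
      poincareTerm k g q p := by
  obtain ⟨p, rfl⟩ : ∃ p', p = g • p' := ⟨g⁻¹ • p, by simp⟩
  have hjp : (starRingEnd ℂ) (jac g.1 p) ≠ 0 := by simpa using jac_ne_zero g p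
  have hbergman : ∀ z, jac g.1 z * bergman (g • z) (g • p) =
      bergman z p / (starRingEnd ℂ) (jac g.1 p) := fun z => by
    rw [← bergman_aut_smul g z p]
    field_simp
  have hintegrand : ∀ z, poincareTerm k g z (g • p) *
      (starRingEnd ℂ) (poincareTerm k (1 : autGroup Γ) z q) =
      ((weight k (g • p) * weight k q : ℝ) : ℂ) * ((starRingEnd ℂ) (jac g.1 p) ^ k)⁻¹ *
        (bergman q z ^ k * bergman z p ^ k / bergman z z ^ k) := fun z => by
    have hweight : (weight k z : ℂ) ^ 2 = (bergman z z ^ k)⁻¹ := by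
      rw [bergman_self]
      exact_mod_cast weight_sq k z
    rw [poincareTerm, poincareTerm, hbergman, jac_one, one_smul, one_mul, map_mul, map_pow,
      conj_bergman, Complex.conj_ofReal, div_eq_mul_inv (bergman q z ^ k * _), ← hweight]
    push_cast
    rw [div_pow]
    ring
  simp only [hintegrand]
  rw [integral_const_mul, mul_left_comm, ← kernelConst_eq, reproducing hk, poincareTerm, hbergman,
    div_pow]
  push_cast
  ring

end PoincareTerm

section NormTheta

variable {n : ℕ} {Γ : Subgroup (SU n)} {m : ℕ} (ρ : autGroup Γ →* Matrix.unitaryGroup (Fin m) ℂ)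
  (j : Fin m) {X : Set (Ball n)} {C : ℝ}

/-- The `i`-th component of the normalized theta series `K(z,z)^{-k/2} K(p,p)^{-k/2} Θ_p(z)`. -/
def normTheta (k : ℕ) (i : Fin m) (z p : Ball n) : ℂ :=
  (kernelReal n k : ℂ) * ∑' g : autGroup Γ, (ρ g⁻¹).1 i j * poincareTerm k g z p

lemma norm_coeff_mul_poincareTerm_le {k : ℕ} (hk : 2 ≤ k) (g h : autGroup Γ) (i l : Fin m)
    (z p : Ball n) : ‖(ρ h).1 i l * poincareTerm k g z p‖ ≤ overlap (g • z) p ^ (n + 1) := by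
  rw [norm_mul]
  exact (mul_le_of_le_one_left (norm_nonneg _) (entry_norm_bound_of_unitary (ρ h).2 i l)).trans
    (norm_poincareTerm_le hk g z p)

lemma summable_normTheta (hC : PoincareBound Γ X C) {k : ℕ} (hk : 2 ≤ k) (i : Fin m) (z : Ball n)
    {p : Ball n} (hp : p ∈ X) :
    Summable fun g : autGroup Γ => (ρ g⁻¹).1 i j * poincareTerm k g z p :=
  (hC p hp z).1.of_norm_bounded fun g => norm_coeff_mul_poincareTerm_le ρ hk g g⁻¹ i j z p

lemma norm_normTheta_le (hC : PoincareBound Γ X C) {k : ℕ} (hk : 2 ≤ k) (i : Fin m) (z : Ball n)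
    {p : Ball n} (hp : p ∈ X) : ‖normTheta ρ j k i z p‖ ≤ kernelReal n k * C := by
  have hc := kernelReal_pos (n := n) (by omega : 1 ≤ k)
  rw [normTheta, norm_mul, Complex.norm_real, Real.norm_of_nonneg hc.le]
  gcongr
  exact (tsum_of_norm_bounded (hC p hp z).1.hasSum
    fun g => norm_coeff_mul_poincareTerm_le ρ hk g g⁻¹ i j z p).trans (hC p hp z).2

lemma enorm_normTheta_le {k : ℕ} (hk : 2 ≤ k) (i : Fin m) (z p : Ball n) :
    ‖normTheta ρ j k i z p‖ₑ ≤ ENNReal.ofReal (kernelReal n k) *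
      ∑' g : autGroup Γ, ENNReal.ofReal (overlap (g • z) p ^ (n + 1)) := by
  have hc := kernelReal_pos (n := n) (by omega : 1 ≤ k)
  rw [normTheta, enorm_mul, ← ofReal_norm (kernelReal n k : ℂ), Complex.norm_real,
    Real.norm_of_nonneg hc.le]
  gcongr
  refine enorm_tsum_le_tsum_enorm.trans (ENNReal.tsum_le_tsum fun g => ?_)
  rw [← ofReal_norm]
  exact ENNReal.ofReal_le_ofReal (norm_coeff_mul_poincareTerm_le ρ hk g g⁻¹ i j z p)

lemma weight_mul_thetaPoint (hC : PoincareBound Γ X C) {k : ℕ} (hk : 2 ≤ k) (i : Fin m)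
    (z : Ball n) {p : Ball n} (hp : p ∈ X) :
    ((weight k z * weight k p : ℝ) : ℂ) * thetaPoint Γ ρ j k z p i = normTheta ρ j k i z p := by
  set w : ℂ := ((weight k z * weight k p : ℝ) : ℂ) with hw
  have hw0 : w ≠ 0 := Complex.ofReal_ne_zero.2 (mul_pos (weight_pos k z) (weight_pos k p)).ne'
  have hcomp : ∀ (g : autGroup Γ) (i : Fin m),
      (jac g.1 z ^ k • ((ρ g⁻¹).1 *ᵥ Pi.single j (bergman (g.1 z) p ^ k))) i =
        w⁻¹ * ((ρ g⁻¹).1 i j * poincareTerm k g z p) := by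
    intro g i
    rw [poincareTerm, ← hw, mul_left_comm _ w, inv_mul_cancel_left₀ hw0, Pi.smul_apply,
      Matrix.mulVec_single, Pi.smul_apply, Matrix.col_apply, MulOpposite.smul_eq_mul_unop,
      MulOpposite.unop_op, smul_eq_mul, mul_pow, aut_smul_def]
    ring
  have hs : Summable fun g : autGroup Γ =>
      jac g.1 z ^ k • ((ρ g⁻¹).1 *ᵥ Pi.single j (bergman (g.1 z) p ^ k)) := by
    rw [Pi.summable]
    intro i
    simp only [hcomp]
    exact (summable_normTheta ρ j hC hk i z hp).mul_left _
  rw [thetaPoint, Pi.smul_apply, tsum_apply hs]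
  simp only [hcomp]
  rw [tsum_mul_left, normTheta, smul_eq_mul, kernelConst_eq]
  field_simp

lemma aestronglyMeasurable_normTheta (hC : PoincareBound Γ X C) [Countable (autGroup Γ)] {k : ℕ}
    (hk : 2 ≤ k) (i : Fin m) {α : Type*} [MeasurableSpace α] {μ : Measure α} {a b : α → Ball n}
    (ha : Measurable a) (hb : Measurable b) (hX : ∀ᵐ x ∂μ, b x ∈ X) :
    AEStronglyMeasurable (fun x => normTheta ρ j k i (a x) (b x)) μ := by
  unfold normTheta
  refine AEStronglyMeasurable.const_mul (aestronglyMeasurable_of_tendsto_ae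
    (atTop : Filter (Finset (autGroup Γ)))
    (f := fun s x => ∑ g ∈ s, (ρ g⁻¹).1 i j * poincareTerm k g (a x) (b x)) (fun s => ?_) ?_) _
  · refine (Finset.measurable_fun_sum _ fun g _ => ?_).aestronglyMeasurable
    exact (measurable_poincareTerm k g ha hb).const_mul _
  · filter_upwards [hX] with x hx
    exact (summable_normTheta ρ j hC hk i (a x) hx).hasSum

lemma normTheta_smul (hC : PoincareBound Γ X C) {k : ℕ} (hk : 2 ≤ k) (g : autGroup Γ) (i : Fin m)
    (z : Ball n) {p : Ball n} (hp : p ∈ X) :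
    normTheta ρ j k i (g • z) p = ((‖jac g.1 z‖ : ℂ) / jac g.1 z) ^ k *
      ∑ l, (ρ g).1 i l * normTheta ρ j k l z p := by
  have hterm : ∀ h : autGroup Γ, (ρ h⁻¹).1 i j * poincareTerm k h (g • z) p =
      ((‖jac g.1 z‖ : ℂ) / jac g.1 z) ^ k *
        ∑ l, (ρ g).1 i l * ((ρ (h * g)⁻¹).1 l j * poincareTerm k (h * g) z p) := by
    intro h
    have hcoeff : (ρ h⁻¹).1 i j = ∑ l, (ρ g).1 i l * (ρ (h * g)⁻¹).1 l j := by
      rw [← Matrix.mul_apply, ← Matrix.UnitaryGroup.mul_val, ← map_mul, mul_inv_rev,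
        mul_inv_cancel_left]
    rw [poincareTerm_smul, hcoeff, Finset.sum_mul, Finset.mul_sum]
    exact Finset.sum_congr rfl fun l _ => by ring
  have hs : ∀ l, Summable fun h : autGroup Γ =>
      (ρ g).1 i l * ((ρ h⁻¹).1 l j * poincareTerm k h z p) :=
    fun l => (summable_normTheta ρ j hC hk l z hp).mul_left _
  have hshift := (Equiv.mulRight g).tsum_eq fun h : autGroup Γ =>
    ∑ l, (ρ g).1 i l * ((ρ h⁻¹).1 l j * poincareTerm k h z p)
  simp only [Equiv.coe_mulRight] at hshift
  simp only [normTheta, hterm]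
  rw [tsum_mul_left, hshift, Summable.tsum_finsetSum fun l _ => hs l, mul_left_comm]
  congr 1
  rw [Finset.mul_sum]
  exact Finset.sum_congr rfl fun l _ => by rw [tsum_mul_left, mul_left_comm]

lemma norm_normTheta_sub_le (hC : PoincareBound Γ X C) {a : ℝ} {k : ℕ} (hk : 2 ≤ k)
    {p q : Ball n} (hp : p ∈ X) (hq : ∀ g : autGroup Γ, g ≠ 1 → overlap (g • q) p ≤ a) :
    ‖normTheta ρ j k j q p - (kernelReal n k : ℂ) * poincareTerm k (1 : autGroup Γ) q p‖ ≤
      kernelReal n k * (√a ^ (k - 2) * C) := by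
  classical
  have hc := kernelReal_pos (n := n) (by omega : 1 ≤ k)
  have hle : ∀ g : autGroup Γ,
      ‖(if g = 1 then 0 else (ρ g⁻¹).1 j j * poincareTerm k g q p)‖ ≤
        √a ^ (k - 2) * overlap (g • q) p ^ (n + 1) := by
    intro g
    have ho := overlap_pos (g • q) p
    split_ifs with hg
    · rw [norm_zero]
      positivity
    · rw [norm_mul]
      have hcoeff := entry_norm_bound_of_unitary (ρ g⁻¹).2 j j
      exact (mul_le_of_le_one_left (norm_nonneg _) hcoeff).trans
        (norm_poincareTerm_le_mul hk (hq g hg))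
  have hone : (ρ (1 : autGroup Γ)⁻¹).1 j j = 1 := by simp
  rw [normTheta, ← mul_sub, norm_mul, Complex.norm_real, Real.norm_of_nonneg hc.le,
    (summable_normTheta ρ j hC hk j q hp).tsum_eq_add_tsum_ite 1, hone, one_mul,
    add_sub_cancel_left]
  gcongr
  refine (tsum_of_norm_bounded ((hC p hp q).1.mul_left _).hasSum hle).trans ?_
  rw [tsum_mul_left]
  gcongr
  exact (hC p hp q).2

end NormTheta

section Unfolding

variable {n : ℕ} {Γ : Subgroup (SU n)} {m : ℕ} (ρ : autGroup Γ →* Matrix.unitaryGroup (Fin m) ℂ)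
  (j : Fin m) {X : Set (Ball n)} {C : ℝ}

lemma conj_norm_div_self_pow_mul {w : ℂ} (hw : w ≠ 0) (k : ℕ) :
    (starRingEnd ℂ) (((‖w‖ : ℂ) / w) ^ k) * ((‖w‖ : ℂ) / w) ^ k = 1 := by
  rw [Complex.conj_mul', norm_pow, norm_div, Complex.norm_real, norm_norm,
    div_self (norm_ne_zero_iff.2 hw)]
  simp

lemma conj_normTheta (k : ℕ) (i : Fin m) (z q : Ball n) :
    (starRingEnd ℂ) (normTheta ρ j k i z q) = (kernelReal n k : ℂ) *
      ∑' g : autGroup Γ, (ρ g).1 j i * (starRingEnd ℂ) (poincareTerm k g z q) := by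
  rw [normTheta, map_mul, Complex.conj_ofReal, Complex.conj_tsum]
  congr 1
  refine tsum_congr fun g => ?_
  rw [map_mul, map_inv, Matrix.UnitaryGroup.inv_val, Matrix.star_apply]
  simp

lemma sum_normTheta_mul_conj (hC : PoincareBound Γ X C) {k : ℕ} (hk : 2 ≤ k) (z : Ball n)
    {p q : Ball n} (hp : p ∈ X) (hq : q ∈ X) :
    ∑ i, normTheta ρ j k i z p * (starRingEnd ℂ) (normTheta ρ j k i z q) =
      ∑' g : autGroup Γ, (kernelReal n k : ℂ) * normTheta ρ j k j (g • z) p *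
        (starRingEnd ℂ) (poincareTerm k (1 : autGroup Γ) (g • z) q) := by
  have hs : ∀ i, Summable fun g : autGroup Γ =>
      (ρ g).1 j i * (starRingEnd ℂ) (poincareTerm k g z q) := fun i =>
    (hC q hq z).1.of_norm_bounded fun g => by
      simpa only [norm_mul, RCLike.norm_conj] using
        norm_coeff_mul_poincareTerm_le ρ hk g g j i z q
  simp only [conj_normTheta, ← tsum_mul_left]
  rw [← Summable.tsum_finsetSum fun i _ => ((hs i).mul_left _).mul_left _]
  refine tsum_congr fun g => ?_
  rw [normTheta_smul ρ j hC hk g j z hp, poincareTerm_smul, one_mul, map_mul, Finset.mul_sum,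
    Finset.mul_sum, Finset.sum_mul]
  refine Finset.sum_congr rfl fun i _ => ?_
  linear_combination (-(kernelReal n k : ℂ) * normTheta ρ j k i z p * (ρ g).1 j i *
    (starRingEnd ℂ) (poincareTerm k g z q)) * conj_norm_div_self_pow_mul (jac_ne_zero g z) k

lemma norm_poincareTerm_one_le {k : ℕ} (hk : 2 ≤ k) (z q : Ball n) :
    ‖poincareTerm k (1 : autGroup Γ) z q‖ ≤ overlap z q ^ (n + 1) := by
  simpa using norm_poincareTerm_le hk (1 : autGroup Γ) z q

lemma tsum_lintegral_overlap_mul_ne_top [Countable (autGroup Γ)] (hC : PoincareBound Γ X C)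
    {p : Ball n} (hp : p ∈ X) (q : Ball n) :
    ∑' g : autGroup Γ, ∫⁻ z, ENNReal.ofReal (overlap (g • z) p ^ (n + 1)) *
      ENNReal.ofReal (overlap z q ^ (n + 1)) ∂(invVol n) ≠ ⊤ := by
  have hmeas : ∀ g : autGroup Γ, Measurable fun z : Ball n =>
      ENNReal.ofReal (overlap (g • z) p ^ (n + 1)) *
        ENNReal.ofReal (overlap z q ^ (n + 1)) := fun g =>
    (((continuous_overlap_left p).comp (continuous_const_smul g)).pow _).measurable.ennreal_ofReal
      |>.mul ((continuous_overlap_left q).pow _).measurable.ennreal_ofReal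
  have hle : ∀ z : Ball n, ∑' g : autGroup Γ, ENNReal.ofReal (overlap (g • z) p ^ (n + 1)) *
      ENNReal.ofReal (overlap z q ^ (n + 1)) ≤
        ENNReal.ofReal C * ENNReal.ofReal (overlap z q ^ (n + 1)) := by
    intro z
    rw [ENNReal.tsum_mul_right, ← ENNReal.ofReal_tsum_of_nonneg
      (fun g => (pow_pos (overlap_pos _ _) _).le) (hC p hp z).1]
    gcongr
    exact (hC p hp z).2
  rw [← lintegral_tsum fun g => (hmeas g).aemeasurable]
  refine ne_top_of_le_ne_top ?_ (lintegral_mono hle)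
  rw [lintegral_const_mul' _ _ ENNReal.ofReal_ne_top]
  exact ENNReal.mul_ne_top ENNReal.ofReal_ne_top (lintegral_overlap_pow_lt_top q).ne

lemma integrable_normTheta_mul_conj_poincareTerm (hC : PoincareBound Γ X C)
    [Countable (autGroup Γ)] {k : ℕ} (hk : 2 ≤ k) {p : Ball n} (hp : p ∈ X) (q : Ball n) :
    Integrable (fun z => normTheta ρ j k j z p *
      (starRingEnd ℂ) (poincareTerm k (1 : autGroup Γ) z q)) (invVol n) := by
  have hterm : Integrable (fun z => (starRingEnd ℂ) (poincareTerm k (1 : autGroup Γ) z q))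
      (invVol n) := by
    refine (integrable_overlap_pow q).mono' ?_ (ae_of_all _ fun z => ?_)
    · exact (Complex.continuous_conj.measurable.comp (measurable_poincareTerm k (1 : autGroup Γ)
        measurable_id measurable_const)).aestronglyMeasurable
    · rw [RCLike.norm_conj]
      exact norm_poincareTerm_one_le hk z q
  exact hterm.bdd_mul (aestronglyMeasurable_normTheta ρ j hC hk j measurable_id measurable_const
    (ae_of_all _ fun _ => hp)) (ae_of_all _ fun z => norm_normTheta_le ρ j hC hk j z hp)

lemma integral_normTheta_mul_conj_poincareTerm (hC : PoincareBound Γ X C) [Countable (autGroup Γ)]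
    {k : ℕ} (hk : 2 ≤ k) {p : Ball n} (hp : p ∈ X) (q : Ball n) :
    (kernelReal n k : ℂ) * ∫ z, normTheta ρ j k j z p *
      (starRingEnd ℂ) (poincareTerm k (1 : autGroup Γ) z q) ∂(invVol n) =
      normTheta ρ j k j q p := by
  have hexpand : ∀ z, normTheta ρ j k j z p *
      (starRingEnd ℂ) (poincareTerm k (1 : autGroup Γ) z q) = (kernelReal n k : ℂ) *
        ∑' g : autGroup Γ, (ρ g⁻¹).1 j j * poincareTerm k g z p *
          (starRingEnd ℂ) (poincareTerm k (1 : autGroup Γ) z q) := by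
    intro z
    rw [normTheta, mul_assoc, tsum_mul_right]
  have hmeas : ∀ g : autGroup Γ, AEStronglyMeasurable (fun z => (ρ g⁻¹).1 j j *
      poincareTerm k g z p * (starRingEnd ℂ) (poincareTerm k (1 : autGroup Γ) z q)) (invVol n) :=
    fun g => (((measurable_poincareTerm k g measurable_id measurable_const).const_mul _).mul
      (Complex.continuous_conj.measurable.comp (measurable_poincareTerm k (1 : autGroup Γ)
        measurable_id measurable_const))).aestronglyMeasurable
  have hbound : ∀ (g : autGroup Γ) (z : Ball n), ‖(ρ g⁻¹).1 j j * poincareTerm k g z p *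
      (starRingEnd ℂ) (poincareTerm k (1 : autGroup Γ) z q)‖ₑ ≤
        ENNReal.ofReal (overlap (g • z) p ^ (n + 1)) *
          ENNReal.ofReal (overlap z q ^ (n + 1)) := by
    intro g z
    rw [enorm_mul, ← ofReal_norm, ← ofReal_norm, RCLike.norm_conj]
    gcongr
    · exact norm_coeff_mul_poincareTerm_le ρ hk g g⁻¹ j j z p
    · exact norm_poincareTerm_one_le hk z q
  simp only [hexpand]
  rw [integral_const_mul, integral_tsum hmeas (ne_top_of_le_ne_top
    (tsum_lintegral_overlap_mul_ne_top hC hp q)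
    (ENNReal.tsum_le_tsum fun g => lintegral_mono (hbound g))), normTheta, ← tsum_mul_left]
  congr 1
  refine tsum_congr fun g => ?_
  simp only [mul_assoc]
  rw [integral_const_mul, mul_left_comm, integral_poincareTerm_mul_conj (by omega)]

variable {S : Set (Ball n)}

theorem setIntegral_sum_normTheta_mul_conj
    (hS : IsFundamentalDomain (autGroup Γ) S (invVol n))
    (hC : PoincareBound Γ X C) [Countable (autGroup Γ)] {k : ℕ} (hk : 2 ≤ k) {p q : Ball n}
    (hp : p ∈ X) (hq : q ∈ X) :
    ∫ z in S, ∑ i, normTheta ρ j k i z p * (starRingEnd ℂ) (normTheta ρ j k i z q) ∂(invVol n) =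
      normTheta ρ j k j q p := by
  have hInt := (integrable_normTheta_mul_conj_poincareTerm ρ j hC hk hp q).const_mul
    (kernelReal n k : ℂ)
  simp only [← mul_assoc] at hInt
  rw [← integral_normTheta_mul_conj_poincareTerm ρ j hC hk hp q, ← integral_const_mul]
  simp only [← mul_assoc]
  rw [hS.integral_eq_tsum'' _ hInt]
  simp only [sum_normTheta_mul_conj ρ j hC hk _ hp hq]
  refine integral_tsum (fun g => ?_) ?_
  · exact (hInt.1.comp_measurePreserving (measurePreserving_smul g (invVol n))).restrict
  · rw [← hS.lintegral_eq_tsum'' fun z => ‖(kernelReal n k : ℂ) * normTheta ρ j k j z p *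
      (starRingEnd ℂ) (poincareTerm k (1 : autGroup Γ) z q)‖ₑ]
    exact hInt.2.ne

lemma setLIntegral_enorm_normTheta_le (hS : IsFundamentalDomain (autGroup Γ) S (invVol n))
    [Countable (autGroup Γ)] {k : ℕ} (hk : 2 ≤ k) (i : Fin m) (p : Ball n) :
    ∫⁻ z in S, ‖normTheta ρ j k i z p‖ₑ ∂(invVol n) ≤ ENNReal.ofReal (kernelReal n k) *
      (ENNReal.ofReal (bergmanConst n) * volume (Metric.ball (0 : E n) 1)) := by
  refine (lintegral_mono fun z => enorm_normTheta_le ρ j hk i z p).trans_eq ?_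
  rw [lintegral_const_mul' _ _ ENNReal.ofReal_ne_top, lintegral_tsum, ← lintegral_overlap_pow p,
    hS.lintegral_eq_tsum'']
  exact fun g => (((continuous_overlap_left p).comp
    (continuous_const_smul g)).pow _).measurable.ennreal_ofReal.aemeasurable

lemma integrable_normTheta_prod (hS : IsFundamentalDomain (autGroup Γ) S (invVol n))
    (hC : PoincareBound Γ X C) [Countable (autGroup Γ)] {k : ℕ} (hk : 2 ≤ k) (i : Fin m)
    {α : Type*} [MeasurableSpace α] {μ : Measure α} [IsFiniteMeasure μ]
    {b : α → Ball n} (hb : Measurable b) (hX : ∀ᵐ x ∂μ, b x ∈ X) :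
    Integrable (fun y : Ball n × α => normTheta ρ j k i y.1 (b y.2))
      (((invVol n).restrict S).prod μ) := by
  have hmeas : AEStronglyMeasurable (fun y : Ball n × α => normTheta ρ j k i y.1 (b y.2))
      (((invVol n).restrict S).prod μ) :=
    aestronglyMeasurable_normTheta ρ j hC hk i measurable_fst (hb.comp measurable_snd)
      (Measure.quasiMeasurePreserving_snd.ae hX)
  refine ⟨hmeas, ?_⟩
  rw [HasFiniteIntegral, lintegral_prod_symm _ hmeas.enorm]
  refine (lintegral_mono fun x => setLIntegral_enorm_normTheta_le ρ j hS hk i (b x)).trans_lt ?_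
  rw [lintegral_const]
  exact ENNReal.mul_lt_top (ENNReal.mul_lt_top ENNReal.ofReal_lt_top
    (ENNReal.mul_lt_top ENNReal.ofReal_lt_top measure_ball_lt_top)) (measure_lt_top μ _)

lemma integrable_normTheta (hC : PoincareBound Γ X C) [Countable (autGroup Γ)] {k : ℕ}
    (hk : 2 ≤ k) {ν : Measure (Ball n)} [IsFiniteMeasure ν] (hX : ∀ᵐ p ∂ν, p ∈ X) (i : Fin m)
    (z : Ball n) : Integrable (fun p => normTheta ρ j k i z p) ν := by
  refine Integrable.of_bound (aestronglyMeasurable_normTheta ρ j hC hk i measurable_const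
    measurable_id hX) (kernelReal n k * C) ?_
  filter_upwards [hX] with p hp
  exact norm_normTheta_le ρ j hC hk i z hp

lemma weight_mul_theta (hC : PoincareBound Γ X C) [Countable (autGroup Γ)] {k : ℕ} (hk : 2 ≤ k)
    {ν : Measure (Ball n)} [IsFiniteMeasure ν] (hX : ∀ᵐ p ∂ν, p ∈ X) (i : Fin m) (z : Ball n) :
    (weight k z : ℂ) * theta Γ ρ ν j k z i = ∫ p, normTheta ρ j k i z p ∂ν := by
  have hw : (weight k z : ℂ) ≠ 0 := Complex.ofReal_ne_zero.2 (weight_pos k z).ne'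
  have hcomp : ∀ i, (fun p => (bergmanDiag p ^ (-(k : ℝ) / 2) • thetaPoint Γ ρ j k z p) i) =ᵐ[ν]
      fun p => (weight k z : ℂ)⁻¹ * normTheta ρ j k i z p := by
    intro i
    filter_upwards [hX] with p hp
    rw [← weight_mul_thetaPoint ρ j hC hk i z hp, Pi.smul_apply, ← weight]
    push_cast
    rw [mul_assoc, inv_mul_cancel_left₀ hw, Complex.real_smul]
  rw [theta, eval_integral fun i =>
    (((integrable_normTheta ρ j hC hk hX i z).const_mul (weight k z : ℂ)⁻¹).congr (hcomp i).symm),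
    integral_congr_ae (hcomp i), integral_const_mul, mul_inv_cancel_left₀ hw]

lemma theta_dotProduct_star_theta_mul (hC : PoincareBound Γ X C) [Countable (autGroup Γ)] {k : ℕ}
    (hk : 2 ≤ k) {μ ν : Measure (Ball n)} [IsFiniteMeasure μ] [IsFiniteMeasure ν]
    (hμ : ∀ᵐ p ∂μ, p ∈ X) (hν : ∀ᵐ q ∂ν, q ∈ X) (z : Ball n) :
    (theta Γ ρ μ j k z ⬝ᵥ star (theta Γ ρ ν j k z)) * ((bergmanDiag z ^ k)⁻¹ : ℝ) =
      ∫ x, ∑ i, normTheta ρ j k i z x.1 * (starRingEnd ℂ) (normTheta ρ j k i z x.2)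
        ∂(μ.prod ν) := by
  have hInt : ∀ i, Integrable (fun x : Ball n × Ball n => normTheta ρ j k i z x.1 *
      (starRingEnd ℂ) (normTheta ρ j k i z x.2)) (μ.prod ν) := fun i =>
    (integrable_normTheta ρ j hC hk hμ i z).mul_prod
      (Complex.conjCLE.toContinuousLinearMap.integrable_comp
        (integrable_normTheta ρ j hC hk hν i z))
  rw [integral_finsetSum _ fun i _ => hInt i, dotProduct, Finset.sum_mul]
  refine Finset.sum_congr rfl fun i _ => ?_
  refine Eq.trans ?_ (integral_prod_mul (fun p => normTheta ρ j k i z p)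
    (fun q => (starRingEnd ℂ) (normTheta ρ j k i z q))).symm
  rw [integral_conj, ← weight_mul_theta ρ j hC hk hμ, ← weight_mul_theta ρ j hC hk hν, ← weight_sq,
    map_mul, Complex.conj_ofReal, Pi.star_apply, RCLike.star_def]
  push_cast
  ring

theorem innerProd_theta (hS : IsFundamentalDomain (autGroup Γ) S (invVol n))
    (hC : PoincareBound Γ X C) [Countable (autGroup Γ)] {k : ℕ} (hk : 2 ≤ k)
    {μ ν : Measure (Ball n)} [IsFiniteMeasure μ] [IsFiniteMeasure ν]
    (hμ : ∀ᵐ p ∂μ, p ∈ X) (hν : ∀ᵐ q ∂ν, q ∈ X) :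
    innerProd S k (theta Γ ρ μ j k) (theta Γ ρ ν j k) =
      ∫ x, normTheta ρ j k j x.2 x.1 ∂(μ.prod ν) := by
  have hfst : ∀ᵐ x ∂(μ.prod ν), x.1 ∈ X := Measure.quasiMeasurePreserving_fst.ae hμ
  have hsnd : ∀ᵐ x ∂(μ.prod ν), x.2 ∈ X := Measure.quasiMeasurePreserving_snd.ae hν
  have hInt : ∀ i, Integrable (fun y : Ball n × Ball n × Ball n => normTheta ρ j k i y.1 y.2.1 *
      (starRingEnd ℂ) (normTheta ρ j k i y.1 y.2.2))
      (((invVol n).restrict S).prod (μ.prod ν)) := fun i => by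
    have hsnd' : ∀ᵐ y ∂(((invVol n).restrict S).prod (μ.prod ν)), y.2.2 ∈ X :=
      Measure.quasiMeasurePreserving_snd.ae hsnd
    refine (integrable_normTheta_prod ρ j hS hC hk i measurable_fst hfst).mul_bdd
      (c := kernelReal n k * C) (Complex.continuous_conj.comp_aestronglyMeasurable
      (aestronglyMeasurable_normTheta ρ j hC hk i measurable_fst measurable_snd.snd hsnd')) ?_
    filter_upwards [hsnd'] with y hy
    rw [RCLike.norm_conj]
    exact norm_normTheta_le ρ j hC hk i y.1 hy
  simp only [innerProd, theta_dotProduct_star_theta_mul ρ j hC hk hμ hν]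
  rw [integral_integral_swap (integrable_finsetSum _ fun i _ => hInt i)]
  refine integral_congr_ae ?_
  filter_upwards [hfst, hsnd] with x hx₁ hx₂
  exact setIntegral_sum_normTheta_mul_conj ρ j hS hC hk hx₁ hx₂

end Unfolding

section Laplace

variable {V : Type*} [NormedAddCommGroup V] [InnerProductSpace ℝ V]

lemma norm_inv_sqrt_smul_sq {c : ℝ} (hc : 0 ≤ c) (v : V) : ‖(√c)⁻¹ • v‖ ^ 2 = ‖v‖ ^ 2 / c := by
  rw [norm_smul, norm_inv, Real.norm_of_nonneg (Real.sqrt_nonneg _), mul_pow, inv_pow,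
    Real.sq_sqrt hc, div_eq_inv_mul]

variable [FiniteDimensional ℝ V] [MeasurableSpace V] [BorelSpace V]

lemma integrable_exp_neg_mul_norm_sq {c : ℝ} (hc : 0 < c) :
    Integrable fun v : V => Real.exp (-c * ‖v‖ ^ 2) := by
  refine Integrable.congr (f := fun v : V => (Complex.exp (-(c : ℂ) * ‖v‖ ^ 2)).re) ?_
    (ae_of_all _ fun v => ?_)
  · simpa using (GaussianFourier.integrable_cexp_neg_mul_sq_norm_add (b := (c : ℂ)) (V := V)
      (by simpa using hc) 0 0).re
  · simp only
    rw [show -(c : ℂ) * (‖v‖ : ℂ) ^ 2 = ((-c * ‖v‖ ^ 2 : ℝ) : ℂ) by push_cast; ring,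
      Complex.exp_ofReal_re]

lemma integral_comp_inv_sqrt_smul (f : V → ℝ) {c : ℝ} (hc : 0 ≤ c) :
    ∫ v, f ((√c)⁻¹ • v) = c ^ ((Module.finrank ℝ V : ℝ) / 2) * ∫ v, f v := by
  rw [Measure.integral_comp_smul volume f, smul_eq_mul, inv_pow, inv_inv,
    abs_of_nonneg (by positivity), Real.sqrt_eq_rpow, ← Real.rpow_natCast, ← Real.rpow_mul hc]
  ring_nf

/-- Laplace's method: rescaling by `√k` and dominated convergence. -/
lemma tendsto_rpow_mul_integral {g : ℕ → V → ℝ} {G : V → ℝ} {M c : ℝ} (hc : 0 < c)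
    (hm : ∀ k, Measurable (g k))
    (hb : ∀ᶠ k : ℕ in atTop, ∀ x, |g k x| ≤ M * Real.exp (-(c * k) * ‖x‖ ^ 2))
    (hlim : ∀ s, Tendsto (fun k : ℕ => g k ((√k)⁻¹ • s)) atTop (𝓝 (G s))) :
    Integrable G ∧ Tendsto (fun k : ℕ => (k : ℝ) ^ ((Module.finrank ℝ V : ℝ) / 2) * ∫ x, g k x)
      atTop (𝓝 (∫ s, G s)) := by
  have hInt : Integrable fun v : V => M * Real.exp (-c * ‖v‖ ^ 2) :=
    (integrable_exp_neg_mul_norm_sq hc).const_mul M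
  have hmeas : ∀ k : ℕ, AEStronglyMeasurable fun s => g k ((√k)⁻¹ • s) := fun k =>
    ((hm k).comp (measurable_const_smul _)).aestronglyMeasurable
  have hbound : ∀ᶠ k : ℕ in atTop, ∀ s,
      ‖g k ((√k)⁻¹ • s)‖ ≤ M * Real.exp (-c * ‖s‖ ^ 2) := by
    filter_upwards [hb, eventually_gt_atTop 0] with k hk hk0 s
    have hk0' : (0 : ℝ) < k := Nat.cast_pos.2 hk0
    refine (hk _).trans_eq ?_
    rw [norm_inv_sqrt_smul_sq hk0'.le]
    field_simp
  constructor
  · refine hInt.mono' (aestronglyMeasurable_of_tendsto_ae atTop hmeas (ae_of_all _ hlim))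
      (ae_of_all _ fun s => le_of_tendsto (hlim s).norm ?_)
    filter_upwards [hbound] with k hk using hk s
  · refine (tendsto_integral_filter_of_dominated_convergence _ (Eventually.of_forall hmeas)
      (hbound.mono fun k hk => ae_of_all _ hk) hInt (ae_of_all _ hlim)).congr fun k => ?_
    exact integral_comp_inv_sqrt_smul (g k) k.cast_nonneg

end Laplace

section KernelConstant

variable {n : ℕ}

lemma indicator_ball_one_sub_norm_sq_pow_le {V : Type*} [SeminormedAddCommGroup V] (l : ℕ)
    (x : V) : |(Metric.ball (0 : V) 1).indicator (fun x => (1 - ‖x‖ ^ 2) ^ l) x| ≤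
      Real.exp (-l * ‖x‖ ^ 2) := by
  by_cases hx : x ∈ Metric.ball (0 : V) 1
  · have hx1 : 0 ≤ 1 - ‖x‖ ^ 2 :=
      sub_nonneg.2 (pow_le_one₀ (norm_nonneg x) (mem_ball_zero_iff.1 hx).le)
    rw [Set.indicator_of_mem hx, abs_of_nonneg (pow_nonneg hx1 l)]
    calc (1 - ‖x‖ ^ 2) ^ l ≤ Real.exp (-‖x‖ ^ 2) ^ l := by
          gcongr
          exact Real.one_sub_le_exp_neg _
      _ = Real.exp (-l * ‖x‖ ^ 2) := by
          rw [← Real.exp_nat_mul]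
          ring_nf
  · rw [Set.indicator_of_notMem hx, abs_zero]
    positivity

lemma tendsto_one_sub_div_pow (N : ℕ) (x : ℝ) :
    Tendsto (fun k : ℕ => (1 - x / k) ^ (N * (k - 1))) atTop (𝓝 (Real.exp (-(N * x)))) := by
  have hbase : Tendsto (fun k : ℕ => 1 + -x / k) atTop (𝓝 1) := by
    simpa using (tendsto_const_div_atTop_nhds_zero_nat (-x)).const_add 1
  have hlim := ((Real.tendsto_one_add_div_pow_exp (-x)).div hbase one_ne_zero).pow N
  rw [div_one, ← Real.exp_nat_mul, mul_neg] at hlim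
  refine hlim.congr' ?_
  filter_upwards [hbase.eventually_ne one_ne_zero, eventually_gt_atTop 0] with k hk hk0
  obtain ⟨l, rfl⟩ := Nat.exists_eq_succ_of_ne_zero hk0.ne'
  rw [Pi.div_apply, Nat.succ_eq_add_one, pow_succ, mul_div_cancel_right₀ _ hk, mul_comm N, pow_mul,
    Nat.add_sub_cancel, neg_div, ← sub_eq_add_neg]

lemma integral_inv_bergmanDiag_pow {k : ℕ} (hk : 1 ≤ k) :
    bergmanConst n ^ k * ∫ w : Ball n, (bergmanDiag w ^ k)⁻¹ ∂(invVol n) =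
      bergmanConst n * ∫ x : E n, (Metric.ball (0 : E n) 1).indicator
        (fun x => (1 - ‖x‖ ^ 2) ^ ((n + 1) * (k - 1))) x := by
  have hb := bergmanConst_pos n
  rw [invVol, integral_withDensity_eq_integral_toReal_smul
    measurable_bergmanDiag.ennreal_ofReal (ae_of_all _ fun _ => ENNReal.ofReal_lt_top),
    integral_indicator measurableSet_ball, ← integral_subtype_comap measurableSet_ball,
    ← integral_const_mul, ← integral_const_mul]
  refine integral_congr_ae (ae_of_all _ fun w => ?_)
  have hw := one_sub_norm_sq_pos w
  obtain ⟨l, rfl⟩ := Nat.exists_eq_add_of_le hk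
  simp only [smul_eq_mul]
  rw [ENNReal.toReal_ofReal (bergmanDiag_pos w).le, bergmanDiag_eq, Nat.add_sub_cancel_left,
    div_pow, pow_mul]
  field_simp
  ring

lemma finrank_real_E_div_two (n : ℕ) : (Module.finrank ℝ (E n) : ℝ) / 2 = n := by
  simp [finrank_real_of_complex]

lemma tendsto_integral_one_sub_norm_sq_pow (n : ℕ) :
    Tendsto (fun k : ℕ => (k : ℝ) ^ n * ∫ x : E n, (Metric.ball (0 : E n) 1).indicator
      (fun x => (1 - ‖x‖ ^ 2) ^ ((n + 1) * (k - 1))) x) atTop (𝓝 ((Real.pi / (n + 1)) ^ n)) := by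
  have hbound : ∀ᶠ k : ℕ in atTop, ∀ x : E n, |(Metric.ball (0 : E n) 1).indicator
      (fun x => (1 - ‖x‖ ^ 2) ^ ((n + 1) * (k - 1))) x| ≤
        1 * Real.exp (-(1 / 2 * k) * ‖x‖ ^ 2) := by
    filter_upwards [eventually_ge_atTop 2] with k hk x
    have hkl : k ≤ 2 * ((n + 1) * (k - 1)) := by
      have : k ≤ 2 * (k - 1) := by omega
      nlinarith [Nat.zero_le (n * (k - 1))]
    have hkl' : (k : ℝ) ≤ 2 * ((n + 1) * (k - 1) : ℕ) := by exact_mod_cast hkl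
    rw [one_mul]
    refine (indicator_ball_one_sub_norm_sq_pow_le _ x).trans ?_
    gcongr
    linarith
  have hlim : ∀ s : E n, Tendsto (fun k : ℕ => (Metric.ball (0 : E n) 1).indicator
      (fun x => (1 - ‖x‖ ^ 2) ^ ((n + 1) * (k - 1))) ((√k)⁻¹ • s)) atTop
      (𝓝 (Real.exp (-(n + 1) * ‖s‖ ^ 2))) := by
    intro s
    have h := tendsto_one_sub_div_pow (n + 1) (‖s‖ ^ 2)
    push_cast at h
    rw [← neg_mul] at h
    refine h.congr' ?_
    filter_upwards [(tendsto_natCast_atTop_atTop (R := ℝ)).eventually_gt_atTop (‖s‖ ^ 2)]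
      with k hk
    have hk0 : (0 : ℝ) < k := (sq_nonneg _).trans_lt hk
    have hns := norm_inv_sqrt_smul_sq hk0.le s
    rw [Set.indicator_of_mem, hns]
    rw [mem_ball_zero_iff, ← sq_lt_one_iff₀ (norm_nonneg _), hns, div_lt_one hk0]
    exact hk
  have hLaplace := (tendsto_rpow_mul_integral (by norm_num : (0 : ℝ) < 1 / 2)
    (fun k => Measurable.indicator (by fun_prop) measurableSet_ball) hbound hlim).2
  simpa only [GaussianFourier.integral_rexp_neg_mul_sq_norm (by positivity : (0 : ℝ) < n + 1),
    finrank_real_E_div_two, Real.rpow_natCast] using hLaplace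

lemma tendsto_kernelReal_div_pow (n : ℕ) :
    Tendsto (fun k : ℕ => kernelReal n k / (k : ℝ) ^ n) atTop
      (𝓝 ((n + 1) ^ n / n.factorial)) := by
  have hb := bergmanConst_pos n
  have hlim := ((tendsto_integral_one_sub_norm_sq_pow n).const_mul (bergmanConst n)).inv₀
    (by positivity)
  have hval : (bergmanConst n * (Real.pi / (n + 1)) ^ n)⁻¹ = ((n : ℝ) + 1) ^ n / n.factorial := by
    rw [bergmanConst, div_pow]
    field_simp
  rw [hval] at hlim
  refine hlim.congr' ?_
  filter_upwards [eventually_ge_atTop 1] with k hk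
  rw [kernelReal, integral_inv_bergmanDiag_pow hk, div_eq_mul_inv _ ((k : ℝ) ^ n), ← mul_inv]
  ring_nf

end KernelConstant

section AdaptedChart

variable {n q : ℕ} {X : Set (Ball n)} {ν : Measure (Ball n)} {x : Ball n}

lemma exists_antilipschitzWith_domRestrict {V W : Type*} [NormedAddCommGroup V] [NormedSpace ℝ V]
    [FiniteDimensional ℝ V] [NormedAddCommGroup W] [NormedSpace ℝ W] {φ : V → W} {L : V →L[ℝ] W}
    {t₀ : V} (h : HasStrictFDerivAt φ L t₀) (hL : Function.Injective L) :
    ∃ K, ∃ s ∈ 𝓝 t₀, AntilipschitzWith K (s.domRestrict φ) := by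
  obtain ⟨K, hK, hKL⟩ := LinearMap.exists_antilipschitzWith (L : V →ₗ[ℝ] W)
    (LinearMap.ker_eq_bot.2 hL)
  obtain ⟨s, hs, happrox⟩ := h.approximates_deriv_on_nhds (c := K⁻¹ / 2) (Or.inr (by positivity))
  refine ⟨(K⁻¹ - K⁻¹ / 2)⁻¹, s, hs, ?_⟩
  convert! (hKL.domRestrict s).add_lipschitzWith happrox.lipschitz_sub
    (NNReal.half_lt_self (by positivity)) using 1
  ext t
  simp

/-- A parametrization, over a compact set of parameters, of a neighbourhood of `x` in `X`, in which
the measure `ν` has a continuous positive density. The lower Lipschitz bound compares the distances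
in `𝔹ⁿ` with those of the parameters. -/
structure AdaptedChart (q : ℕ) (X : Set (Ball n)) (ν : Measure (Ball n)) (x : Ball n) where
  dom : Set (EuclideanSpace ℝ (Fin q))
  param : EuclideanSpace ℝ (Fin q) → Ball n
  dens : EuclideanSpace ℝ (Fin q) → ℝ
  centre : EuclideanSpace ℝ (Fin q)
  deriv : EuclideanSpace ℝ (Fin q) →L[ℝ] E n
  lip : ℝ
  isCompact_dom : IsCompact dom
  dom_mem_nhds : dom ∈ 𝓝 centre
  param_centre : param centre = x
  image_mem_nhdsWithin : param '' dom ∈ 𝓝[X] x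
  continuousOn_param : ContinuousOn param dom
  continuousOn_dens : ContinuousOn dens dom
  dens_pos : ∀ t ∈ dom, 0 < dens t
  restrict_eq : ν.restrict (param '' dom) =
    ((volume.restrict dom).withDensity fun t => ENNReal.ofReal (dens t)).map param
  lip_pos : 0 < lip
  norm_sub_le_lip_mul : ∀ s ∈ dom, ∀ t ∈ dom, ‖s - t‖ ≤ lip * ‖(param s : E n) - param t‖
  hasFDerivAt_param : HasFDerivAt (fun t => (param t : E n)) deriv centre

lemma restrict_image_eq_map_withDensity {U K : Set (EuclideanSpace ℝ (Fin q))}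
    {φ : EuclideanSpace ℝ (Fin q) → Ball n} {f : EuclideanSpace ℝ (Fin q) → ℝ≥0∞}
    (hU : MeasurableSet U) (hφ : ContinuousOn φ U) (hinj : Set.InjOn φ U) (hK : IsCompact K)
    (hKU : K ⊆ U) (h : ν.restrict (φ '' U) = ((volume.restrict U).withDensity f).map φ) :
    ν.restrict (φ '' K) = ((volume.restrict K).withDensity f).map φ := by
  have hφK : MeasurableSet (φ '' K) := (hK.image_of_continuousOn (hφ.mono hKU)).measurableSet
  have hφm : AEMeasurable φ ((volume.restrict U).withDensity f) :=
    (hφ.aemeasurable hU).mono_ac (withDensity_absolutelyContinuous _ _)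
  have hpreimage : (φ ⁻¹' (φ '' K) : Set _) =ᵐ[(volume.restrict U).withDensity f] K := by
    filter_upwards [withDensity_absolutelyContinuous _ f |>.ae_le (ae_restrict_mem hU)] with t ht
    exact propext (hinj.mem_image_iff hKU ht)
  rw [← Set.inter_eq_self_of_subset_left (Set.image_mono hKU), ← Measure.restrict_restrict hφK, h,
    Measure.restrict_map_of_aemeasurable hφm hφK, Measure.restrict_congr_set hpreimage,
    restrict_withDensity hK.measurableSet, Measure.restrict_restrict hK.measurableSet,
    Set.inter_eq_self_of_subset_left hKU]

lemma IsLocalParam.continuousOn {U : Set (EuclideanSpace ℝ (Fin q))}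
    {φ : EuclideanSpace ℝ (Fin q) → Ball n} (h : IsLocalParam q X U φ) : ContinuousOn φ U :=
  continuousOn_iff_continuous_domRestrict.2 h.embedding.continuous

lemma IsLocalParam.image_mem_nhdsWithin {U K : Set (EuclideanSpace ℝ (Fin q))}
    {φ : EuclideanSpace ℝ (Fin q) → Ball n} (h : IsLocalParam q X U φ)
    {t : EuclideanSpace ℝ (Fin q)} (ht : t ∈ U) (hK : K ∈ 𝓝 t) : φ '' K ∈ 𝓝[X] (φ t) := by
  obtain ⟨V, hV, hVeq⟩ := h.image
  have hxV : φ t ∈ V := (hVeq ▸ Set.mem_image_of_mem φ ht : φ t ∈ X ∩ V).2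
  have hnhds : 𝓝[X] (φ t) = map (U.domRestrict φ) (𝓝 ⟨t, ht⟩) := by
    rw [h.embedding.map_nhds_eq, Set.range_domRestrict, hVeq, Set.domRestrict_apply,
      nhdsWithin_inter_of_mem' (nhdsWithin_le_nhds (hV.mem_nhds hxV))]
  rw [hnhds, mem_map]
  filter_upwards [continuous_subtype_val.continuousAt.preimage_mem_nhds hK] with s hs
    using Set.mem_image_of_mem φ hs

lemma nonempty_adaptedChart (hν : IsVolumeForm q X ν) (hx : x ∈ X) :
    Nonempty (AdaptedChart q X ν x) := by
  obtain ⟨U, φ, hφ, ⟨t₀, ht₀, rfl⟩, f, hf, hfpos, hmeas⟩ := hν.2 x hx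
  have hUt : U ∈ 𝓝 t₀ := hφ.isOpen.mem_nhds ht₀
  have hφc := hφ.continuousOn
  have hstrict : HasStrictFDerivAt (fun t => (φ t : E n))
      (fderiv ℝ (fun t => (φ t : E n)) t₀) t₀ :=
    (hφ.smooth.contDiffAt hUt).hasStrictFDerivAt (by simp)
  obtain ⟨K, s, hs, hKs⟩ := exists_antilipschitzWith_domRestrict hstrict (hφ.immersion t₀ ht₀)
  obtain ⟨r, hr, hball⟩ := Metric.nhds_basis_closedBall.mem_iff.1 (inter_mem hUt hs)
  have hBU : Metric.closedBall t₀ r ⊆ U := hball.trans Set.inter_subset_left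
  exact ⟨{
    dom := Metric.closedBall t₀ r
    param := φ
    dens := f
    centre := t₀
    deriv := fderiv ℝ (fun t => (φ t : E n)) t₀
    lip := K + 1
    isCompact_dom := isCompact_closedBall t₀ r
    dom_mem_nhds := Metric.closedBall_mem_nhds t₀ hr
    param_centre := rfl
    image_mem_nhdsWithin := hφ.image_mem_nhdsWithin ht₀ (Metric.closedBall_mem_nhds t₀ hr)
    continuousOn_param := hφc.mono hBU
    continuousOn_dens := hf.continuousOn.mono hBU
    dens_pos := fun t ht => hfpos t (hBU ht)
    restrict_eq := restrict_image_eq_map_withDensity hφ.isOpen.measurableSet hφc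
      (Set.injOn_iff_injective.2 hφ.embedding.injective) (isCompact_closedBall t₀ r) hBU hmeas
    lip_pos := by positivity
    norm_sub_le_lip_mul := fun s hs t ht => by
      have h := hKs.le_mul_dist ⟨s, (hball hs).2⟩ ⟨t, (hball ht).2⟩
      rw [Subtype.dist_eq, dist_eq_norm, dist_eq_norm] at h
      refine h.trans ?_
      gcongr
      · linarith
      · rfl
    hasFDerivAt_param := hstrict.hasFDerivAt }⟩

namespace AdaptedChart

variable (c : AdaptedChart q X ν x)

lemma centre_mem_dom : c.centre ∈ c.dom := mem_of_mem_nhds c.dom_mem_nhds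

lemma measurableSet_dom : MeasurableSet c.dom := c.isCompact_dom.measurableSet

lemma isCompact_image : IsCompact (c.param '' c.dom) :=
  c.isCompact_dom.image_of_continuousOn c.continuousOn_param

lemma aemeasurable_dens : AEMeasurable (fun t => ENNReal.ofReal (c.dens t))
    (volume.restrict c.dom) :=
  (c.continuousOn_dens.aemeasurable c.measurableSet_dom).ennreal_ofReal

lemma aemeasurable_param : AEMeasurable c.param
    ((volume.restrict c.dom).withDensity fun t => ENNReal.ofReal (c.dens t)) :=
  (c.continuousOn_param.aemeasurable c.measurableSet_dom).mono_ac
    (withDensity_absolutelyContinuous _ _)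

lemma exists_dens_le : ∃ M, 0 ≤ M ∧ ∀ t ∈ c.dom, c.dens t ≤ M := by
  obtain ⟨M, hM⟩ := c.isCompact_dom.bddAbove_image c.continuousOn_dens
  exact ⟨M, (c.dens_pos _ c.centre_mem_dom).le.trans (hM ⟨_, c.centre_mem_dom, rfl⟩),
    fun t ht => hM ⟨t, ht, rfl⟩⟩

lemma setLIntegral_image {h : Ball n → ℝ≥0∞} (hh : Measurable h) :
    ∫⁻ p in c.param '' c.dom, h p ∂ν =
      ∫⁻ t in c.dom, ENNReal.ofReal (c.dens t) * h (c.param t) := by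
  rw [c.restrict_eq, lintegral_map' hh.aemeasurable c.aemeasurable_param,
    lintegral_withDensity_eq_lintegral_mul₀ c.aemeasurable_dens (g := fun t => h (c.param t))
      (hh.comp_aemeasurable (c.continuousOn_param.aemeasurable c.measurableSet_dom))]
  rfl

lemma setIntegral_image {h : Ball n → ℝ} (hh : Measurable h) :
    ∫ p in c.param '' c.dom, h p ∂ν = ∫ t in c.dom, c.dens t * h (c.param t) := by
  rw [c.restrict_eq, integral_map c.aemeasurable_param hh.aestronglyMeasurable,
    integral_withDensity_eq_integral_toReal_smul₀ c.aemeasurable_dens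
      (ae_of_all _ fun _ => ENNReal.ofReal_lt_top)]
  refine setIntegral_congr_fun c.measurableSet_dom fun t ht => ?_
  simp only [ENNReal.toReal_ofReal (c.dens_pos t ht).le, smul_eq_mul]

lemma exists_norm_sub_le_two_mul (y : E n) :
    ∃ t' ∈ c.dom, ∀ t ∈ c.dom, ‖t - t'‖ ≤ 2 * c.lip * ‖(c.param t : E n) - y‖ := by
  obtain ⟨t', ht', hmin⟩ := c.isCompact_dom.exists_isMinOn ⟨c.centre, c.centre_mem_dom⟩
    (f := fun t => ‖(c.param t : E n) - y‖)
    ((continuous_subtype_val.comp_continuousOn c.continuousOn_param).sub continuousOn_const).norm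
  refine ⟨t', ht', fun t ht => (c.norm_sub_le_lip_mul t ht t' ht').trans ?_⟩
  have hle : ‖(c.param t' : E n) - y‖ ≤ ‖(c.param t : E n) - y‖ := hmin ht
  have htri := norm_sub_le ((c.param t : E n) - y) ((c.param t' : E n) - y)
  rw [sub_sub_sub_cancel_right] at htri
  rw [mul_comm 2, mul_assoc]
  gcongr
  · exact c.lip_pos.le
  · linarith

lemma exists_setLIntegral_gaussian_le : ∃ C : ℝ, 0 ≤ C ∧ ∀ N : ℝ, 0 < N → ∀ y : E n,
    ∫⁻ p in c.param '' c.dom, ENNReal.ofReal (Real.exp (-N * ‖(p : E n) - y‖ ^ 2)) ∂ν ≤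
      ENNReal.ofReal (C * N ^ (-(q : ℝ) / 2)) := by
  obtain ⟨M, hM0, hM⟩ := c.exists_dens_le
  have hlip := c.lip_pos
  refine ⟨M * (Real.pi * (2 * c.lip) ^ 2) ^ ((q : ℝ) / 2), by positivity, fun N hN y => ?_⟩
  obtain ⟨t', -, ht'⟩ := c.exists_norm_sub_le_two_mul y
  have hpoint : ∀ t ∈ c.dom, ENNReal.ofReal (c.dens t) *
      ENNReal.ofReal (Real.exp (-N * ‖(c.param t : E n) - y‖ ^ 2)) ≤
        ENNReal.ofReal (M * Real.exp (-(N / (2 * c.lip) ^ 2) * ‖t - t'‖ ^ 2)) := by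
    intro t ht
    rw [← ENNReal.ofReal_mul (c.dens_pos t ht).le]
    refine ENNReal.ofReal_le_ofReal
      (mul_le_mul (hM t ht) (Real.exp_le_exp.2 ?_) (Real.exp_pos _).le hM0)
    have hsq : ‖t - t'‖ ^ 2 ≤ (2 * c.lip) ^ 2 * ‖(c.param t : E n) - y‖ ^ 2 := by
      rw [← mul_pow]
      gcongr
      exact ht' t ht
    rw [neg_mul, neg_mul, neg_le_neg_iff, div_mul_eq_mul_div, div_le_iff₀ (by positivity)]
    nlinarith
  calc ∫⁻ p in c.param '' c.dom, ENNReal.ofReal (Real.exp (-N * ‖(p : E n) - y‖ ^ 2)) ∂ν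
      = ∫⁻ t in c.dom, ENNReal.ofReal (c.dens t) *
          ENNReal.ofReal (Real.exp (-N * ‖(c.param t : E n) - y‖ ^ 2)) :=
        c.setLIntegral_image (by fun_prop)
    _ ≤ ∫⁻ t, ENNReal.ofReal (M * Real.exp (-(N / (2 * c.lip) ^ 2) * ‖t - t'‖ ^ 2)) :=
        (setLIntegral_mono' c.measurableSet_dom hpoint).trans (setLIntegral_le_lintegral _ _)
    _ = ENNReal.ofReal (M * (Real.pi / (N / (2 * c.lip) ^ 2)) ^ ((q : ℝ) / 2)) := by
        rw [lintegral_sub_right_eq_self (fun t => ENNReal.ofReal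
            (M * Real.exp (-(N / (2 * c.lip) ^ 2) * ‖t‖ ^ 2))) t',
          ← ofReal_integral_eq_lintegral_ofReal
            ((integrable_exp_neg_mul_norm_sq (by positivity)).const_mul _)
            (ae_of_all _ fun t => by positivity), integral_const_mul,
          GaussianFourier.integral_rexp_neg_mul_sq_norm (by positivity), finrank_euclideanSpace_fin]
    _ = ENNReal.ofReal (M * (Real.pi * (2 * c.lip) ^ 2) ^ ((q : ℝ) / 2) *
          N ^ (-(q : ℝ) / 2)) := by
        rw [neg_div, Real.rpow_neg hN.le, ← Real.inv_rpow hN.le, mul_assoc,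
          ← Real.mul_rpow (by positivity) (by positivity), div_div_eq_mul_div, div_eq_mul_inv]

end AdaptedChart

lemma exists_lintegral_gaussian_le (h : IsRegularUpToEnds q X ν) :
    ∃ C : ℝ, 0 ≤ C ∧ ∀ N : ℝ, 0 < N → ∀ y : E n,
      ∫⁻ p, ENNReal.ofReal (Real.exp (-N * ‖(p : E n) - y‖ ^ 2)) ∂ν ≤
        ENNReal.ofReal (C * N ^ (-(q : ℝ) / 2)) := by
  obtain ⟨Z, νZ, -, hνZ, hcomp, hXZ, rfl⟩ := h
  suffices hclosure : ∃ C : ℝ, 0 ≤ C ∧ ∀ N : ℝ, 0 < N → ∀ y : E n,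
      ∫⁻ p in closure X, ENNReal.ofReal (Real.exp (-N * ‖(p : E n) - y‖ ^ 2)) ∂νZ ≤
        ENNReal.ofReal (C * N ^ (-(q : ℝ) / 2)) by
    obtain ⟨C, hC, hle⟩ := hclosure
    exact ⟨C, hC, fun N hN y => (lintegral_mono_set subset_closure).trans (hle N hN y)⟩
  refine hcomp.induction_on (p := fun s => ∃ C : ℝ, 0 ≤ C ∧ ∀ N : ℝ, 0 < N → ∀ y : E n,
    ∫⁻ p in s, ENNReal.ofReal (Real.exp (-N * ‖(p : E n) - y‖ ^ 2)) ∂νZ ≤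
      ENNReal.ofReal (C * N ^ (-(q : ℝ) / 2))) ⟨0, le_rfl, by simp⟩ ?_ ?_ ?_
  · rintro s t hst ⟨C, hC, hle⟩
    exact ⟨C, hC, fun N hN y => (lintegral_mono_set hst).trans (hle N hN y)⟩
  · rintro s t ⟨C, hC, hle⟩ ⟨C', hC', hle'⟩
    refine ⟨C + C', by positivity, fun N hN y => (lintegral_union_le _ _ _).trans ?_⟩
    rw [add_mul, ENNReal.ofReal_add (by positivity) (by positivity)]
    exact add_le_add (hle N hN y) (hle' N hN y)
  · intro x hx
    obtain ⟨c⟩ := nonempty_adaptedChart hνZ (hXZ hx)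
    exact ⟨c.param '' c.dom, nhdsWithin_mono x hXZ c.image_mem_nhdsWithin,
      c.exists_setLIntegral_gaussian_le⟩

lemma isFiniteMeasure_of_isRegularUpToEnds (h : IsRegularUpToEnds q X ν) : IsFiniteMeasure ν := by
  obtain ⟨C, -, hC⟩ := exists_lintegral_gaussian_le h
  have hexp (p : Ball n) : Real.exp (-1) ≤ Real.exp (-1 * ‖(p : E n) - 0‖ ^ 2) := by
    have := one_sub_norm_sq_pos p
    rw [sub_zero]
    gcongr
    linarith
  have hle : ENNReal.ofReal (Real.exp (-1)) * ν Set.univ < ⊤ :=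
    calc ENNReal.ofReal (Real.exp (-1)) * ν Set.univ
        = ∫⁻ _, ENNReal.ofReal (Real.exp (-1)) ∂ν := (lintegral_const _).symm
      _ ≤ ∫⁻ p, ENNReal.ofReal (Real.exp (-1 * ‖(p : E n) - 0‖ ^ 2)) ∂ν :=
          lintegral_mono fun p => ENNReal.ofReal_le_ofReal (hexp p)
      _ ≤ ENNReal.ofReal (C * 1 ^ (-(q : ℝ) / 2)) := hC 1 one_pos 0
      _ < ⊤ := ENNReal.ofReal_lt_top
  exact ⟨ENNReal.lt_top_of_mul_ne_top_right hle.ne (by simp [Real.exp_pos])⟩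

end AdaptedChart

section OverlapAsymptotics

variable {n q : ℕ}

lemma sqrt_overlap_le_exp (z w : Ball n) :
    √(overlap z w) ≤ Real.exp (-(‖(z : E n) - w‖ ^ 2 / 10)) := by
  have hdist : ‖(z : E n) - w‖ ^ 2 ≤ 4 := by
    have hle : ‖(z : E n) - w‖ ≤ 2 := by
      linarith [norm_sub_le (z : E n) w, mem_ball_zero_iff.1 z.2, mem_ball_zero_iff.1 w.2]
    nlinarith [norm_nonneg ((z : E n) - w)]
  have hinv := one_add_norm_sub_sq_le_inv_overlap z w
  set x := ‖(z : E n) - w‖ ^ 2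
  have hx : 0 ≤ x := sq_nonneg _
  rw [Real.sqrt_le_left (Real.exp_pos _).le, ← Real.exp_nat_mul]
  calc overlap z w ≤ (1 + x)⁻¹ := (le_inv_comm₀ (by positivity) (overlap_pos z w)).1 hinv
    _ ≤ 1 - x / 5 := by
      rw [inv_le_iff_one_le_mul₀ (by positivity)]
      nlinarith
    _ ≤ Real.exp (-(x / 5)) := Real.one_sub_le_exp_neg _
    _ = Real.exp ((2 : ℕ) * -(x / 10)) := by
      congr 1
      push_cast
      ring

lemma sqrt_overlap_pow_le (k : ℕ) (z w : Ball n) :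
    √(overlap z w) ^ ((n + 1) * k) ≤ Real.exp (-((k : ℝ) / 10) * ‖(z : E n) - w‖ ^ 2) :=
  calc √(overlap z w) ^ ((n + 1) * k)
      ≤ √(overlap z w) ^ k :=
        pow_le_pow_of_le_one (Real.sqrt_nonneg _) (Real.sqrt_le_one.2 (overlap_le_one z w))
          (Nat.le_mul_of_pos_left k n.succ_pos)
    _ ≤ Real.exp (-(‖(z : E n) - w‖ ^ 2 / 10)) ^ k := by
        gcongr
        exact sqrt_overlap_le_exp z w
    _ = Real.exp (-((k : ℝ) / 10) * ‖(z : E n) - w‖ ^ 2) := by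
        rw [← Real.exp_nat_mul]
        ring_nf

lemma sqrt_overlap_pow_le_of_le {ε : ℝ} (hε : 0 ≤ ε) (k : ℕ) {z w : Ball n}
    (h : ε ≤ ‖(z : E n) - w‖) :
    √(overlap z w) ^ ((n + 1) * k) ≤ Real.exp (-((k : ℝ) / 10) * ε ^ 2) := by
  refine (sqrt_overlap_pow_le k z w).trans (Real.exp_le_exp.2 ?_)
  rw [neg_mul, neg_mul, neg_le_neg_iff]
  gcongr

/-- The quadratic form of the Bergman metric at `w`, up to a constant factor. -/
def metricForm (w : Ball n) (v : E n) : ℝ :=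
  (‖v‖ ^ 2 * (1 - ‖(w : E n)‖ ^ 2) + ‖inner ℂ (w : E n) v‖ ^ 2) / (1 - ‖(w : E n)‖ ^ 2) ^ 2

lemma tendsto_mul_inv_overlap_sub_one {z : ℕ → Ball n} {w : Ball n} {v : E n}
    (hz : Tendsto z atTop (𝓝 w))
    (hv : Tendsto (fun k : ℕ => √k • ((z k : E n) - w)) atTop (𝓝 v)) :
    Tendsto (fun k : ℕ => (k : ℝ) * ((overlap (z k) w)⁻¹ - 1)) atTop (𝓝 (metricForm w v)) := by
  set b := 1 - ‖(w : E n)‖ ^ 2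
  have hb : 0 < b := one_sub_norm_sq_pos w
  have hzE : Tendsto (fun k => (z k : E n)) atTop (𝓝 w) :=
    continuous_subtype_val.continuousAt.tendsto.comp hz
  have hlim : Tendsto (fun k : ℕ => (‖√k • ((z k : E n) - w)‖ ^ 2 * b +
      ‖inner ℂ (w : E n) (√k • ((z k : E n) - w))‖ ^ 2) / ((1 - ‖(z k : E n)‖ ^ 2) * b)) atTop
      (𝓝 ((‖v‖ ^ 2 * b + ‖inner ℂ (w : E n) v‖ ^ 2) / (b * b))) :=
    (((hv.norm.pow 2).mul_const b).add ((tendsto_const_nhds.inner hv).norm.pow 2)).div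
      ((tendsto_const_nhds.sub (hzE.norm.pow 2)).mul_const b) (by positivity)
  rw [metricForm, sq (1 - _)]
  refine hlim.congr fun k => ?_
  have hinner : inner ℂ (w : E n) (√k • ((z k : E n) - w)) =
      ((√k : ℝ) : ℂ) * inner ℂ (w : E n) ((z k : E n) - w) := by
    rw [← inner_smul_right]
    rfl
  rw [hinner, norm_mul, norm_smul, Complex.norm_real, Real.norm_of_nonneg (Real.sqrt_nonneg _),
    mul_pow, mul_pow, Real.sq_sqrt k.cast_nonneg, inv_overlap]
  ring

lemma tendsto_sqrt_overlap_pow {z : ℕ → Ball n} {w : Ball n} {v : E n}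
    (hz : Tendsto z atTop (𝓝 w))
    (hv : Tendsto (fun k : ℕ => √k • ((z k : E n) - w)) atTop (𝓝 v)) :
    Tendsto (fun k => √(overlap (z k) w) ^ ((n + 1) * k)) atTop
      (𝓝 (√(Real.exp (metricForm w v))⁻¹ ^ (n + 1))) := by
  have hpow := Real.tendsto_one_add_pow_exp_of_tendsto (tendsto_mul_inv_overlap_sub_one hz hv)
  refine ((hpow.inv₀ (Real.exp_pos _).ne').sqrt.pow (n + 1)).congr fun k => ?_
  have ho := (overlap_pos (z k) w).le
  have hsqrt : √(overlap (z k) w ^ k) = √(overlap (z k) w) ^ k := by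
    rw [Real.sqrt_eq_iff_mul_self_eq (pow_nonneg ho k) (by positivity), ← mul_pow,
      Real.mul_self_sqrt ho]
  rw [add_sub_cancel, inv_pow, inv_inv, hsqrt, ← pow_mul, mul_comm]

lemma tendsto_rpow_mul_exp_neg (a : ℝ) {c : ℝ} (hc : 0 < c) :
    Tendsto (fun k : ℕ => (k : ℝ) ^ a * Real.exp (-c * k)) atTop (𝓝 0) :=
  (tendsto_rpow_mul_exp_neg_mul_atTop_nhds_zero a c hc).comp tendsto_natCast_atTop_atTop

lemma measurable_sqrt_overlap_pow (x : Ball n) (k : ℕ) :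
    Measurable fun p : Ball n => √(overlap p x) ^ k :=
  (continuous_overlap_left x).measurable.sqrt.pow_const _

lemma sqrt_overlap_pow_le_one (p x : Ball n) (k : ℕ) : √(overlap p x) ^ k ≤ 1 :=
  pow_le_one₀ (Real.sqrt_nonneg _) (Real.sqrt_le_one.2 (overlap_le_one p x))

lemma integrable_sqrt_overlap_pow (ν : Measure (Ball n)) [IsFiniteMeasure ν] (x : Ball n) (k : ℕ) :
    Integrable (fun p => √(overlap p x) ^ k) ν := by
  refine .of_bound (measurable_sqrt_overlap_pow x k).aestronglyMeasurable 1
    (ae_of_all _ fun p => ?_)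
  rw [Real.norm_of_nonneg (by positivity)]
  exact sqrt_overlap_pow_le_one p x k

namespace AdaptedChart

variable {X : Set (Ball n)} {ν : Measure (Ball n)} {x : Ball n} (c : AdaptedChart q X ν x)

/-- The integrand of `∫ cosh^{-(n+1)k}(τ(p,x)/2) dν(p)` in the coordinates of the chart centred at
`x`, extended by zero. -/
def integrand (k : ℕ) (s : EuclideanSpace ℝ (Fin q)) : ℝ :=
  c.dom.indicator (fun t => c.dens t * √(overlap (c.param t) x) ^ ((n + 1) * k)) (c.centre + s)

lemma integral_integrand (k : ℕ) :
    ∫ s, c.integrand k s = ∫ p in c.param '' c.dom, √(overlap p x) ^ ((n + 1) * k) ∂ν := by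
  rw [c.setIntegral_image (measurable_sqrt_overlap_pow x _),
    ← integral_indicator c.measurableSet_dom]
  exact integral_add_left_eq_self _ c.centre

lemma measurable_integrand (k : ℕ) : Measurable (c.integrand k) := by
  classical
  have hcont : ContinuousOn (fun t => c.dens t * √(overlap (c.param t) x) ^ ((n + 1) * k)) c.dom :=
    c.continuousOn_dens.mul
      (((continuous_overlap_left x).comp_continuousOn c.continuousOn_param).sqrt.pow _)
  have hind := hcont.measurable_piecewise (g := 0) continuousOn_const c.measurableSet_dom
  rw [Set.piecewise_eq_indicator] at hind
  exact hind.comp (measurable_const_add c.centre)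

lemma exists_abs_integrand_le : ∃ M a : ℝ, 0 < a ∧
    ∀ k s, |c.integrand k s| ≤ M * Real.exp (-(a * k) * ‖s‖ ^ 2) := by
  obtain ⟨M, hM0, hM⟩ := c.exists_dens_le
  have hlip := c.lip_pos
  refine ⟨M, (10 * c.lip ^ 2)⁻¹, by positivity, fun k s => ?_⟩
  by_cases hs : c.centre + s ∈ c.dom
  · have hnorm : ‖s‖ / c.lip ≤ ‖(c.param (c.centre + s) : E n) - x‖ := by
      have h := c.norm_sub_le_lip_mul _ hs _ c.centre_mem_dom
      rw [add_sub_cancel_left, c.param_centre] at h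
      exact (div_le_iff₀' hlip).2 h
    rw [integrand, Set.indicator_of_mem hs,
      abs_of_nonneg (mul_nonneg (c.dens_pos _ hs).le (by positivity))]
    refine mul_le_mul (hM _ hs) ((sqrt_overlap_pow_le_of_le (by positivity) k hnorm).trans_eq ?_)
      (by positivity) hM0
    congr 1
    field_simp
  · rw [integrand, Set.indicator_of_notMem hs, abs_zero]
    positivity

lemma tendsto_integrand (s : EuclideanSpace ℝ (Fin q)) :
    Tendsto (fun k : ℕ => c.integrand k ((√k)⁻¹ • s)) atTop
      (𝓝 (c.dens c.centre * √(Real.exp (metricForm x (c.deriv s)))⁻¹ ^ (n + 1))) := by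
  have hsqrt : Tendsto (fun k : ℕ => √(k : ℝ)) atTop atTop :=
    Real.tendsto_sqrt_atTop.comp tendsto_natCast_atTop_atTop
  have hcentre : Tendsto (fun k : ℕ => c.centre + (√k)⁻¹ • s) atTop (𝓝 c.centre) := by
    simpa using ((tendsto_inv_atTop_zero.comp hsqrt).smul_const s).const_add c.centre
  have hv := c.hasFDerivAt_param.lim s (c := fun k : ℕ => √k) (l := atTop)
    (tendsto_norm_atTop_atTop.comp hsqrt)
  have hz := (c.continuousOn_param.continuousAt c.dom_mem_nhds).tendsto.comp hcentre
  simp only [c.param_centre] at hv hz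
  refine (((c.continuousOn_dens.continuousAt c.dom_mem_nhds).tendsto.comp hcentre).mul
    (tendsto_sqrt_overlap_pow hz hv)).congr' ?_
  filter_upwards [hcentre c.dom_mem_nhds] with k hk
  rw [AdaptedChart.integrand, Set.indicator_of_mem (show c.centre + (√k)⁻¹ • s ∈ c.dom from hk)]
  rfl

lemma exists_tendsto_setIntegral_image : ∃ G : ℝ, 0 < G ∧
    Tendsto (fun k : ℕ => (k : ℝ) ^ ((q : ℝ) / 2) *
      ∫ p in c.param '' c.dom, √(overlap p x) ^ ((n + 1) * k) ∂ν) atTop (𝓝 G) := by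
  obtain ⟨M, a, ha, hbound⟩ := c.exists_abs_integrand_le
  obtain ⟨hint, hlim⟩ := tendsto_rpow_mul_integral ha c.measurable_integrand
    (Eventually.of_forall hbound) c.tendsto_integrand
  simp only [c.integral_integrand, finrank_euclideanSpace_fin] at hlim
  refine ⟨_, ?_, hlim⟩
  have hpos (s) : 0 < c.dens c.centre * √(Real.exp (metricForm x (c.deriv s)))⁻¹ ^ (n + 1) :=
    mul_pos (c.dens_pos _ c.centre_mem_dom) (by positivity)
  rw [integral_pos_iff_support_of_nonneg (fun s => (hpos s).le) hint,
    Function.support_eq_univ fun s => (hpos s).ne']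
  exact Measure.measure_univ_pos.2 (NeZero.ne _)

end AdaptedChart

variable {X : Set (Ball n)} {ν : Measure (Ball n)}

lemma tendsto_setIntegral_compl_sqrt_overlap_pow [IsFiniteMeasure ν] (hX : ν Xᶜ = 0)
    {S : Set (Ball n)} {x : Ball n} (hSm : MeasurableSet S) (hS : S ∈ 𝓝[X] x) (a : ℝ) :
    Tendsto (fun k : ℕ => (k : ℝ) ^ a * ∫ p in Sᶜ, √(overlap p x) ^ ((n + 1) * k) ∂ν)
      atTop (𝓝 0) := by
  obtain ⟨ε, hε, hball⟩ := Metric.mem_nhdsWithin_iff.1 hS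
  have hfar : ∀ᵐ p : Ball n ∂ν.restrict Sᶜ, ε ≤ ‖(p : E n) - x‖ := by
    filter_upwards [ae_restrict_mem hSm.compl,
      ae_restrict_of_ae (mem_ae_iff.2 hX : X ∈ ae ν)] with p hpS hpX
    by_contra! hlt
    exact hpS (hball ⟨by rwa [Metric.mem_ball, Subtype.dist_eq, dist_eq_norm], hpX⟩)
  have hzero := (tendsto_rpow_mul_exp_neg a (by positivity : 0 < ε ^ 2 / 10)).mul_const
    (ν.real Sᶜ)
  rw [zero_mul] at hzero
  refine squeeze_zero (fun k => by positivity) (fun k => ?_) hzero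
  rw [mul_assoc]
  gcongr
  refine (Real.le_norm_self _).trans
    (norm_setIntegral_le_of_norm_le_const_ae (measure_lt_top ν _) ?_)
  filter_upwards [hfar] with p hp
  rw [Real.norm_of_nonneg (by positivity)]
  refine (sqrt_overlap_pow_le_of_le hε.le k hp).trans_eq ?_
  ring_nf

lemma exists_tendsto_integral_overlap [IsFiniteMeasure ν] (hν : IsVolumeForm q X ν) {x : Ball n}
    (hx : x ∈ X) : ∃ G : ℝ, 0 < G ∧
      Tendsto (fun k : ℕ => (k : ℝ) ^ ((q : ℝ) / 2) *
        ∫ p, √(overlap p x) ^ ((n + 1) * k) ∂ν) atTop (𝓝 G) := by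
  obtain ⟨c⟩ := nonempty_adaptedChart hν hx
  obtain ⟨G, hG, hlim⟩ := c.exists_tendsto_setIntegral_image
  have hmeas := c.isCompact_image.measurableSet
  have hfar := tendsto_setIntegral_compl_sqrt_overlap_pow hν.1 hmeas c.image_mem_nhdsWithin (q / 2)
  refine ⟨G, hG, (add_zero G ▸ hlim.add hfar).congr fun k => ?_⟩
  rw [← mul_add, integral_add_compl hmeas (integrable_sqrt_overlap_pow ν x _)]

lemma exists_integral_overlap_le (h : IsRegularUpToEnds q X ν) :
    ∃ C : ℝ, ∀ k : ℕ, 0 < k → ∀ x : Ball n,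
      (k : ℝ) ^ ((q : ℝ) / 2) * ∫ p, √(overlap p x) ^ ((n + 1) * k) ∂ν ≤ C := by
  have := isFiniteMeasure_of_isRegularUpToEnds h
  obtain ⟨C, hC, hle⟩ := exists_lintegral_gaussian_le h
  refine ⟨C * (10 : ℝ) ^ ((q : ℝ) / 2), fun k hk x => ?_⟩
  have hk0 : (0 : ℝ) < k := by exact_mod_cast hk
  have hint : ∫ p, √(overlap p x) ^ ((n + 1) * k) ∂ν ≤ C * ((k : ℝ) / 10) ^ (-(q : ℝ) / 2) := by
    rw [integral_eq_lintegral_of_nonneg_ae (ae_of_all _ fun p => by positivity)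
      (integrable_sqrt_overlap_pow ν x _).1]
    exact ENNReal.toReal_le_of_le_ofReal (by positivity)
      ((lintegral_mono fun p => ENNReal.ofReal_le_ofReal (sqrt_overlap_pow_le k p x)).trans
        (hle (k / 10) (by positivity) x))
  calc (k : ℝ) ^ ((q : ℝ) / 2) * ∫ p, √(overlap p x) ^ ((n + 1) * k) ∂ν
      ≤ (k : ℝ) ^ ((q : ℝ) / 2) * (C * ((k : ℝ) / 10) ^ (-(q : ℝ) / 2)) := by gcongr
    _ = C * (10 : ℝ) ^ ((q : ℝ) / 2) := by
      rw [neg_div, Real.rpow_neg (by positivity), Real.div_rpow hk0.le (by norm_num)]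
      field_simp

end OverlapAsymptotics

section RealPairs

variable {n : ℕ} {Γ : Subgroup (SU n)}

lemma poincareTerm_one_of_inner_im_eq_zero (k : ℕ) {z p : Ball n}
    (h : (inner ℂ (p : E n) (z : E n)).im = 0) :
    poincareTerm k (1 : autGroup Γ) z p = ((√(overlap z p) ^ ((n + 1) * k) : ℝ) : ℂ) := by
  set u := (inner ℂ (p : E n) (z : E n)).re
  have hinner : inner ℂ (p : E n) (z : E n) = (u : ℂ) := Complex.ext rfl (by simpa using h)
  have hlt : 0 < 1 - u := by
    have hnorm := norm_inner_lt_one z p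
    rw [hinner, Complex.norm_real] at hnorm
    linarith [Real.le_norm_self u]
  have hterm : poincareTerm k (1 : autGroup Γ) z p = ((weight k z * weight k p *
      (bergmanConst n / (1 - u) ^ (n + 1)) ^ k : ℝ) : ℂ) := by
    rw [poincareTerm, jac_one, one_smul, one_mul, bergman_eq, hinner]
    push_cast
    rfl
  have hpos : 0 < weight k z * weight k p * (bergmanConst n / (1 - u) ^ (n + 1)) ^ k := by
    have := weight_pos k z
    have := weight_pos k p
    have := bergmanConst_pos n
    positivity
  have hnorm := norm_poincareTerm k (1 : autGroup Γ) z p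
  rw [one_smul, hterm, Complex.norm_real, Real.norm_of_nonneg hpos.le] at hnorm
  rw [hterm, hnorm]

end RealPairs

section Growth

variable {n : ℕ}

lemma tendsto_kernelReal_mul_div (q : ℕ) {f : ℕ → ℝ} {G : ℝ}
    (hf : Tendsto (fun k : ℕ => (k : ℝ) ^ ((q : ℝ) / 2) * f k) atTop (𝓝 G)) :
    Tendsto (fun k : ℕ => kernelReal n k * f k / (k : ℝ) ^ ((n : ℝ) - (q : ℝ) / 2)) atTop
      (𝓝 ((n + 1) ^ n / n.factorial * G)) := by
  refine ((tendsto_kernelReal_div_pow n).mul hf).congr' ?_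
  filter_upwards [eventually_gt_atTop 0] with k hk
  rw [Real.rpow_sub (by exact_mod_cast hk), Real.rpow_natCast]
  field_simp

lemma tendsto_rpow_mul_pow_sub {b : ℝ} (hb : 0 < b) (hb1 : b < 1) (a D : ℝ) :
    Tendsto (fun k : ℕ => (k : ℝ) ^ a * (b ^ (k - 2) * D)) atTop (𝓝 0) := by
  have h := (tendsto_rpow_mul_exp_neg a (neg_pos.2 (Real.log_neg hb hb1))).mul_const (D / b ^ 2)
  rw [zero_mul] at h
  refine h.congr' ?_
  filter_upwards [eventually_ge_atTop 2] with k hk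
  have hexp : Real.exp (- -Real.log b * k) = b ^ (k - 2) * b ^ 2 := by
    rw [neg_neg, mul_comm, Real.exp_nat_mul, Real.exp_log hb, ← pow_add, Nat.sub_add_cancel hk]
  rw [hexp]
  field_simp

end Growth

section LeadingTerm

variable {n q : ℕ} {X : Set (Ball n)} {νX νY : Measure (Ball n)} [IsFiniteMeasure νX]

/-- The double integral of `cosh^{-(n+1)k}(τ(p,y)/2)` over `X × Y`, which governs the growth of
`(Θ_X, Θ_Y)`. -/
def leadingTerm (νX νY : Measure (Ball n)) (k : ℕ) : ℝ :=
  ∫ y, ∫ p, √(overlap p y) ^ ((n + 1) * k) ∂νX ∂νY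

variable [IsFiniteMeasure νY]

lemma integrable_sqrt_overlap_pow_prod (k : ℕ) :
    Integrable (fun x : Ball n × Ball n => √(overlap x.1 x.2) ^ k) (νX.prod νY) := by
  have hm : Measurable fun x : Ball n × Ball n => overlap x.1 x.2 := continuous_overlap.measurable
  refine .of_bound (hm.sqrt.pow_const _).aestronglyMeasurable 1 (ae_of_all _ fun x => ?_)
  rw [Real.norm_of_nonneg (by positivity)]
  exact sqrt_overlap_pow_le_one x.1 x.2 k

lemma leadingTerm_eq_integral_prod (k : ℕ) : leadingTerm νX νY k =
    ∫ x : Ball n × Ball n, √(overlap x.1 x.2) ^ ((n + 1) * k) ∂(νX.prod νY) :=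
  (integral_prod_symm _ (integrable_sqrt_overlap_pow_prod _)).symm

lemma exists_tendsto_leadingTerm [NeZero νY] (hνX : IsVolumeForm q X νX)
    (hreg : IsRegularUpToEnds q X νX) (hY : ∀ᵐ y ∂νY, y ∈ X) : ∃ G : ℝ, 0 < G ∧
      Tendsto (fun k : ℕ => (k : ℝ) ^ ((q : ℝ) / 2) * leadingTerm νX νY k) atTop (𝓝 G) := by
  obtain ⟨C, hC⟩ := exists_integral_overlap_le hreg
  choose! G hGpos hG using fun y (hy : y ∈ X) => exists_tendsto_integral_overlap hνX hy
  set F : ℕ → Ball n → ℝ := fun k y =>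
    (k : ℝ) ^ ((q : ℝ) / 2) * ∫ p, √(overlap p y) ^ ((n + 1) * k) ∂νX with hF
  have hmeas (k : ℕ) : AEStronglyMeasurable (F k) νY :=
    (integrable_sqrt_overlap_pow_prod (νX := νX) _).integral_prod_right.1.const_mul _
  have hlim : ∀ᵐ y ∂νY, Tendsto (F · y) atTop (𝓝 (G y)) := hY.mono hG
  have hbound : ∀ᶠ k in atTop, ∀ y, ‖F k y‖ ≤ C := by
    filter_upwards [eventually_gt_atTop 0] with k hk y
    rw [Real.norm_of_nonneg (mul_nonneg (by positivity) (integral_nonneg fun p => by positivity))]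
    exact hC k hk y
  have hGint : Integrable G νY :=
    .of_bound (aestronglyMeasurable_of_tendsto_ae atTop hmeas hlim) C
      (hlim.mono fun y hy => le_of_tendsto hy.norm (hbound.mono fun k hk => hk y))
  refine ⟨∫ y, G y ∂νY, ?_, ?_⟩
  · have hpos : ∀ᵐ y ∂νY, 0 < G y := hY.mono hGpos
    rw [integral_pos_iff_support_of_nonneg_ae (hpos.mono fun y hy => hy.le) hGint,
      measure_congr (hpos.mono fun y hy => eq_true hy.ne' : Function.support G =ᵐ[νY] Set.univ)]
    exact Measure.measure_univ_pos.2 (NeZero.ne νY)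
  · simpa only [leadingTerm, hF, integral_const_mul] using
      tendsto_integral_filter_of_dominated_convergence (fun _ => C) (Eventually.of_forall hmeas)
        (hbound.mono fun k hk => ae_of_all _ hk) (integrable_const C) hlim

end LeadingTerm

section IdentityTerm

variable {n : ℕ} {X : Set (Ball n)} {νX νY : Measure (Ball n)} {Γ : Subgroup (SU n)}

/-- The contribution of `γ = 1` to the unfolded inner product `(Θ_X, Θ_Y)`, up to the factor
`kernelReal n k`. -/
def identityTerm (Γ : Subgroup (SU n)) (νX νY : Measure (Ball n)) (k : ℕ) : ℂ :=
  ∫ x, poincareTerm k (1 : autGroup Γ) x.2 x.1 ∂(νX.prod νY)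

variable [IsFiniteMeasure νX] [IsFiniteMeasure νY]

lemma norm_identityTerm_le (k : ℕ) : ‖identityTerm Γ νX νY k‖ ≤ leadingTerm νX νY k := by
  rw [leadingTerm_eq_integral_prod]
  refine (norm_integral_le_integral_norm _).trans_eq (integral_congr_ae (ae_of_all _ fun x => ?_))
  simp only [norm_poincareTerm, one_smul, overlap_comm x.2]

lemma identityTerm_eq_leadingTerm
    (him : ∀ x ∈ X, ∀ y ∈ X, (inner ℂ (x : E n) (y : E n)).im = 0)
    (hX : ∀ᵐ p ∂νX, p ∈ X) (hY : ∀ᵐ y ∂νY, y ∈ X) (k : ℕ) :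
    identityTerm Γ νX νY k = leadingTerm νX νY k := by
  rw [leadingTerm_eq_integral_prod, ← integral_complex_ofReal]
  refine integral_congr_ae ?_
  filter_upwards [Measure.quasiMeasurePreserving_fst.ae hX,
    Measure.quasiMeasurePreserving_snd.ae hY] with x hx₁ hx₂
  rw [poincareTerm_one_of_inner_im_eq_zero k (him _ hx₁ _ hx₂), overlap_comm]

lemma integrable_poincareTerm (g : autGroup Γ) (k : ℕ) :
    Integrable (fun x => poincareTerm k g x.2 x.1) (νX.prod νY) := by
  refine .of_bound (measurable_poincareTerm k g measurable_snd
    measurable_fst).aestronglyMeasurable 1 (ae_of_all _ fun x => ?_)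
  rw [norm_poincareTerm]
  exact sqrt_overlap_pow_le_one _ _ _

variable [DiscreteTopology Γ] {z₀ : Ball n} {m : ℕ}
  (ρ : autGroup Γ →* Matrix.unitaryGroup (Fin m) ℂ) (j : Fin m)

lemma exists_norm_innerProd_sub_le (hne : X.Nonempty) (hXF : X ⊆ dirichlet Γ z₀)
    (hd : 0 < setDist X (frontier (dirichlet Γ z₀)))
    (hX : ∀ᵐ p ∂νX, p ∈ X) (hY : ∀ᵐ y ∂νY, y ∈ X) :
    ∃ b D : ℝ, 0 < b ∧ b < 1 ∧ ∀ k : ℕ, 2 ≤ k →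
      ‖innerProd (dirichlet Γ z₀) k (theta Γ ρ νX j k) (theta Γ ρ νY j k) -
        kernelReal n k * identityTerm Γ νX νY k‖ ≤ kernelReal n k * (b ^ (k - 2) * D) := by
  obtain ⟨a, ha, ha1, hball⟩ := exists_overlap_gt_mem_dirichlet hXF hd
  obtain ⟨C, -, hC⟩ := exists_poincareBound ha ha1 hball
  have hX' : ∀ᵐ x ∂(νX.prod νY), x.1 ∈ X := Measure.quasiMeasurePreserving_fst.ae hX
  have hY' : ∀ᵐ x ∂(νX.prod νY), x.2 ∈ X := Measure.quasiMeasurePreserving_snd.ae hY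
  refine ⟨√a, C * (νX.prod νY).real Set.univ, Real.sqrt_pos.2 ha,
    (Real.sqrt_lt' one_pos).2 (by simpa using ha1), fun k hk => ?_⟩
  have hint : Integrable (fun x => normTheta ρ j k j x.2 x.1) (νX.prod νY) :=
    .of_bound (aestronglyMeasurable_normTheta ρ j hC hk j measurable_snd measurable_fst hX')
      (kernelReal n k * C) (hX'.mono fun x hx => norm_normTheta_le ρ j hC hk j x.2 hx)
  rw [innerProd_theta ρ j (isFundamentalDomain_dirichlet (hne.mono hXF)) hC hk hX hY,
    identityTerm, ← integral_const_mul,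
    ← integral_sub hint ((integrable_poincareTerm 1 k).const_mul _)]
  refine (norm_integral_le_of_norm_le_const
    (C := kernelReal n k * (√a ^ (k - 2) * C)) ?_).trans_eq (by ring)
  filter_upwards [hX', hY'] with x hx₁ hx₂
  refine norm_normTheta_sub_le ρ j hC hk hx₁ fun g hg => ?_
  by_contra! hlt
  exact smul_notMem_dirichlet (hXF hx₂) hg (hball _ hx₁ _ hlt)

lemma tendsto_innerProd_sub_div (q : ℕ) (hne : X.Nonempty) (hXF : X ⊆ dirichlet Γ z₀)
    (hd : 0 < setDist X (frontier (dirichlet Γ z₀)))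
    (hX : ∀ᵐ p ∂νX, p ∈ X) (hY : ∀ᵐ y ∂νY, y ∈ X) :
    Tendsto (fun k : ℕ => (innerProd (dirichlet Γ z₀) k (theta Γ ρ νX j k) (theta Γ ρ νY j k) -
      kernelReal n k * identityTerm Γ νX νY k) / ((k : ℝ) ^ ((n : ℝ) - (q : ℝ) / 2) : ℝ))
      atTop (𝓝 0) := by
  obtain ⟨b, D, hb, hb1, hest⟩ := exists_norm_innerProd_sub_le ρ j hne hXF hd hX hY
  have herr := tendsto_kernelReal_mul_div (n := n) q (tendsto_rpow_mul_pow_sub hb hb1 (q / 2) D)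
  rw [mul_zero] at herr
  refine squeeze_zero_norm' ?_ herr
  filter_upwards [eventually_ge_atTop 2] with k hk
  rw [norm_div, Complex.norm_real, Real.norm_of_nonneg (by positivity)]
  gcongr
  exact hest k hk

end IdentityTerm

section InnerProduct

variable {n q : ℕ} {X : Set (Ball n)} {νX νY : Measure (Ball n)} {Γ : Subgroup (SU n)}
  [IsFiniteMeasure νX] [IsFiniteMeasure νY] [DiscreteTopology Γ] {z₀ : Ball n} {m : ℕ}
  (ρ : autGroup Γ →* Matrix.unitaryGroup (Fin m) ℂ) (j : Fin m) {C : ℝ}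

lemma eventually_norm_innerProd_le (hne : X.Nonempty) (hXF : X ⊆ dirichlet Γ z₀)
    (hd : 0 < setDist X (frontier (dirichlet Γ z₀)))
    (hX : ∀ᵐ p ∂νX, p ∈ X) (hY : ∀ᵐ y ∂νY, y ∈ X)
    (hlead : Tendsto (fun k : ℕ => kernelReal n k * leadingTerm νX νY k /
      (k : ℝ) ^ ((n : ℝ) - (q : ℝ) / 2)) atTop (𝓝 C)) :
    ∀ᶠ k : ℕ in atTop, ‖innerProd (dirichlet Γ z₀) k (theta Γ ρ νX j k) (theta Γ ρ νY j k)‖ ≤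
      (C + 1) * (k : ℝ) ^ ((n : ℝ) - (q : ℝ) / 2) := by
  have hsum := (tendsto_innerProd_sub_div ρ j q hne hXF hd hX hY).norm.add hlead
  rw [norm_zero, zero_add] at hsum
  filter_upwards [hsum.eventually_lt_const (lt_add_one C), eventually_gt_atTop 0] with k hk hk0
  have hpow : 0 < (k : ℝ) ^ ((n : ℝ) - (q : ℝ) / 2) := by positivity
  rw [norm_div, Complex.norm_real, Real.norm_of_nonneg hpow.le, ← add_div, div_lt_iff₀ hpow] at hk
  refine (norm_le_norm_sub_add _ (kernelReal n k * identityTerm Γ νX νY k)).trans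
    (le_trans ?_ hk.le)
  have hker := kernelReal_pos (n := n) hk0
  rw [norm_mul, Complex.norm_real, Real.norm_of_nonneg hker.le]
  gcongr
  exact norm_identityTerm_le k

lemma tendsto_innerProd_div (hne : X.Nonempty) (hXF : X ⊆ dirichlet Γ z₀)
    (hd : 0 < setDist X (frontier (dirichlet Γ z₀)))
    (hX : ∀ᵐ p ∂νX, p ∈ X) (hY : ∀ᵐ y ∂νY, y ∈ X)
    (him : ∀ x ∈ X, ∀ y ∈ X, (inner ℂ (x : E n) (y : E n)).im = 0) (hC : C ≠ 0)
    (hlead : Tendsto (fun k : ℕ => kernelReal n k * leadingTerm νX νY k /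
      (k : ℝ) ^ ((n : ℝ) - (q : ℝ) / 2)) atTop (𝓝 C)) :
    Tendsto (fun k : ℕ => innerProd (dirichlet Γ z₀) k (theta Γ ρ νX j k) (theta Γ ρ νY j k) /
      ((C * (k : ℝ) ^ ((n : ℝ) - (q : ℝ) / 2) : ℝ) : ℂ)) atTop (𝓝 1) := by
  have hC' : (C : ℂ) ≠ 0 := Complex.ofReal_ne_zero.2 hC
  have hsum := (tendsto_innerProd_sub_div ρ j q hne hXF hd hX hY).add
    ((Complex.continuous_ofReal.tendsto C).comp hlead)
  have hlim := hsum.div_const (C : ℂ)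
  rw [zero_add, div_self hC'] at hlim
  refine hlim.congr fun k => ?_
  rw [identityTerm_eq_leadingTerm him hX hY, Function.comp_apply]
  push_cast
  rw [← add_div, sub_add_cancel, div_div, mul_comm]

end InnerProduct

end BallQuotient

open BallQuotient in
theorem theorem4p2_general {n q : ℕ} {X : Set (Ball n)} {νX νY : Measure (Ball n)}
    (hνX : IsVolumeForm q X νX) (hXreg : IsRegularUpToEnds q X νX)
    (hνY : νY Xᶜ = 0) (hYpos : 0 < νY Set.univ) (hYfin : νY Set.univ < ⊤) :
    (∃ C : ℝ, ∀ (Γ : Subgroup (SU n)), DiscreteTopology Γ → ∀ z₀ : Ball n,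
      X ⊆ dirichlet Γ z₀ → 0 < setDist X (frontier (dirichlet Γ z₀)) →
      ∀ (m : ℕ) (ρ : autGroup Γ →* Matrix.unitaryGroup (Fin m) ℂ) (j : Fin m),
        ∀ᶠ k : ℕ in atTop,
          ‖innerProd (dirichlet Γ z₀) k (theta Γ ρ νX j k) (theta Γ ρ νY j k)‖ ≤
            C * (k : ℝ) ^ ((n : ℝ) - (q : ℝ) / 2)) ∧
    ((∀ x ∈ X, ∀ y ∈ X, (inner ℂ (x : E n) (y : E n)).im = 0) →
      ∃ C : ℝ, 0 < C ∧ ∀ (Γ : Subgroup (SU n)), DiscreteTopology Γ → ∀ z₀ : Ball n,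
        X ⊆ dirichlet Γ z₀ → 0 < setDist X (frontier (dirichlet Γ z₀)) →
        ∀ (m : ℕ) (ρ : autGroup Γ →* Matrix.unitaryGroup (Fin m) ℂ) (j : Fin m),
          Tendsto (fun k : ℕ =>
            innerProd (dirichlet Γ z₀) k (theta Γ ρ νX j k) (theta Γ ρ νY j k) /
              ((C * (k : ℝ) ^ ((n : ℝ) - (q : ℝ) / 2) : ℝ) : ℂ)) atTop (𝓝 1)) := by
  have := isFiniteMeasure_of_isRegularUpToEnds hXreg
  have : IsFiniteMeasure νY := ⟨hYfin⟩
  have : NeZero νY := ⟨Measure.measure_univ_pos.1 hYpos⟩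
  have hX : ∀ᵐ p ∂νX, p ∈ X := hνX.1
  have hY : ∀ᵐ y ∂νY, y ∈ X := hνY
  have hne : X.Nonempty := hY.exists
  obtain ⟨G, hG, hGlim⟩ := exists_tendsto_leadingTerm hνX hXreg hY
  have hlead := tendsto_kernelReal_mul_div (n := n) q hGlim
  refine ⟨⟨_, fun Γ _ z₀ hXF hd m ρ j => eventually_norm_innerProd_le ρ j hne hXF hd hX hY hlead⟩,
    fun him => ⟨_, by positivity, fun Γ _ z₀ hXF hd m ρ j =>
      tendsto_innerProd_div ρ j hne hXF hd hX hY him (by positivity) hlead⟩⟩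

end

open BallQuotient in
theorem theorem4p2 (n : ℕ) (hn : 0 < n) (qX qY : ℕ) (hqX : 0 < qX) (hqY : 0 < qY)
    (X Y : Set (Ball n)) (νX νY : MeasureTheory.Measure (Ball n))
    (hX : IsSubmanifold qX X) (hY : IsSubmanifold qY Y)
    (hνX : IsVolumeForm qX X νX) (hνY : IsVolumeForm qY Y νY)
    (hXpos : 0 < νX Set.univ) (hXreg : IsRegularUpToEnds qX X νX)
    (hYpos : 0 < νY Set.univ) (hYfin : νY Set.univ < ⊤)
    (hYX : Y ⊆ X) :
    (qX ≤ n →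
      ∃ C : ℝ, ∀ (Γ : Subgroup (SU n)), IsSmoothCocompact Γ → ∀ z₀ : Ball n,
        X ⊆ dirichlet Γ z₀ → 0 < setDist X (frontier (dirichlet Γ z₀)) →
        ∀ (m : ℕ) (ρ : autGroup Γ →* Matrix.unitaryGroup (Fin m) ℂ) (j : Fin m),
          ∀ᶠ k : ℕ in Filter.atTop,
            ‖innerProd (dirichlet Γ z₀) k (theta Γ ρ νX j k) (theta Γ ρ νY j k)‖ ≤
              C * (k : ℝ) ^ ((n : ℝ) - (qX : ℝ) / 2)) ∧
    ((∀ x ∈ X, ∀ i, ((x : E n) i).im = 0) →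
      ∃ C : ℝ, 0 < C ∧ ∀ (Γ : Subgroup (SU n)), IsSmoothCocompact Γ → ∀ z₀ : Ball n,
        X ⊆ dirichlet Γ z₀ → 0 < setDist X (frontier (dirichlet Γ z₀)) →
        ∀ (m : ℕ) (ρ : autGroup Γ →* Matrix.unitaryGroup (Fin m) ℂ) (j : Fin m),
          Filter.Tendsto (fun k : ℕ =>
            innerProd (dirichlet Γ z₀) k (theta Γ ρ νX j k) (theta Γ ρ νY j k) /
              ((C * (k : ℝ) ^ ((n : ℝ) - (qX : ℝ) / 2) : ℝ) : ℂ)) Filter.atTop (nhds 1)) := by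
  obtain ⟨hbound, hlim⟩ := theorem4p2_general hνX hXreg
    (measure_mono_null (Set.compl_subset_compl.2 hYX) hνY.1) hYpos hYfin
  refine ⟨fun _ => hbound.imp fun C h Γ hΓ => h Γ hΓ.discrete, fun hreal => ?_⟩
  refine (hlim fun x hx y hy => ?_).imp fun C h => ⟨h.1, fun Γ hΓ => h.2 Γ hΓ.discrete⟩
  simp [PiLp.inner_apply, Complex.mul_im, hreal x hx, hreal y hy]
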